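/- **Setting.** Fix a sampling interval $h>0$. For $\eta$ in a set $G_\eta\subset\mathbb R^r$ let $b(\eta)\in\mathbb R$ be a drift (possibly identically $0$) and $\nu(\cdot,\eta)$ a Lévy measure on $\mathbb R$ with $\int\min(|x|,1)\,\nu(dx,\eta)<\infty$, and put $$\varphi(u,\eta)=\exp\Big(h\Big(iub(\eta)+\int_{\mathbb R}(e^{iux}-1)\,\nu(dx,\eta)\Big)\Big).$$ For $\theta\in G_\theta\subset\mathbb R^p$ let $H(\theta)\in\mathbb R^{d\times d}$, $K_0(\theta)\in\mathbb R^{d\times1}$, $L(\theta)\in\mathbb R^{1\times d}$. Let $D_\theta^*,D_\theta,D_\eta^*,D_\eta$ be compact with $\theta^*\in D_\theta^*\subset\operatorname{int}D_\theta$, $D_\theta\subset G_\theta$, $\eta^*\in D_\eta^*\subset\operatorname{int}D_\eta$, $D_\eta\subset G_\eta$. Assume that $H,K_0,L$ are three times continuously differentiable near each point of $D_\theta$ and that, for each $u\in\mathbb R$, $\varphi(u,\cdot)$ is twice continuously differentiable near each point of $D_\eta$. Let $(Z_t)_{t\in\mathbb R}$ be a two-sided Lévy process with $Z_0=0$, drift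 $b(\eta^*)$ and Lévy measure $\nu(\cdot,\eta^*)$, so that $\varphi(\cdot,\eta^*)$ is the characteristic function of $\Delta Z_n=Z_{nh}-Z_{(n-1)h}$, $n\in\mathbb Z$. The observed output is $$\Delta y=A(\theta^*,q^{-1})\Delta Z,\qquad A(\theta,q^{-1})=1+\sum_{k\ge1}L(\theta)H(\theta)^{k-1}K_0(\theta)q^{-k},$$ i.e. $\Delta y_n=\sum_{k\ge0}a_k(\theta^*)\Delta Z_{n-k}$ for all $n\in\mathbb Z$, where $a_k(\theta)$ is the coefficient of $q^{-k}$ in $A(\theta,q^{-1})$. Let $b_k(\theta)$ be the coefficients of $A(\theta,q^{-1})^{-1}=1-\sum_{k\ge1}L(\theta)(H(\theta)-K_0(\theta)L(\theta))^{k-1}K_0(\theta)q^{-k}$, and set $$\varepsilon_n(\theta)=\sum_{k=0}^{n-1}b_k(\theta)\Delta y_{n-k}\ (n\ge1),\qquad \varepsilon^{(s)}_n(\theta)=\sum_{k=0}^{\infty}b_k(\theta)\Delta y_{n-k}\ (n\in\mathbb Z).$$ Subscripts $\theta,\eta$ denote gradients, double subscripts Hessians. For an equation in a compact set $D$ depending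 on chance, an *estimator solving it* means a $D$-valued random variable which is a solution whenever there is exactly one solution in $D$ (and is arbitrary in $D$ otherwise). Write $X_N=O_M(f(N))$ if $\sup_{N\ge1}\mathbb E^{1/q}|X_N|^q/f(N)<\infty$ for every $q\ge1$. **Stage 1.** $V_{P,N}(\theta)=\frac12\sum_{n=1}^N\varepsilon_n(\theta)^2$ and $W_P(\theta)=\frac12\mathbb E[\varepsilon_n^{(s)}(\theta)^2]$. The estimator $\hat\theta_N$ solves $V_{P,N,\theta}(\theta)=0$ in $D_\theta$. **Stage 2.** For fixed reals $u'_1,\dots,u'_{M'}$ and a Hermitian positive definite $M'\times M'$ matrix $K'$, let $h^E_n(\theta,\eta)$ and $h_n^{E,(s)}(\theta,\eta)$ have entries $e^{iu'_k\varepsilon_n(\theta)}-\varphi(u'_k,\eta)$ and $e^{iu'_k\varepsilon^{(s)}_n(\theta)}-\varphi(u'_k,\eta)$. Put $V_{E,N}(\theta,\eta)=|K'^{-1/2}\frac1N\sum_{n=1}^Nh^E_n(\theta,\eta)|^2$ and $W_E(\theta,\eta)=\mathbb E|K'^{-1/2}h_n^{E,(s)}(\theta,\eta)|^2$. The estimator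 $\hat\eta_N$ solves $V_{E,N,\eta}(\hat\theta_N,\eta)=0$ in $D_\eta$. **Stage 3.** For fixed reals $u_1,\dots,u_M$ and a Hermitian positive definite $Mp\times Mp$ matrix $K$, let $h_n(\theta,\eta)\in\mathbb C^{Mp}$ consist of the blocks $(e^{iu_k\varepsilon_n(\theta)}-\varphi(u_k,\eta))\,\varepsilon_{n\theta}(\theta)$, $1\le k\le M$, and let $h^{(s)}_n$ be defined likewise with $\varepsilon^{(s)}_n$. Put $\overline h_N=\frac1N\sum_{n=1}^Nh_n$, $g(\theta,\eta)=\mathbb E[h_n^{(s)}(\theta,\eta)]$, $$V_N(\theta,\eta)=|K^{-1/2}\overline h_N(\theta,\eta)|^2,\qquad W(\theta,\eta)=g(\theta,\eta)^*K^{-1}g(\theta,\eta),\qquad R^*(\eta)=W_{\theta\theta}(\theta^*,\eta).$$ The estimator $\hat{\hat\theta}_N(\hat\eta_N)$ solves $V_{N\theta}(\theta,\hat\eta_N)=0$ in $D_\theta$. **Theorem.** Assume: 1. (Stability) For $\theta\in G_\theta$ all eigenvalues of $H(\theta)$ and of $H(\theta)-K_0(\theta)L(\theta)$ have modulus less than $1$.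 2. (Moments, zero mean) $\int_{|x|\ge1}|x|^q\,\nu(dx,\eta^*)<\infty$ for all $q\ge1$, and $\mathbb E[\Delta Z_n]=0$. 3. (Identifiability in the first two stages) $\theta^*$ is the only solution of $W_{P,\theta}(\theta)=0$ in $D_\theta$; $\eta^*$ is the only solution of $W_{E,\eta}(\theta^*,\eta)=0$ in $D_\eta$, and $W_{E,\eta\eta}(\theta^*,\eta^*)$ is nonsingular. 4. (Uniqueness in the third stage) For each $\eta\in D_\eta$ the equation $W_\theta(\theta,\eta)=0$ has exactly one solution in $D_\theta$, and this solution lies in $D_\theta^*$; moreover $R^*(\eta^*)$ is nonsingular. Then $$\hat{\hat\theta}_N(\hat\eta_N)-\theta^*=-(R^*(\eta^*))^{-1}V_{N\theta}(\theta^*,\eta^*)+O_M(N^{-1}).$$ -/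

import Mathlib

open MeasureTheory ProbabilityTheory Filter Topology
open scoped NNReal ENNReal Matrix ComplexOrder

noncomputable section

namespace LevyECF

/-- Euclidean parameter space `ℝᵖ`. -/
abbrev Vec (p : ℕ) := EuclideanSpace ℝ (Fin p)

/-- A real square matrix is (discrete-time) stable if all its complex eigenvalues have modulus
less than one. -/
def IsStable {d : ℕ} (A : Matrix (Fin d) (Fin d) ℝ) : Prop :=
  ∀ z ∈ spectrum ℂ (A.map (fun x : ℝ => (x : ℂ))), ‖z‖ < 1

/-! ### The linear system -/

/-- The matrices of a parametrised single-input single-output state-space system in innovation form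
`x (n+1) = H θ x n + K θ z n`, `y n = L θ x n + z n`, with parameter `θ ∈ ℝᵖ`, state in `ℝᵈ`,
`K θ` a column and `L θ` a row. -/
structure SystemFamily (p d : ℕ) where
  H : Vec p → Matrix (Fin d) (Fin d) ℝ
  K : Vec p → Fin d → ℝ
  L : Vec p → Fin d → ℝ

namespace SystemFamily

variable {p d : ℕ} (S : SystemFamily p d)

/-- The state matrix `H θ - K θ L θ` of the inverse system. -/
def invH (θ : Vec p) : Matrix (Fin d) (Fin d) ℝ :=
  S.H θ - Matrix.vecMulVec (S.K θ) (S.L θ)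

/-- The coefficients of `A(θ, q⁻¹) = 1 + ∑_{k ≥ 1} L H ^ (k-1) K q⁻ᵏ`. -/
def response (θ : Vec p) : ℕ → ℝ
  | 0 => 1
  | k + 1 => S.L θ ⬝ᵥ ((S.H θ ^ k) *ᵥ S.K θ)

/-- The coefficients of `A(θ, q⁻¹)⁻¹ = 1 - ∑_{k ≥ 1} L (H - K L) ^ (k-1) K q⁻ᵏ`. -/
def invResponse (θ : Vec p) : ℕ → ℝ
  | 0 => 1
  | k + 1 => -(S.L θ ⬝ᵥ ((S.invH θ ^ k) *ᵥ S.K θ))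

/-- `H`, `K`, `L` are three times continuously differentiable near each point of `D`. -/
def SmoothOn (D : Set (Vec p)) : Prop :=
  ∀ θ ∈ D, (∀ i j, ContDiffAt ℝ 3 (fun τ => S.H τ i j) θ) ∧
    (∀ i, ContDiffAt ℝ 3 (fun τ => S.K τ i) θ) ∧ (∀ i, ContDiffAt ℝ 3 (fun τ => S.L τ i) θ)

/-- Stability and inverse stability on `G`. -/
def StabilityCondition (G : Set (Vec p)) : Prop :=
  ∀ θ ∈ G, IsStable (S.H θ) ∧ IsStable (S.invH θ)

end SystemFamily

/-! ### The Lévy noise -/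

/-- A Lévy measure of finite variation type: no atom at `0` and `∫ min(|x|, 1) ν(dx) < ∞`. -/
def IsFiniteVariationLevyMeasure (ν : Measure ℝ) : Prop :=
  ν {0} = 0 ∧ ∫⁻ x, ENNReal.ofReal (min |x| 1) ∂ν < ∞

/-- The characteristic exponent `i b u + ∫ (e^{iux} - 1) ν(dx)`. -/
def charExponent (b : ℝ) (ν : Measure ℝ) (u : ℝ) : ℂ :=
  Complex.I * b * u + ∫ x : ℝ, (Complex.exp (Complex.I * u * x) - 1) ∂ν

/-- `Z` is a two-sided Lévy process, indexed by all real times, with drift `b` and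
Lévy measure `ν`. -/
structure IsLevyProcess {Ω : Type*} [MeasurableSpace Ω] (Z : ℝ → Ω → ℝ) (P : Measure Ω)
    (b : ℝ) (ν : Measure ℝ) : Prop where
  measurable : ∀ t, Measurable (Z t)
  zero : ∀ᵐ ω ∂P, Z 0 ω = 0
  indep : HasIndepIncrements Z P
  law : ∀ s t : ℝ, s ≤ t → ∀ u : ℝ,
    charFun (P.map (fun ω => Z t ω - Z s ω)) u = Complex.exp ((t - s : ℝ) * charExponent b ν u)
  cadlag : ∀ᵐ ω ∂P, ∀ t : ℝ, ContinuousWithinAt (fun s => Z s ω) (Set.Ici t) t ∧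
    ∃ l : ℝ, Tendsto (fun s => Z s ω) (𝓝[<] t) (𝓝 l)

/-- A parametrised family of drifts and Lévy measures, with parameter `η ∈ ℝʳ`. -/
structure NoiseFamily (r : ℕ) where
  b : Vec r → ℝ
  ν : Vec r → Measure ℝ

/-- `φ(u, η)`: the characteristic function of an increment over a time interval of length `h`
of the Lévy process with drift `b η` and Lévy measure `ν η`. -/
def NoiseFamily.phi {r : ℕ} (F : NoiseFamily r) (h u : ℝ) (η : Vec r) : ℂ :=
  Complex.exp (h * charExponent (F.b η) (F.ν η) u)

/-- The increment `ΔZ_n = Z (n h) - Z ((n-1) h)`. -/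
def increment {Ω : Type*} (Z : ℝ → Ω → ℝ) (h : ℝ) (n : ℤ) (ω : Ω) : ℝ :=
  Z (n * h) ω - Z ((n - 1) * h) ω

/-- `∫_{|x| ≥ 1} |x|^q ν(dx) < ∞` for all real `q ≥ 1`, and the increments have mean zero. -/
def MomentCondition {Ω : Type*} [MeasurableSpace Ω] (Z : ℝ → Ω → ℝ) (P : Measure Ω) (h : ℝ)
    (ν : Measure ℝ) : Prop :=
  (∀ q : ℝ, 1 ≤ q → ∫⁻ x in {x : ℝ | 1 ≤ |x|}, ENNReal.ofReal (|x| ^ q) ∂ν < ∞) ∧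
    ∀ n : ℤ, ∫ ω, increment Z h n ω ∂P = 0

/-! ### Observations and estimated innovations

In the rest of the file `z : ℤ → Ω → ℝ` is the noise `ΔZ` and `y : ℤ → Ω → ℝ` the output `Δy`. -/

section Innovations

variable {Ω : Type*} {p d : ℕ} (S : SystemFamily p d)

/-- The stationary output `Δy_n = ∑_{k ≥ 0} a_k(θ) ΔZ_{n-k}` of the system with parameter `θ`. -/
def output (θ : Vec p) (z : ℤ → Ω → ℝ) (n : ℤ) (ω : Ω) : ℝ :=
  ∑' k : ℕ, S.response θ k * z (n - k) ω

/-- The estimated innovations `ε_n(θ)`, `n ≥ 1`: the inverse filter is started at time `0` with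
zero initial condition, so that only `Δy_1, …, Δy_n` enter. -/
def innov (y : ℤ → Ω → ℝ) (n : ℕ) (θ : Vec p) (ω : Ω) : ℝ :=
  ∑ k ∈ Finset.range n, S.invResponse θ k * y ((n : ℤ) - k) ω

/-- The stationary innovations `ε_n^{(s)}(θ)`: the inverse filter is started at `-∞`. -/
def statInnov (y : ℤ → Ω → ℝ) (n : ℤ) (θ : Vec p) (ω : Ω) : ℝ :=
  ∑' k : ℕ, S.invResponse θ k * y (n - k) ω

/-- `ε_{nθ}(θ)`, the gradient in `θ`. -/
def innovGrad (y : ℤ → Ω → ℝ) (n : ℕ) (θ : Vec p) (ω : Ω) : Vec p :=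
  gradient (fun τ => innov S y n τ ω) θ

/-- `ε_{nθ}^{(s)}(θ)`, the gradient in `θ`. -/
def statInnovGrad (y : ℤ → Ω → ℝ) (n : ℤ) (θ : Vec p) (ω : Ω) : Vec p :=
  gradient (fun τ => statInnov S y n τ ω) θ

end Innovations

/-- `|K^{-1/2} v|² = v* K⁻¹ v` for a positive definite Hermitian weighting matrix `K`. -/
def weightedSq {ι : Type*} [Fintype ι] [DecidableEq ι] (K : Matrix ι ι ℂ) (v : ι → ℂ) : ℝ :=
  (star v ⬝ᵥ (K⁻¹ *ᵥ v)).re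

/-- The Hessian of `f` at `x`, as a linear map: the derivative of the gradient. -/
def hessian {p : ℕ} (f : Vec p → ℝ) (x : Vec p) : Vec p →L[ℝ] Vec p :=
  fderiv ℝ (gradient f) x

/-! ### First stage: prediction error method -/

section PE

variable {Ω : Type*} {p d : ℕ} (S : SystemFamily p d)

/-- `V_{P,N}(θ) = ½ ∑_{n=1}^N ε_n(θ)²`. -/
def peCost (y : ℤ → Ω → ℝ) (N : ℕ) (θ : Vec p) (ω : Ω) : ℝ :=
  (1 / 2) * ∑ n ∈ Finset.Icc 1 N, innov S y n θ ω ^ 2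

/-- `W_P(θ) = ½ E[ε_n^{(s)}(θ)²]` (the expectation does not depend on `n`). -/
def peAsympCost [MeasurableSpace Ω] (P : Measure Ω) (y : ℤ → Ω → ℝ) (θ : Vec p) : ℝ :=
  (1 / 2) * ∫ ω, statInnov S y 0 θ ω ^ 2 ∂P

end PE

/-! ### Second stage: ECF method for the noise parameters -/

section NoiseStage

variable {Ω : Type*} {p d r M : ℕ} (S : SystemFamily p d) (F : NoiseFamily r) (h : ℝ)
  (u : Fin M → ℝ)

/-- The averaged score: its `k`-th entry is
`N⁻¹ ∑_{n=1}^N (exp(i u_k ε_n(θ)) - φ(u_k, η))`. -/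
def noiseScoreMean (y : ℤ → Ω → ℝ) (N : ℕ) (θ : Vec p) (η : Vec r) (ω : Ω) : Fin M → ℂ :=
  fun k => (N : ℂ)⁻¹ * ∑ n ∈ Finset.Icc 1 N,
    (Complex.exp (Complex.I * u k * innov S y n θ ω) - F.phi h (u k) η)

/-- The stationary score `h_n^{(s)}(θ, η)`. -/
def noiseStatScore (y : ℤ → Ω → ℝ) (n : ℤ) (θ : Vec p) (η : Vec r) (ω : Ω) : Fin M → ℂ :=
  fun k => Complex.exp (Complex.I * u k * statInnov S y n θ ω) - F.phi h (u k) η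

/-- `V_{E,N}(θ, η)`. -/
def noiseCost (K : Matrix (Fin M) (Fin M) ℂ) (y : ℤ → Ω → ℝ) (N : ℕ) (θ : Vec p) (η : Vec r)
    (ω : Ω) : ℝ :=
  weightedSq K (noiseScoreMean S F h u y N θ η ω)

/-- `W_E(θ, η) = E |K^{-1/2} h_n^{(s)}(θ, η)|²` (the expectation does not depend on `n`). -/
def noiseAsympCost [MeasurableSpace Ω] (P : Measure Ω) (K : Matrix (Fin M) (Fin M) ℂ)
    (y : ℤ → Ω → ℝ) (θ : Vec p) (η : Vec r) : ℝ :=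
  ∫ ω, weightedSq K (noiseStatScore S F h u y 0 θ η ω) ∂P

end NoiseStage

/-! ### Third stage: ECF method for the system parameters -/

section SystemStage

variable {Ω : Type*} {p d r M : ℕ} (S : SystemFamily p d) (F : NoiseFamily r) (h : ℝ)
  (u : Fin M → ℝ)

/-- The averaged score `h̄_N(θ, η) ∈ ℂ^{Mp}`: its `(k, j)` entry is
`N⁻¹ ∑_{n=1}^N (exp(i u_k ε_n(θ)) - φ(u_k, η)) ∂_j ε_n(θ)`. -/
def scoreMean (y : ℤ → Ω → ℝ) (N : ℕ) (θ : Vec p) (η : Vec r) (ω : Ω) : Fin M × Fin p → ℂ :=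
  fun kj => (N : ℂ)⁻¹ * ∑ n ∈ Finset.Icc 1 N,
    (Complex.exp (Complex.I * u kj.1 * innov S y n θ ω) - F.phi h (u kj.1) η) *
      (innovGrad S y n θ ω kj.2 : ℂ)

/-- The stationary score `h_n^{(s)}(θ, η)`. -/
def statScore (y : ℤ → Ω → ℝ) (n : ℤ) (θ : Vec p) (η : Vec r) (ω : Ω) : Fin M × Fin p → ℂ :=
  fun kj => (Complex.exp (Complex.I * u kj.1 * statInnov S y n θ ω) - F.phi h (u kj.1) η) *
    (statInnovGrad S y n θ ω kj.2 : ℂ)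

/-- `g(θ, η) = E[h_n^{(s)}(θ, η)]` (the expectation does not depend on `n`). -/
def scoreExpectation [MeasurableSpace Ω] (P : Measure Ω) (y : ℤ → Ω → ℝ) (θ : Vec p)
    (η : Vec r) : Fin M × Fin p → ℂ :=
  fun kj => ∫ ω, statScore S F h u y 0 θ η ω kj ∂P

/-- `V_N(θ, η) = |K^{-1/2} h̄_N(θ, η)|²`. -/
def ecfCost (K : Matrix (Fin M × Fin p) (Fin M × Fin p) ℂ) (y : ℤ → Ω → ℝ) (N : ℕ)
    (θ : Vec p) (η : Vec r) (ω : Ω) : ℝ :=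
  weightedSq K (scoreMean S F h u y N θ η ω)

/-- `V_{Nθ}(θ, η)`, the gradient in `θ`. -/
def ecfCostGrad (K : Matrix (Fin M × Fin p) (Fin M × Fin p) ℂ) (y : ℤ → Ω → ℝ) (N : ℕ)
    (θ : Vec p) (η : Vec r) (ω : Ω) : Vec p :=
  gradient (fun τ => ecfCost S F h u K y N τ η ω) θ

/-- `W(θ, η) = g(θ, η)* K⁻¹ g(θ, η)`. -/
def ecfAsympCost [MeasurableSpace Ω] (P : Measure Ω)
    (K : Matrix (Fin M × Fin p) (Fin M × Fin p) ℂ) (y : ℤ → Ω → ℝ) (θ : Vec p)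
    (η : Vec r) : ℝ :=
  weightedSq K (scoreExpectation S F h u P y θ η)

/-- `R*(η)`: the Hessian of `W(·, η)` at the point `θ`. -/
def ecfHessian [MeasurableSpace Ω] (P : Measure Ω)
    (K : Matrix (Fin M × Fin p) (Fin M × Fin p) ℂ) (y : ℤ → Ω → ℝ) (θ : Vec p)
    (η : Vec r) : Vec p →L[ℝ] Vec p :=
  hessian (fun τ => ecfAsympCost S F h u P K y τ η) θ

end SystemStage

/-! ### Estimators and orders of magnitude -/

/-- `est` is a `D`-valued random variable solving the (random) equation `score x ω = 0`, `x ∈ D`,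
whenever this equation has exactly one solution in `D` (and arbitrary in `D` otherwise). -/
def IsRootEstimator {Ω : Type*} [MeasurableSpace Ω] {p : ℕ} (D : Set (Vec p))
    (score : Vec p → Ω → Vec p) (est : Ω → Vec p) : Prop :=
  Measurable est ∧ (∀ ω, est ω ∈ D) ∧
    ∀ ω, (∃! x, x ∈ D ∧ score x ω = 0) → score (est ω) ω = 0

/-- `X_N = O_M(f(N))`: for every `q ≥ 1`, `sup_{N ≥ 1} E^{1/q}|X_N|^q / f(N) < ∞`. -/
def IsOM {Ω : Type*} [MeasurableSpace Ω] (P : Measure Ω) {p : ℕ} (X : ℕ → Ω → Vec p)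
    (f : ℕ → ℝ) : Prop :=
  (∀ N, 1 ≤ N → AEStronglyMeasurable (X N) P) ∧
    ∀ q : ℝ≥0, 1 ≤ q → ∃ C : ℝ≥0, ∀ N, 1 ≤ N →
      eLpNorm (X N) (q : ℝ≥0∞) P ≤ C * ENNReal.ofReal (f N)

end LevyECF

end

noncomputable section

set_option linter.unusedSectionVars false
set_option maxSynthPendingDepth 3

open scoped BoundedContinuousFunction

namespace LevyECF

/-! ### Moments of sums of independent centred variables -/

section IndepSums

/-! Each estimator is a zero of a random score, and each score is built from averages of functions
of `(θ, X_n)`, where `X_n` is a random point of a Banach space not depending on `θ`. For a suitable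
`r > 1`, `θ ↦ (r^k b_k(θ))_k` is a `C³` map into bounded sequences (`SystemFamily.exists_weight`),
and `ε_n(θ)` is the pairing of this sequence with a functional `X_n`. That functional approaches,
exponentially fast, a stationary linear process driven by `ΔZ` in the dual space
(`IsNoise.isSample_startedFunctional`). Derivatives in `θ` fall on the sequence alone, so they need
no separate probabilistic argument.

For functions whose Lipschitz constants grow polynomially, averages deviate from stationary means by
`O_M(N^{-1/2})` at each point (`PL.om_norm_avg_sub`, resting on `IsNoise.exists_sum_le`) and by
`O_M(N^{-1/4})` uniformly on compact sets (`PL.exists_unif`). A unique nondegenerate zero survives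
small perturbations (`exists_root_radius`). Hence, off an event whose probability decays faster than
any power of `N`, an estimator is the unique root near the true value; on that event compactness is
enough (`OM.of_good`). This gives the rate `N^{-1/2}` in the first two stages
(`IsSetup.om_peEstimator`, `IsSetup.om_noiseEstimator`).

The decisive fact for the third stage is that the stationary innovation at `θ*` is `ΔZ_n`, while its
`θ`-derivatives involve only earlier noise, because `b_0 = 1` is constant. Hence `g(θ*, η) = 0` for
every `η`, not only for `η*` (`IsSetup.mean_scoreFun_true`). Consequently the Hessian `R*` has
Gauss-Newton form; a direction in which the gradient of the innovation degenerates lies in the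
kernel of `R*`, so nonsingularity of `R*` also gives nonsingularity of the Hessian of `W_P`; and
replacing `η*` by its estimate changes the score at `θ*` only by a product of two quantities of
order `N^{-1/2}`. Linearising the score at `θ*` therefore leaves a remainder of second order
(`norm_root_expansion_le`, `om_root_expansion`). -/

theorem exists_abs_add_pow_sub_le (n : ℕ) : ∃ c : ℝ, 0 ≤ c ∧ ∀ s d : ℝ,
    |(s + d) ^ (n + 2) - s ^ (n + 2) - (n + 2) * s ^ (n + 1) * d| ≤
      c * (|s| ^ n * |d| ^ 2 + |d| ^ (n + 2)) := by
  induction n with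
  | zero =>
    refine ⟨1, zero_le_one, fun s d => ?_⟩
    have : (s + d) ^ (0 + 2) - s ^ (0 + 2) - ((0 : ℕ) + 2) * s ^ (0 + 1) * d = d ^ 2 := by
      push_cast; ring
    rw [this, abs_pow]
    simp only [pow_zero, zero_add, one_mul]
    nlinarith [sq_nonneg |d|]
  | succ n ih =>
    obtain ⟨c, hc, h⟩ := ih
    -- With `R` the remainder for exponent `n + 2`, the next one is `(n + 2) s^(n+1) d² + (s + d)
    -- R`. The factor `4` bounds `|s| + |d|` times the old majorant, by comparing `|s|` with `|d|`.
    refine ⟨n + 2 + 4 * c, by positivity, fun s d => ?_⟩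
    set R := (s + d) ^ (n + 2) - s ^ (n + 2) - (n + 2) * s ^ (n + 1) * d with hR
    have e : (s + d) ^ (n + 1 + 2) - s ^ (n + 1 + 2) - ((n + 1 : ℕ) + 2) * s ^ (n + 1 + 1) * d
        = (n + 2) * (s ^ (n + 1) * d ^ 2) + (s + d) * R := by
      rw [hR]; push_cast; ring
    have hR' := h s d
    rw [← hR] at hR'
    have key : (|s| + |d|) * (|s| ^ n * |d| ^ 2 + |d| ^ (n + 2)) ≤
        4 * (|s| ^ (n + 1) * |d| ^ 2 + |d| ^ (n + 1 + 2)) := by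
      rcases le_total |d| |s| with hds | hds
      · have h1 : |d| ^ n ≤ |s| ^ n := pow_le_pow_left₀ (abs_nonneg d) hds n
        calc (|s| + |d|) * (|s| ^ n * |d| ^ 2 + |d| ^ (n + 2))
            = (|s| + |d|) * (|s| ^ n * |d| ^ 2 + |d| ^ n * |d| ^ 2) := by ring
          _ ≤ (|s| + |s|) * (|s| ^ n * |d| ^ 2 + |s| ^ n * |d| ^ 2) := by gcongr
          _ = 4 * (|s| ^ (n + 1) * |d| ^ 2) := by ring
          _ ≤ _ := by gcongr; exact le_add_of_nonneg_right (by positivity)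
      · have h1 : |s| ^ n ≤ |d| ^ n := pow_le_pow_left₀ (abs_nonneg s) hds n
        calc (|s| + |d|) * (|s| ^ n * |d| ^ 2 + |d| ^ (n + 2))
            = (|s| + |d|) * (|s| ^ n * |d| ^ 2 + |d| ^ n * |d| ^ 2) := by ring
          _ ≤ (|d| + |d|) * (|d| ^ n * |d| ^ 2 + |d| ^ n * |d| ^ 2) := by gcongr
          _ = 4 * (|d| ^ (n + 1 + 2)) := by ring
          _ ≤ _ := by gcongr; exact le_add_of_nonneg_left (by positivity)
    rw [e]
    calc |(n + 2) * (s ^ (n + 1) * d ^ 2) + (s + d) * R|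
        ≤ |(n + 2 : ℝ) * (s ^ (n + 1) * d ^ 2)| + |(s + d) * R| := abs_add_le _ _
      _ = (n + 2) * (|s| ^ (n + 1) * |d| ^ 2) + |s + d| * |R| := by
          rw [abs_mul, abs_mul, abs_mul, abs_pow, abs_pow, abs_of_nonneg (by positivity : (0:ℝ) ≤ n + 2)]
      _ ≤ (n + 2) * (|s| ^ (n + 1) * |d| ^ 2) +
          (|s| + |d|) * (c * (|s| ^ n * |d| ^ 2 + |d| ^ (n + 2))) := by
          gcongr; exact abs_add_le _ _
      _ = (n + 2) * (|s| ^ (n + 1) * |d| ^ 2) +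
          c * ((|s| + |d|) * (|s| ^ n * |d| ^ 2 + |d| ^ (n + 2))) := by ring
      _ ≤ (n + 2) * (|s| ^ (n + 1) * |d| ^ 2 + |d| ^ (n + 1 + 2)) +
          c * (4 * (|s| ^ (n + 1) * |d| ^ 2 + |d| ^ (n + 1 + 2))) := by
          gcongr; exact le_add_of_nonneg_right (by positivity)
      _ = _ := by ring

variable {Ω : Type*} [MeasurableSpace Ω] {P : Measure Ω}

theorem MemLp.integrable_pow [IsFiniteMeasure P] {X : Ω → ℝ} (h : ∀ q : ℝ≥0, MemLp X q P)
    (k : ℕ) : Integrable (fun ω => X ω ^ k) P := by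
  have h1 := (h k).integrable_norm_pow' (p := k)
  refine (integrable_norm_iff ((h 0).1.pow k)).1 (h1.congr (ae_of_all _ fun ω => ?_))
  simp [norm_pow]

/-- Even moments of sums of centred variables, each of which is independent of the sum of the
previous ones. -/
theorem exists_integral_sum_pow_le (P : Measure Ω) [IsProbabilityMeasure P] (m : ℕ) :
    ∃ C : ℝ, 0 ≤ C ∧ ∀ (X : ℕ → Ω → ℝ) (δ : ℝ) (n : ℕ), 0 ≤ δ →
      (∀ n, IndepFun (fun ω => ∑ i ∈ Finset.range n, X i ω) (X n) P) →
      (∀ i, ∀ q : ℝ≥0, MemLp (X i) q P) → (∀ i, ∫ ω, X i ω ∂P = 0) →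
      (∀ i, ∀ j ≤ m, ∫ ω, X i ω ^ (2 * j) ∂P ≤ δ ^ (2 * j)) →
      ∫ ω, (∑ i ∈ Finset.range n, X i ω) ^ (2 * m) ∂P ≤ C * n ^ m * δ ^ (2 * m) := by
  induction m with
  | zero => exact ⟨1, zero_le_one, fun X δ s _ _ _ _ _ => by simp⟩
  | succ m ih =>
    obtain ⟨C, hC, ih⟩ := ih
    obtain ⟨c, hc, hcd⟩ := exists_abs_add_pow_sub_le (2 * m)
    -- Inner induction on the number of summands: the term linear in the new variable has mean zero,
    -- so the `a`-th step adds at most `c (C a^m + 1) δ^(2m+2)`, and such increments sum to order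
    -- `a^(m+1)`.
    refine ⟨c * (C + 1), by positivity, fun X δ s hδ hind hmem hmean hmom => ?_⟩
    induction s with
    | zero => simp
    | succ a ihs =>
      have hSmem : ∀ q : ℝ≥0, MemLp (fun ω => ∑ i ∈ Finset.range a, X i ω) q P := fun q =>
        memLp_finsetSum _ fun i _ => hmem i q
      have hindS := hind a
      set S : Ω → ℝ := fun ω => ∑ i ∈ Finset.range a, X i ω with hS
      have hindp : ∀ k l : ℕ, IndepFun (fun ω => S ω ^ k) (fun ω => X a ω ^ l) P := fun k l =>
        hindS.comp (measurable_id.pow_const k) (measurable_id.pow_const l)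
      have hintp : ∀ k l : ℕ, Integrable (fun ω => S ω ^ k * X a ω ^ l) P := fun k l =>
        (hindp k l).integrable_mul (MemLp.integrable_pow hSmem k) (MemLp.integrable_pow (hmem a) l)
      have hprod : ∀ k l : ℕ, ∫ ω, S ω ^ k * X a ω ^ l ∂P =
          (∫ ω, S ω ^ k ∂P) * ∫ ω, X a ω ^ l ∂P := fun k l =>
        (hindp k l).integral_fun_mul_eq_mul_integral (MemLp.integrable_pow hSmem k).1
          (MemLp.integrable_pow (hmem a) l).1
      have hle : ∀ ω, (∑ i ∈ Finset.range (a + 1), X i ω) ^ (2 * (m + 1)) ≤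
          S ω ^ (2 * m + 2) + (2 * m + 2) * (S ω ^ (2 * m + 1) * X a ω ^ 1) +
            c * (S ω ^ (2 * m) * X a ω ^ 2 + X a ω ^ (2 * m + 2)) := fun ω => by
        have h1 := (abs_le.1 (hcd (S ω) (X a ω))).2
        rw [Finset.sum_range_succ]
        rw [show |S ω| ^ (2 * m) = S ω ^ (2 * m) from (even_two_mul m).pow_abs _,
          show |X a ω| ^ 2 = X a ω ^ 2 from even_two.pow_abs _,
          show |X a ω| ^ (2 * m + 2) = X a ω ^ (2 * m + 2) from
            (show Even (2 * m + 2) by exact ⟨m + 1, by ring⟩).pow_abs _] at h1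
        push_cast at h1
        rw [pow_one, show 2 * (m + 1) = 2 * m + 2 by ring]
        linarith
      have hint := ((hintp (2 * m + 2) 0).add ((hintp (2 * m + 1) 1).const_mul (2 * m + 2 : ℝ))).add
        (((hintp (2 * m) 2).add (MemLp.integrable_pow (hmem a) (2 * m + 2))).const_mul c)
      have h1 : ∫ ω, (∑ i ∈ Finset.range (a + 1), X i ω) ^ (2 * (m + 1)) ∂P ≤
          ∫ ω, S ω ^ (2 * m + 2) ∂P + c * ((∫ ω, S ω ^ (2 * m) ∂P) * ∫ ω, X a ω ^ 2 ∂P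
            + ∫ ω, X a ω ^ (2 * m + 2) ∂P) := by
        refine (integral_mono_of_nonneg (ae_of_all _ fun ω => ?_) hint
          (ae_of_all _ fun ω => ?_)).trans_eq ?_
        · exact (even_two_mul (m + 1)).pow_nonneg _
        · simpa using hle ω
        · simp only [Pi.add_apply]
          rw [integral_add, integral_add, integral_const_mul, integral_const_mul, integral_add,
            hprod, hprod, hprod]
          · simp [hmean a]
          all_goals first
            | exact hintp _ _
            | exact MemLp.integrable_pow (hmem a) _
            | exact (hintp _ _).const_mul _
            | exact (hintp _ _).add ((hintp _ _).const_mul _)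
            | exact ((hintp _ _).add (MemLp.integrable_pow (hmem a) _)).const_mul _
      have h2 := ih X δ a hδ hind hmem hmean (fun i j hj => hmom i j (by omega))
      have h3 := hmom a 1 (by omega)
      have h4 := hmom a (m + 1) le_rfl
      have hS2 : 0 ≤ ∫ ω, X a ω ^ (2 * 1) ∂P := integral_nonneg fun ω => (even_two_mul 1).pow_nonneg _
      set n : ℝ := (a : ℝ) with hn
      have hn0 : 0 ≤ n := by positivity
      have hpn : n ^ m ≤ (n + 1) ^ m := pow_le_pow_left₀ hn0 (by linarith) m
      have hp1 : (1 : ℝ) ≤ (n + 1) ^ m := one_le_pow₀ (by linarith)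
      calc _ ≤ _ := h1
        _ ≤ c * (C + 1) * n ^ (m + 1) * δ ^ (2 * (m + 1)) +
            c * (C * n ^ m * δ ^ (2 * m) * δ ^ (2 * 1) + δ ^ (2 * (m + 1))) := by
          gcongr
          exacts [ihs, h4]
        _ = (c * (C + 1) * n ^ (m + 1) + c * (C * n ^ m + 1)) * δ ^ (2 * (m + 1)) := by ring
        _ ≤ (c * (C + 1) * (n * (n + 1) ^ m) + c * (C * (n + 1) ^ m + (n + 1) ^ m))
              * δ ^ (2 * (m + 1)) := by
          rw [pow_succ' n m]; gcongr
        _ = c * (C + 1) * (↑(a + 1)) ^ (m + 1) * δ ^ (2 * (m + 1)) := by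
          push_cast; ring

end IndepSums

/-! ### Orders of magnitude -/

section OrderCalculus

variable {Ω : Type*} [MeasurableSpace Ω] {P : Measure Ω}

theorem one_le_two_mul {q : ℝ≥0} (hq : 1 ≤ q) : 1 ≤ 2 * q := by
  calc (1 : ℝ≥0) ≤ 1 * 1 := by simp
    _ ≤ 2 * q := by gcongr; norm_num

theorem eLpNorm_mul_le_two_mul {X Y : Ω → ℝ} (hX : AEStronglyMeasurable X P)
    (hY : AEStronglyMeasurable Y P) {q : ℝ≥0} (hq : 1 ≤ q) :
    eLpNorm (fun ω => X ω * Y ω) q P ≤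
      eLpNorm X (2 * q : ℝ≥0) P * eLpNorm Y (2 * q : ℝ≥0) P := by
  have hq0 : q ≠ 0 := (zero_lt_one.trans_le hq).ne'
  have : ENNReal.HolderTriple ((2 * q : ℝ≥0) : ℝ≥0∞) ((2 * q : ℝ≥0) : ℝ≥0∞) (q : ℝ≥0∞) := by
    constructor
    rw [← ENNReal.coe_inv hq0, ← ENNReal.coe_inv (by positivity), ← ENNReal.coe_add,
      ENNReal.coe_inj]
    field_simp
    norm_num
  have h := eLpNorm_smul_le_mul_eLpNorm (p := ((2 * q : ℝ≥0) : ℝ≥0∞))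
    (q := ((2 * q : ℝ≥0) : ℝ≥0∞)) (r := (q : ℝ≥0∞)) hY hX
  simpa only [smul_eq_mul] using! h

/-- A sequence of random variables with `‖X N‖_q ≤ C_q N⁻ᵃ` for every finite `q`. -/
structure OM (P : Measure Ω) (X : ℕ → Ω → ℝ) (a : ℝ) : Prop where
  meas : ∀ N, 1 ≤ N → AEStronglyMeasurable (X N) P
  bound : ∀ q : ℝ≥0, 1 ≤ q → ∃ C : ℝ≥0, ∀ N : ℕ, 1 ≤ N →
    eLpNorm (X N) q P ≤ C * ENNReal.ofReal ((N : ℝ) ^ (-a))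

namespace OM

variable {X Y : ℕ → Ω → ℝ} {a b : ℝ}

theorem mono (hY : OM P Y a) (hX : ∀ N, 1 ≤ N → AEStronglyMeasurable (X N) P)
    (h : ∀ N, 1 ≤ N → ∀ᵐ ω ∂P, |X N ω| ≤ |Y N ω|) : OM P X a := by
  refine ⟨hX, fun q hq => ?_⟩
  obtain ⟨C, hC⟩ := hY.bound q hq
  exact ⟨C, fun N hN => (eLpNorm_mono_ae (by simpa using h N hN)).trans (hC N hN)⟩

theorem of_le (hX : OM P X a) (hab : b ≤ a) : OM P X b := by
  refine ⟨hX.meas, fun q hq => ?_⟩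
  obtain ⟨C, hC⟩ := hX.bound q hq
  refine ⟨C, fun N hN => (hC N hN).trans ?_⟩
  gcongr
  exact_mod_cast hN

theorem add (hX : OM P X a) (hY : OM P Y a) : OM P (fun N ω => X N ω + Y N ω) a := by
  refine ⟨fun N hN => (hX.meas N hN).add (hY.meas N hN), fun q hq => ?_⟩
  obtain ⟨C, hC⟩ := hX.bound q hq
  obtain ⟨C', hC'⟩ := hY.bound q hq
  refine ⟨C + C', fun N hN => (eLpNorm_add_le (hX.meas N hN) (hY.meas N hN)
    (by exact_mod_cast hq)).trans ?_⟩
  rw [ENNReal.coe_add, add_mul]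
  exact add_le_add (hC N hN) (hC' N hN)

theorem mul (hX : OM P X a) (hY : OM P Y b) : OM P (fun N ω => X N ω * Y N ω) (a + b) := by
  refine ⟨fun N hN => (hX.meas N hN).mul (hY.meas N hN), fun q hq => ?_⟩
  obtain ⟨C, hC⟩ := hX.bound (2 * q) (one_le_two_mul hq)
  obtain ⟨C', hC'⟩ := hY.bound (2 * q) (one_le_two_mul hq)
  refine ⟨C * C', fun N hN => ?_⟩
  refine (eLpNorm_mul_le_two_mul (hX.meas N hN) (hY.meas N hN) hq).trans
    ((mul_le_mul' (hC N hN) (hC' N hN)).trans_eq ?_)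
  rw [ENNReal.coe_mul, neg_add, Real.rpow_add (by exact_mod_cast hN), ENNReal.ofReal_mul (by positivity)]
  ring

theorem det [IsProbabilityMeasure P] {f : ℕ → ℝ} {C : ℝ}
    (h : ∀ N : ℕ, 1 ≤ N → |f N| ≤ C * (N : ℝ) ^ (-a)) : OM P (fun N _ => f N) a := by
  refine ⟨fun N _ => aestronglyMeasurable_const, fun q hq => ⟨C.toNNReal, fun N hN => ?_⟩⟩
  rw [eLpNorm_const _ (by simpa using (zero_lt_one.trans_le hq).ne') (IsProbabilityMeasure.ne_zero P)]
  simp only [measure_univ, ENNReal.one_rpow, mul_one]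
  rw [Real.enorm_eq_ofReal_abs]
  have hC : 0 ≤ C := by
    have := (abs_nonneg _).trans (h 1 le_rfl); simpa using this
  rw [← ENNReal.ofReal_coe_nnreal, ← ENNReal.ofReal_mul (by positivity), Real.coe_toNNReal _ hC]
  exact ENNReal.ofReal_le_ofReal (h N hN)

theorem const [IsProbabilityMeasure P] (c : ℝ) : OM P (fun _ _ => c) 0 :=
  det (C := |c|) fun N _ => by simp

theorem rpow [IsProbabilityMeasure P] (a : ℝ) : OM P (fun N _ => (N : ℝ) ^ (-a)) a :=
  det (C := 1) fun N _ => by rw [one_mul, abs_of_nonneg (by positivity)]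

theorem const_mul [IsProbabilityMeasure P] (hX : OM P X a) (c : ℝ) :
    OM P (fun N ω => c * X N ω) a := by
  simpa using (const (P := P) c).mul hX

theorem abs (hX : OM P X a) : OM P (fun N ω => |X N ω|) a :=
  hX.mono (fun N hN => (hX.meas N hN).norm) fun N _ => ae_of_all _ fun ω => by simp

theorem pow [IsProbabilityMeasure P] (hX : OM P X a) (k : ℕ) :
    OM P (fun N ω => X N ω ^ k) (k * a) := by
  induction k with
  | zero => simpa using const (P := P) 1
  | succ k ih =>
    have := ih.mul hX
    simp only [pow_succ]
    convert this using 1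
    push_cast; ring

theorem sum [IsProbabilityMeasure P] {ι : Type*} (s : Finset ι) {X : ι → ℕ → Ω → ℝ}
    (h : ∀ i ∈ s, OM P (X i) a) : OM P (fun N ω => ∑ i ∈ s, X i N ω) a := by
  classical
  induction s using Finset.induction_on with
  | empty =>
    simpa using det (P := P) (a := a) (f := fun _ => 0) (C := 1)
      (fun N _ => by rw [abs_zero]; positivity)
  | insert i s hi ih =>
    simp only [Finset.sum_insert hi]
    exact (h i (Finset.mem_insert_self i s)).add (ih fun j hj => h j (Finset.mem_insert_of_mem hj))

/-- A variable is controlled by its order of magnitude on the event `|T| ≤ δ`, as the probability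
of the complement decreases faster than any power. -/
theorem of_good [IsProbabilityMeasure P] {Z G B T : ℕ → Ω → ℝ} {c δ : ℝ} (k : ℕ) (hδ : 0 < δ)
    (hZ : ∀ N, 1 ≤ N → AEStronglyMeasurable (Z N) P) (hG : OM P G a) (hB : OM P B b)
    (hT : OM P T c) (habc : a ≤ b + k * c)
    (hgood : ∀ N, 1 ≤ N → ∀ᵐ ω ∂P, |T N ω| ≤ δ → |Z N ω| ≤ |G N ω|)
    (hbad : ∀ N, 1 ≤ N → ∀ᵐ ω ∂P, |Z N ω| ≤ |B N ω|) : OM P Z a := by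
  -- The factor `(|T| / δ)^k` dominates the indicator of `|T| > δ` and is of order `N^(-k c)`.
  have h1 : OM P (fun N ω => |G N ω| + |B N ω| * (δ⁻¹ * |T N ω|) ^ k) a :=
    hG.abs.add ((hB.abs.mul ((hT.abs.const_mul δ⁻¹).pow k)).of_le habc)
  refine h1.mono hZ fun N hN => ?_
  filter_upwards [hgood N hN, hbad N hN] with ω h2 h3
  rw [abs_of_nonneg (a := |G N ω| + _) (by positivity)]
  by_cases h : |T N ω| ≤ δ
  · exact (h2 h).trans (le_add_of_nonneg_right (by positivity))
  · refine h3.trans (le_add_of_nonneg_of_le (abs_nonneg _) ?_)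
    refine le_mul_of_one_le_right (abs_nonneg _) (one_le_pow₀ ?_)
    rw [inv_mul_eq_div, one_le_div hδ]
    exact (not_le.1 h).le

end OM

/-- A family of random variables with uniformly bounded moments of every order. -/
structure MB {J : Type*} (P : Measure Ω) (X : J → Ω → ℝ) : Prop where
  meas : ∀ j, AEStronglyMeasurable (X j) P
  bound : ∀ q : ℝ≥0, 1 ≤ q → ∃ C : ℝ≥0, ∀ j, eLpNorm (X j) q P ≤ C

namespace MB

variable {J : Type*} {X Y : J → Ω → ℝ}

theorem mono (hY : MB P Y) (hX : ∀ j, AEStronglyMeasurable (X j) P)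
    (h : ∀ j, ∀ᵐ ω ∂P, |X j ω| ≤ |Y j ω|) : MB P X := by
  refine ⟨hX, fun q hq => ?_⟩
  obtain ⟨C, hC⟩ := hY.bound q hq
  exact ⟨C, fun j => (eLpNorm_mono_ae (by simpa using h j)).trans (hC j)⟩

theorem add (hX : MB P X) (hY : MB P Y) : MB P (fun j ω => X j ω + Y j ω) := by
  refine ⟨fun j => (hX.meas j).add (hY.meas j), fun q hq => ?_⟩
  obtain ⟨C, hC⟩ := hX.bound q hq
  obtain ⟨C', hC'⟩ := hY.bound q hq
  exact ⟨C + C', fun j => (eLpNorm_add_le (hX.meas j) (hY.meas j) (by exact_mod_cast hq)).trans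
    (by rw [ENNReal.coe_add]; exact add_le_add (hC j) (hC' j))⟩

theorem mul (hX : MB P X) (hY : MB P Y) : MB P (fun j ω => X j ω * Y j ω) := by
  refine ⟨fun j => (hX.meas j).mul (hY.meas j), fun q hq => ?_⟩
  obtain ⟨C, hC⟩ := hX.bound (2 * q) (one_le_two_mul hq)
  obtain ⟨C', hC'⟩ := hY.bound (2 * q) (one_le_two_mul hq)
  exact ⟨C * C', fun j => (eLpNorm_mul_le_two_mul (hX.meas j) (hY.meas j) hq).trans
    (by rw [ENNReal.coe_mul]; exact mul_le_mul' (hC j) (hC' j))⟩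

theorem const [IsProbabilityMeasure P] (c : ℝ) : MB P (fun (_ : J) (_ : Ω) => c) := by
  refine ⟨fun j => aestronglyMeasurable_const, fun q hq => ⟨‖c‖₊, fun j => ?_⟩⟩
  rw [eLpNorm_const _ (by simpa using (zero_lt_one.trans_le hq).ne') (IsProbabilityMeasure.ne_zero P)]
  simp [enorm_eq_nnnorm]

theorem pow [IsProbabilityMeasure P] (hX : MB P X) (k : ℕ) : MB P (fun j ω => X j ω ^ k) := by
  induction k with
  | zero => simpa using const (P := P) (J := J) 1
  | succ k ih => simpa only [pow_succ] using ih.mul hX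

theorem memLp [IsProbabilityMeasure P] (hX : MB P X) (j : J) (q : ℝ≥0) : MemLp (X j) q P := by
  obtain ⟨C, hC⟩ := hX.bound (max q 1) (le_max_right _ _)
  have h : MemLp (X j) (max q 1 : ℝ≥0) P := ⟨hX.meas j, (hC j).trans_lt ENNReal.coe_lt_top⟩
  exact h.mono_exponent (by exact_mod_cast le_max_left _ _)

theorem integrable [IsProbabilityMeasure P] (hX : MB P X) (j : J) : Integrable (X j) P := by
  have := hX.memLp j 1
  rwa [ENNReal.coe_one, memLp_one_iff_integrable] at this

end MB

/-- Partition into cubes of side `ε` and keep one representative from every cube that meets `D`.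
Representatives are taken inside `D` because the estimates to be discretised hold only there; the
power `p` of `ε⁻¹` decides which moments the maximal inequality uses. -/
theorem exists_finset_cover {p : ℕ} {D : Set (Vec p)} (hD : Bornology.IsBounded D) :
    ∃ C : ℝ, 1 ≤ C ∧ ∀ ε : ℝ, 0 < ε → ε ≤ 1 → ∃ t : Finset (Vec p), (∀ x ∈ t, x ∈ D) ∧
      (t.card : ℝ) ≤ (C * ε⁻¹) ^ p ∧ ∀ x ∈ D, ∃ y ∈ t, ‖x - y‖ ≤ p * ε := by
  classical
  obtain ⟨R, hR0, hR⟩ := hD.exists_pos_norm_le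
  refine ⟨2 * R + 4, by linarith, fun ε hε hε1 => ?_⟩
  set m : ℕ := ⌈R / ε⌉₊ with hm
  let cell : Vec p → Fin p → ℤ := fun x i => ⌊x i / ε⌋
  let S : Finset (Fin p → ℤ) := Fintype.piFinset fun _ => Finset.Icc (-(m : ℤ) - 1) m
  have hcell : ∀ x ∈ D, cell x ∈ S := fun x hx => by
    simp only [S, Fintype.mem_piFinset, Finset.mem_Icc, cell]
    intro i
    have h1 : |x i| ≤ R := (PiLp.norm_apply_le x i).trans (hR x hx)
    have h2 : R / ε ≤ m := Nat.le_ceil _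
    have h3 : |x i / ε| ≤ m := by
      rw [abs_div, abs_of_pos hε]; exact le_trans (by gcongr) h2
    rw [abs_le] at h3
    constructor
    · have : (-(m : ℤ) : ℤ) ≤ ⌊x i / ε⌋ := by rw [Int.le_floor]; push_cast; exact h3.1
      omega
    · have : ((⌊x i / ε⌋ : ℤ) : ℝ) ≤ ((m : ℤ) : ℝ) := (Int.floor_le _).trans (by push_cast; exact h3.2)
      exact_mod_cast this
  -- The default `0` is harmless: it either belongs to `D` or is removed by the filter below.
  let rep : (Fin p → ℤ) → Vec p := fun c => if h : ∃ x ∈ D, cell x = c then h.choose else 0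
  have hrep : ∀ x ∈ D, rep (cell x) ∈ D ∧ cell (rep (cell x)) = cell x := fun x hx => by
    have h : ∃ z ∈ D, cell z = cell x := ⟨x, hx, rfl⟩
    simp only [rep, dif_pos h]
    exact h.choose_spec
  refine ⟨(S.image rep).filter (· ∈ D), fun x hx => (Finset.mem_filter.1 hx).2, ?_, fun x hx => ?_⟩
  · have h1 : (((S.image rep).filter (· ∈ D)).card : ℝ) ≤ (S.card : ℝ) := by
      exact_mod_cast (Finset.card_filter_le _ _).trans Finset.card_image_le
    refine h1.trans ?_
    simp only [S, Fintype.card_piFinset, Finset.prod_const, Finset.card_univ, Fintype.card_fin,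
      Int.card_Icc, Nat.cast_pow]
    refine pow_le_pow_left₀ (by positivity) ?_ p
    have h2 : (((m : ℤ) + 1 - (-(m : ℤ) - 1)).toNat : ℝ) = 2 * m + 2 := by
      rw [show ((m : ℤ) + 1 - (-(m : ℤ) - 1)) = ((2 * m + 2 : ℕ) : ℤ) by push_cast; ring,
        Int.toNat_natCast]
      push_cast; rfl
    rw [h2]
    have h3 : (m : ℝ) < R / ε + 1 := Nat.ceil_lt_add_one (by positivity)
    have h4 : 1 ≤ ε⁻¹ := (one_le_inv₀ hε).2 hε1
    calc (2 * m + 2 : ℝ) ≤ 2 * (R / ε + 1) + 2 := by linarith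
      _ = 2 * R * ε⁻¹ + 4 * 1 := by ring
      _ ≤ 2 * R * ε⁻¹ + 4 * ε⁻¹ := by gcongr
      _ = _ := by ring
  · refine ⟨rep (cell x), Finset.mem_filter.2 ⟨Finset.mem_image_of_mem _ (hcell x hx),
      (hrep x hx).1⟩, ?_⟩
    have h1 : ∀ i, ‖(x - rep (cell x)) i‖ ≤ ε := fun i => by
      have h2 : ⌊x i / ε⌋ = ⌊rep (cell x) i / ε⌋ := (congrFun (hrep x hx).2 i).symm
      have h3 := Int.abs_sub_lt_one_of_floor_eq_floor h2
      rw [← sub_div, abs_div, abs_of_pos hε, div_lt_one hε] at h3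
      exact h3.le
    have h5 : ‖x - rep (cell x)‖ ≤ ∑ i, ‖(x - rep (cell x)) i‖ := by
      set v := x - rep (cell x)
      rw [EuclideanSpace.norm_eq]
      refine Real.sqrt_le_iff.2 ⟨Finset.sum_nonneg fun _ _ => norm_nonneg _, ?_⟩
      exact Finset.sum_sq_le_sq_sum_of_nonneg fun i _ => norm_nonneg _
    calc _ ≤ _ := h5
      _ ≤ ∑ i : Fin p, ε := Finset.sum_le_sum fun i _ => h1 i
      _ = p * ε := by simp

/-- The `q`-th power of a maximum is at most the sum of the `q`-th powers, so a maximum over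
finitely many variables costs only the `q`-th root of their number. -/
theorem eLpNorm_pi_le {ι : Type*} [Fintype ι] {X : ι → Ω → ℝ}
    (hX : ∀ i, AEStronglyMeasurable (X i) P) {q : ℝ≥0} (hq : q ≠ 0) {A : ℝ≥0∞}
    (h : ∀ i, eLpNorm (X i) q P ≤ A) :
    eLpNorm (fun ω => (fun i => X i ω)) q P ≤ (Fintype.card ι : ℝ≥0∞) ^ (q⁻¹ : ℝ) * A := by
  have hq0 : (0 : ℝ) < q := by positivity
  rw [eLpNorm_nnreal_eq_lintegral hq]
  have h1 : ∀ ω, ‖(fun i => X i ω)‖ₑ ^ (q : ℝ) ≤ ∑ i, ‖X i ω‖ₑ ^ (q : ℝ) := fun ω => by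
    rcases isEmpty_or_nonempty ι with hι | hι
    · have : (fun i => X i ω) = 0 := Subsingleton.elim _ _
      rw [this]; simp [hq0]
    · obtain ⟨i, -, hi⟩ := Finset.exists_max_image Finset.univ (fun i => ‖X i ω‖) Finset.univ_nonempty
      have h2 : ‖(fun i => X i ω)‖ₑ ≤ ‖X i ω‖ₑ := by
        rw [← ofReal_norm, ← ofReal_norm]
        exact ENNReal.ofReal_le_ofReal ((pi_norm_le_iff_of_nonneg (norm_nonneg _)).2
          fun j => hi j (Finset.mem_univ j))
      exact (ENNReal.rpow_le_rpow h2 hq0.le).trans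
        (Finset.single_le_sum (f := fun i => ‖X i ω‖ₑ ^ (q : ℝ)) (fun _ _ => zero_le)
          (Finset.mem_univ i))
  have h3 : ∫⁻ ω, ‖(fun i => X i ω)‖ₑ ^ (q : ℝ) ∂P ≤ Fintype.card ι * A ^ (q : ℝ) := by
    calc _ ≤ ∫⁻ ω, ∑ i, ‖X i ω‖ₑ ^ (q : ℝ) ∂P := lintegral_mono h1
      _ = ∑ i, ∫⁻ ω, ‖X i ω‖ₑ ^ (q : ℝ) ∂P :=
        lintegral_finsetSum' _ fun i _ => (hX i).enorm.pow_const _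
      _ ≤ ∑ _i : ι, A ^ (q : ℝ) := by
        refine Finset.sum_le_sum fun i _ => ?_
        have := h i
        rw [eLpNorm_nnreal_eq_lintegral hq] at this
        have := ENNReal.rpow_le_rpow this hq0.le
        rwa [← ENNReal.rpow_mul, one_div, inv_mul_cancel₀ hq0.ne', ENNReal.rpow_one] at this
      _ = _ := by simp
  calc _ ≤ (Fintype.card ι * A ^ (q : ℝ)) ^ (1 / (q : ℝ)) := ENNReal.rpow_le_rpow h3 (by positivity)
    _ = _ := by
      rw [ENNReal.mul_rpow_of_nonneg _ _ (by positivity), ← ENNReal.rpow_mul, one_div,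
        mul_inv_cancel₀ hq0.ne', ENNReal.rpow_one]

/-- A maximal inequality: pointwise rate `N^{-1/2}` and a Lipschitz constant of order one give a
uniform rate. -/
theorem exists_uniform_bound [IsProbabilityMeasure P] {p : ℕ} {D : Set (Vec p)}
    (hD : Bornology.IsBounded D) {X : ℕ → Vec p → Ω → ℝ} {ξ : ℕ → Ω → ℝ}
    (hmeas : ∀ N, 1 ≤ N → ∀ θ ∈ D, AEStronglyMeasurable (X N θ) P)
    (hX : ∀ q : ℝ≥0, 1 ≤ q → ∃ C : ℝ≥0, ∀ N : ℕ, 1 ≤ N → ∀ θ ∈ D,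
      eLpNorm (X N θ) q P ≤ C * ENNReal.ofReal ((N : ℝ) ^ (-(1 / 2) : ℝ)))
    (hξ : OM P ξ 0)
    (hlip : ∀ N, 1 ≤ N → ∀ᵐ ω ∂P, ∀ θ ∈ D, ∀ θ' ∈ D,
      |X N θ ω - X N θ' ω| ≤ ξ N ω * ‖θ - θ'‖) :
    ∃ Y : ℕ → Ω → ℝ, OM P Y (1 / 4) ∧ ∀ N, 1 ≤ N → ∀ᵐ ω ∂P, ∀ θ ∈ D, |X N θ ω| ≤ Y N ω := by
  obtain ⟨C, hC1, hC⟩ := exists_finset_cover hD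
  -- A net of mesh `N^{-1/4}`, which has of order `N^{p/4}` points.
  have hε : ∀ N : ℕ, ∃ t : Finset (Vec p), (∀ x ∈ t, x ∈ D) ∧ (1 ≤ N →
      (t.card : ℝ) ≤ (C * (N : ℝ) ^ (1 / 4 : ℝ)) ^ p ∧
      ∀ x ∈ D, ∃ y ∈ t, ‖x - y‖ ≤ p * (N : ℝ) ^ (-(1 / 4) : ℝ)) := fun N => by
    rcases Nat.lt_or_ge N 1 with hN | hN
    · exact ⟨∅, by simp, fun h => by omega⟩
    · have hN' : (1 : ℝ) ≤ N := by exact_mod_cast hN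
      obtain ⟨t, h1, h2, h3⟩ := hC ((N : ℝ) ^ (-(1 / 4) : ℝ)) (by positivity)
        (Real.rpow_le_one_of_one_le_of_nonpos hN' (by norm_num))
      refine ⟨t, h1, fun _ => ⟨?_, h3⟩⟩
      rwa [← Real.rpow_neg (by positivity), neg_neg] at h2
  choose t htD ht using hε
  let Y₁ : ℕ → Ω → ℝ := fun N ω => ‖(fun i : t N => X N i ω)‖
  have hY₁ : OM P Y₁ (1 / 4) := by
    refine ⟨fun N hN => AEStronglyMeasurable.norm (AEMeasurable.aestronglyMeasurable
      (aemeasurable_pi_lambda _ fun i => (hmeas N hN i (htD N i i.2)).aemeasurable)),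
      fun q hq => ?_⟩
    -- An exponent of at least `p` makes the cost of the maximum over the net at most `C N^{1/4}`.
    -- Against the pointwise rate `N^{-1/2}` this leaves `N^{-1/4}`, which is also the
    -- discretisation error.
    let q' : ℝ≥0 := max q p
    have hq' : 1 ≤ q' := hq.trans (le_max_left _ _)
    have hq'0 : q' ≠ 0 := (zero_lt_one.trans_le hq').ne'
    obtain ⟨C', hC'⟩ := hX q' hq'
    refine ⟨C.toNNReal * C', fun N hN => ?_⟩
    have hN' : (1 : ℝ) ≤ N := by exact_mod_cast hN
    have hm : ∀ i : t N, AEStronglyMeasurable (X N i) P := fun i => hmeas N hN i (htD N i i.2)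
    have hm' : AEStronglyMeasurable (fun ω => (fun i : t N => X N i ω)) P :=
      AEMeasurable.aestronglyMeasurable (aemeasurable_pi_lambda _ fun i => (hm i).aemeasurable)
    have hb : (1 : ℝ) ≤ C * (N : ℝ) ^ (1 / 4 : ℝ) :=
      one_le_mul_of_one_le_of_one_le hC1 (Real.one_le_rpow hN' (by norm_num))
    have hcard : ((Fintype.card (t N) : ℕ) : ℝ≥0∞) ^ ((q' : ℝ)⁻¹) ≤
        ENNReal.ofReal (C * (N : ℝ) ^ (1 / 4 : ℝ)) := by
      have h1 : ((Fintype.card (t N) : ℕ) : ℝ≥0∞) ≤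
          ENNReal.ofReal ((C * (N : ℝ) ^ (1 / 4 : ℝ)) ^ (p : ℝ)) := by
        rw [← ENNReal.ofReal_natCast]
        refine ENNReal.ofReal_le_ofReal ?_
        rw [Fintype.card_coe, Real.rpow_natCast]
        exact (ht N hN).1
      refine (ENNReal.rpow_le_rpow h1 (by positivity)).trans ?_
      rw [ENNReal.ofReal_rpow_of_nonneg (by positivity) (by positivity),
        ← Real.rpow_mul (by positivity)]
      refine ENNReal.ofReal_le_ofReal ?_
      conv_rhs => rw [← Real.rpow_one (C * (N : ℝ) ^ (1 / 4 : ℝ))]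
      refine Real.rpow_le_rpow_of_exponent_le hb ?_
      rw [← div_eq_mul_inv, div_le_one (by positivity)]
      exact_mod_cast le_max_right q (p : ℝ≥0)
    calc eLpNorm (Y₁ N) q P = eLpNorm (fun ω => (fun i : t N => X N i ω)) q P := eLpNorm_norm _
      _ ≤ eLpNorm (fun ω => (fun i : t N => X N i ω)) q' P :=
        eLpNorm_le_eLpNorm_of_exponent_le (by exact_mod_cast le_max_left _ _) hm'
      _ ≤ _ := eLpNorm_pi_le hm hq'0 fun i => hC' N hN i (htD N i i.2)
      _ ≤ ENNReal.ofReal (C * (N : ℝ) ^ (1 / 4 : ℝ)) *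
          (C' * ENNReal.ofReal ((N : ℝ) ^ (-(1 / 2) : ℝ))) := by gcongr
      _ = _ := by
        rw [ENNReal.ofReal_mul (by positivity), ENNReal.coe_mul,
          show (-(1 / 4) : ℝ) = 1 / 4 + -(1 / 2) by norm_num, Real.rpow_add (by positivity),
          ENNReal.ofReal_mul (by positivity), ENNReal.ofReal]
        ring
  refine ⟨fun N ω => Y₁ N ω + p * (|ξ N ω| * (N : ℝ) ^ (-(1 / 4) : ℝ)),
    hY₁.add (OM.const_mul (by simpa using hξ.abs.mul (OM.rpow (P := P) (1 / 4))) _), fun N hN => ?_⟩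
  filter_upwards [hlip N hN] with ω hω θ hθ
  obtain ⟨θ', hθ', hd⟩ := (ht N hN).2 θ hθ
  have h1 : |X N θ' ω| ≤ Y₁ N ω := norm_le_pi_norm (fun i : t N => X N i ω) ⟨θ', hθ'⟩
  have h2 := hω θ hθ θ' (htD N θ' hθ')
  have hp : |X N θ ω| ≤ |X N θ' ω| + ξ N ω * ‖θ - θ'‖ := by
    have := abs_sub_abs_le_abs_sub (X N θ ω) (X N θ' ω); linarith
  have h3 : ξ N ω * ‖θ - θ'‖ ≤ |ξ N ω| * (p * (N : ℝ) ^ (-(1 / 4) : ℝ)) := by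
    gcongr
    exact le_abs_self _
  linarith

end OrderCalculus

/-! ### Increments of the Lévy process -/

section Increments

theorem hasDerivAt_fwdDiff_iter {u : ℝ} (n : ℕ) {f f' : ℝ → ℂ} (hf : ∀ x, HasDerivAt f (f' x) x)
    (x : ℝ) : HasDerivAt ((fwdDiff u)^[n] f) ((fwdDiff u)^[n] f' x) x := by
  induction n generalizing f f' with
  | zero => exact hf x
  | succ n ih =>
    rw [Function.iterate_succ_apply, Function.iterate_succ_apply]
    exact ih fun y => ((hf (y + u)).comp_add_const y u).sub (hf y)

/-- Differencing commutes with differentiation, so the mean value inequality can be applied one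
difference at a time; the nodes never leave the interval on which the derivative is bounded. -/
theorem norm_fwdDiff_iter_le {R B u : ℝ} (hu : 0 ≤ u) (n : ℕ) {f : ℝ → ℂ} (hf : ContDiff ℝ n f)
    (hB : ∀ x ∈ Set.Icc (-R) R, ‖iteratedDeriv n f x‖ ≤ B) {y : ℝ} (hy : -R ≤ y)
    (hy' : y + n * u ≤ R) : ‖(fwdDiff u)^[n] f y‖ ≤ B * u ^ n := by
  induction n generalizing f y with
  | zero => simpa using hB y ⟨hy, by simpa using hy'⟩
  | succ n ih =>
    have hf1 : ∀ x, HasDerivAt f (deriv f x) x := fun x =>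
      (hf.differentiable (by simp)).differentiableAt.hasDerivAt
    have hf2 : ContDiff ℝ n (deriv f) := (contDiff_succ_iff_deriv.1 hf).2.2
    rw [Function.iterate_succ_apply']
    have h1 : ∀ s ∈ Set.Icc y (y + u), ‖(fwdDiff u)^[n] (deriv f) s‖ ≤ B * u ^ n := fun s hs => by
      refine ih hf2 (fun x hx => ?_) (hy.trans hs.1) ?_
      · rw [← iteratedDeriv_succ']; exact hB x hx
      · push_cast at hy'; linarith [hs.2]
    have h2 := (convex_Icc y (y + u)).norm_image_sub_le_of_norm_hasDerivWithin_le
      (f := (fwdDiff u)^[n] f) (f' := (fwdDiff u)^[n] (deriv f)) (C := B * u ^ n)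
      (fun s _ => (hasDerivAt_fwdDiff_iter n hf1 s).hasDerivWithinAt) h1
      (Set.left_mem_Icc.2 (by linarith)) (Set.right_mem_Icc.2 (by linarith))
    rw [fwdDiff]
    refine h2.trans_eq ?_
    rw [add_sub_cancel_left, Real.norm_of_nonneg hu]; ring

theorem fwdDiff_iter_charFun (μ : Measure ℝ) [IsProbabilityMeasure μ] (u : ℝ) (n : ℕ) (y : ℝ) :
    (fwdDiff u)^[n] (charFun μ) y =
      ∫ x, Complex.exp (y * x * Complex.I) * (Complex.exp (u * x * Complex.I) - 1) ^ n ∂μ := by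
  have hint : ∀ (n : ℕ) (y : ℝ), Integrable (fun x : ℝ => Complex.exp (y * x * Complex.I) *
      (Complex.exp (u * x * Complex.I) - 1) ^ n) μ := fun n y => by
    refine Integrable.of_bound (C := 2 ^ n) (by fun_prop) (ae_of_all _ fun x => ?_)
    rw [norm_mul, norm_pow, ← Complex.ofReal_mul, Complex.norm_exp_ofReal_mul_I, one_mul,
      ← Complex.ofReal_mul]
    refine pow_le_pow_left₀ (norm_nonneg _) ((norm_sub_le _ _).trans ?_) n
    rw [Complex.norm_exp_ofReal_mul_I]; norm_num
  induction n generalizing y with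
  | zero => simp [charFun_apply_real]
  | succ n ih =>
    rw [Function.iterate_succ_apply', fwdDiff, ih, ih, ← integral_sub (hint n _) (hint n _)]
    congr 1
    ext x
    push_cast
    rw [show ((y : ℂ) + u) * x * Complex.I = y * x * Complex.I + u * x * Complex.I by ring,
      Complex.exp_add]
    ring

/-- Centring a difference of even order makes its integrand real and of constant sign. Thus the
`2m`-th difference of a characteristic function based at `-m u` is, up to sign, the integral of a
nonnegative function. -/
theorem exp_mul_sub_one_pow (m : ℕ) (t : ℝ) :
    Complex.exp (-(m * t : ℝ) * Complex.I) * (Complex.exp (t * Complex.I) - 1) ^ (2 * m) =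
      (-1) ^ m * ((‖Complex.exp (t * Complex.I) - 1‖ ^ (2 * m) : ℝ) : ℂ) := by
  have h1 : Complex.exp (-t * Complex.I) * (Complex.exp (t * Complex.I) - 1) ^ 2 =
      -((‖Complex.exp (t * Complex.I) - 1‖ ^ 2 : ℝ) : ℂ) := by
    have h2 : ((‖Complex.exp (t * Complex.I) - 1‖ ^ 2 : ℝ) : ℂ) =
        (Complex.exp (t * Complex.I) - 1) * (Complex.exp (-t * Complex.I) - 1) := by
      rw [← Complex.normSq_eq_norm_sq, Complex.normSq_eq_conj_mul_self, map_sub, map_one,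
        ← Complex.exp_conj]
      simp [mul_comm]
    rw [h2]
    have h3 : Complex.exp (-t * Complex.I) * Complex.exp (t * Complex.I) = 1 := by
      rw [← Complex.exp_add]; simp
    linear_combination (Complex.exp (t * Complex.I) - 1) * h3
  have h4 : Complex.exp (-(m * t : ℝ) * Complex.I) = Complex.exp (-t * Complex.I) ^ m := by
    rw [← Complex.exp_nat_mul]; push_cast; ring_nf
  rw [h4, pow_mul, ← mul_pow, h1, neg_pow]
  push_cast
  rw [pow_mul]

/-- A distribution with a smooth characteristic function has moments of all orders. -/
theorem lintegral_pow_lt_top_of_contDiff_charFun (μ : Measure ℝ) [IsProbabilityMeasure μ] (m : ℕ)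
    (h : ContDiff ℝ (2 * m : ℕ) (charFun μ)) : ∫⁻ x, ENNReal.ofReal (|x| ^ (2 * m)) ∂μ < ∞ := by
  obtain ⟨B, hB⟩ := (isCompact_Icc (a := -(m : ℝ)) (b := m)).exists_bound_of_continuousOn
    (h.continuous_iteratedDeriv (2 * m) (by simp)).continuousOn
  let u : ℕ → ℝ := fun k => 1 / ((k : ℝ) + 1)
  have hu0 : ∀ k, 0 < u k := fun k => by positivity
  have hu1 : ∀ k, u k ≤ 1 := fun k => by
    simp only [u]; rw [div_le_one (by positivity)]; linarith [(Nat.cast_nonneg k : (0 : ℝ) ≤ k)]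
  -- The integral of `g k` is a normalised central difference of the characteristic function, hence
  -- bounded by its `2m`-th derivative. Since `g k x → |x|^(2m)`, Fatou's lemma bounds the moment.
  let g : ℕ → ℝ → ℝ := fun k x => (‖Complex.exp ((u k * x : ℝ) * Complex.I) - 1‖ / u k) ^ (2 * m)
  have hg : ∀ k, Continuous (g k) := fun k => by fun_prop
  have hlim : ∀ x : ℝ, Tendsto (fun k => g k x) atTop (𝓝 (|x| ^ (2 * m))) := fun x => by
    refine Tendsto.pow ?_ _
    have h1 : HasDerivAt (fun s : ℝ => Complex.exp ((s * x : ℝ) * Complex.I)) (x * Complex.I) 0 := by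
      have h2 : HasDerivAt (fun s : ℝ => ((s * x : ℝ) : ℂ) * Complex.I) (x * Complex.I) 0 := by
        have := ((hasDerivAt_id (0 : ℝ)).mul_const x).ofReal_comp.mul_const Complex.I
        simpa using this
      have := h2.cexp
      simpa using this
    have h3 : Tendsto u atTop (𝓝[≠] 0) := by
      refine tendsto_nhdsWithin_iff.2 ⟨tendsto_one_div_add_atTop_nhds_zero_nat,
        Eventually.of_forall fun k => (hu0 k).ne'⟩
    have h4 := ((hasDerivAt_iff_tendsto_slope.1 h1).comp h3).norm
    refine (h4.congr fun k => ?_).trans_eq ?_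
    · simp only [Function.comp, slope, vsub_eq_sub, sub_zero, norm_smul, norm_inv]
      rw [Real.norm_of_nonneg (hu0 k).le]
      simp [div_eq_inv_mul]
    · simp
  have hint : ∀ k, ∫⁻ x, ENNReal.ofReal (g k x) ∂μ ≤ ENNReal.ofReal B := fun k => by
    have hgi : Integrable (g k) μ := by
      refine Integrable.of_bound (C := (2 / u k) ^ (2 * m)) (hg k).aestronglyMeasurable
        (ae_of_all _ fun x => ?_)
      simp only [g, norm_pow, norm_div, norm_norm]
      rw [Real.norm_of_nonneg (hu0 k).le]
      have : ‖Complex.exp ((u k * x : ℝ) * Complex.I) - 1‖ ≤ 2 := by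
        refine (norm_sub_le _ _).trans ?_
        rw [Complex.norm_exp_ofReal_mul_I]; norm_num
      have := hu0 k
      gcongr
    have hg0 : ∀ x, 0 ≤ g k x := fun x => (even_two_mul m).pow_nonneg _
    rw [← ofReal_integral_eq_lintegral_ofReal hgi (ae_of_all _ hg0)]
    refine ENNReal.ofReal_le_ofReal ?_
    have h1 := norm_fwdDiff_iter_le (R := m) (y := -(m * u k)) (hu0 k).le (2 * m) h hB
      (by nlinarith [hu1 k, (Nat.cast_nonneg m : (0 : ℝ) ≤ m)])
      (by push_cast; nlinarith [hu1 k, (Nat.cast_nonneg m : (0 : ℝ) ≤ m)])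
    rw [fwdDiff_iter_charFun] at h1
    have h2 : ∀ x : ℝ, Complex.exp ((-(m * u k) : ℝ) * x * Complex.I) *
        (Complex.exp (u k * x * Complex.I) - 1) ^ (2 * m) =
        (-1) ^ m * (((u k) ^ (2 * m) * g k x : ℝ) : ℂ) := fun x => by
      have h3 := exp_mul_sub_one_pow m (u k * x)
      have h4 : (u k) ^ (2 * m) * g k x = ‖Complex.exp ((u k * x : ℝ) * Complex.I) - 1‖ ^ (2 * m) := by
        simp only [g]
        rw [← mul_pow, mul_div_cancel₀ _ (hu0 k).ne']
      rw [h4, ← h3]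
      push_cast
      ring_nf
    simp_rw [h2] at h1
    rw [integral_const_mul, norm_mul, norm_pow, norm_neg, norm_one, one_pow, one_mul,
      integral_complex_ofReal, Complex.norm_real, integral_const_mul, norm_mul,
      Real.norm_of_nonneg (pow_nonneg (hu0 k).le _), mul_comm B] at h1
    exact (le_abs_self _).trans (le_of_mul_le_mul_left h1 (pow_pos (hu0 k) _))
  calc ∫⁻ x, ENNReal.ofReal (|x| ^ (2 * m)) ∂μ
      = ∫⁻ x, liminf (fun k => ENNReal.ofReal (g k x)) atTop ∂μ := by
        refine lintegral_congr fun x => ?_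
        exact ((ENNReal.continuous_ofReal.tendsto _).comp (hlim x)).liminf_eq.symm
    _ ≤ liminf (fun k => ∫⁻ x, ENNReal.ofReal (g k x) ∂μ) atTop :=
        lintegral_liminf_le fun k => (hg k).measurable.ennreal_ofReal
    _ ≤ ENNReal.ofReal B := by
        refine (liminf_le_liminf (Eventually.of_forall hint)).trans_eq ?_
        simp
    _ < ∞ := ENNReal.ofReal_lt_top

/-- Small jumps satisfy `|x|^k ≤ |x|` because `k ≥ 1`; large jumps are covered by the moment
condition. -/
theorem integrable_abs_pow_levy {ν : Measure ℝ} (hν : IsFiniteVariationLevyMeasure ν)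
    (hm : ∀ q : ℝ, 1 ≤ q → ∫⁻ x in {x : ℝ | 1 ≤ |x|}, ENNReal.ofReal (|x| ^ q) ∂ν < ∞) {k : ℕ}
    (hk : 1 ≤ k) : Integrable (fun x : ℝ => |x| ^ k) ν := by
  refine ⟨by fun_prop, ?_⟩
  have hle : ∀ x : ℝ, ‖|x| ^ k‖ₑ ≤ ENNReal.ofReal (min |x| 1) +
      {x : ℝ | 1 ≤ |x|}.indicator (fun x => ENNReal.ofReal (|x| ^ (k : ℝ))) x := fun x => by
    rw [Real.enorm_of_nonneg (by positivity)]
    by_cases hx : 1 ≤ |x|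
    · rw [Set.indicator_of_mem (by exact hx), Real.rpow_natCast]
      exact le_add_self
    · refine le_add_right (ENNReal.ofReal_le_ofReal ?_)
      rw [min_eq_left (not_le.1 hx).le]
      exact (pow_le_pow_of_le_one (abs_nonneg x) (not_le.1 hx).le hk).trans_eq (pow_one _)
  have hs : MeasurableSet {x : ℝ | 1 ≤ |x|} := measurableSet_le measurable_const (by fun_prop)
  refine (lintegral_mono hle).trans_lt ?_
  rw [lintegral_add_left (by fun_prop), lintegral_indicator hs]
  exact ENNReal.add_lt_top.2 ⟨hν.2, hm k (by exact_mod_cast hk)⟩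

/-- Differentiation under the integral sign. From the first derivative on, the integrand carries a
factor `x^k` with `k ≥ 1` and is integrable; at order zero the measure may be infinite and the
compensating `-1` is needed, so that step is done separately. -/
theorem contDiff_charExponent {ν : Measure ℝ} (hν : IsFiniteVariationLevyMeasure ν)
    (hm : ∀ q : ℝ, 1 ≤ q → ∫⁻ x in {x : ℝ | 1 ≤ |x|}, ENNReal.ofReal (|x| ^ q) ∂ν < ∞) (b : ℝ)
    (n : ℕ) : ContDiff ℝ n (charExponent b ν) := by
  let J : ℕ → ℝ → ℂ := fun k u => ∫ x : ℝ, (Complex.I * x) ^ k * Complex.exp (Complex.I * u * x) ∂ν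
  have hn : ∀ (u x : ℝ), ‖Complex.exp (Complex.I * u * x)‖ = 1 := fun u x => by
    rw [show Complex.I * u * x = ((u * x : ℝ) : ℂ) * Complex.I by push_cast; ring,
      Complex.norm_exp_ofReal_mul_I]
  have hexp : ∀ (u x : ℝ), HasDerivAt (fun s : ℝ => Complex.exp (Complex.I * s * x))
      (Complex.I * x * Complex.exp (Complex.I * u * x)) u := fun u x => by
    have h1 : HasDerivAt (fun s : ℝ => Complex.I * s * x) (Complex.I * x) u := by
      have := (((hasDerivAt_id u).ofReal_comp).const_mul Complex.I).mul_const (x : ℂ)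
      simpa using this
    simpa [mul_comm] using h1.cexp
  have hJint : ∀ k, 1 ≤ k → ∀ u : ℝ, Integrable (fun x : ℝ => (Complex.I * x) ^ k *
      Complex.exp (Complex.I * u * x)) ν := fun k hk u => by
    refine (integrable_abs_pow_levy hν hm hk).mono' (by fun_prop) (ae_of_all _ fun x => ?_)
    simp [norm_pow, hn]
  have hJ : ∀ k, 1 ≤ k → ∀ u, HasDerivAt (J k) (J (k + 1) u) u := fun k hk u => by
    refine (hasDerivAt_integral_of_dominated_loc_of_deriv_le (bound := fun x => |x| ^ (k + 1))
      (F := fun (u x : ℝ) => (Complex.I * x) ^ k * Complex.exp (Complex.I * u * x))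
      (F' := fun (u x : ℝ) => (Complex.I * x) ^ (k + 1) * Complex.exp (Complex.I * u * x))
      (Metric.ball_mem_nhds u one_pos) (Eventually.of_forall fun s => by fun_prop) (hJint k hk u)
      (by fun_prop) (ae_of_all _ fun x s _ => ?_) (integrable_abs_pow_levy hν hm (by omega))
      (ae_of_all _ fun x s _ => ?_)).2
    · simp [norm_pow, hn]
    · have := (hexp s x).const_mul ((Complex.I * x) ^ k)
      convert! this using 1
      ring
  have h0 : ∀ u, HasDerivAt (charExponent b ν) (Complex.I * b + J 1 u) u := fun u => by
    have h1 : HasDerivAt (fun u : ℝ => Complex.I * b * u) (Complex.I * b) u := by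
      have := ((hasDerivAt_id u).ofReal_comp).const_mul (Complex.I * b)
      simpa using this
    refine h1.add (hasDerivAt_integral_of_dominated_loc_of_deriv_le (bound := fun x => |x| ^ 1)
      (F := fun (u x : ℝ) => Complex.exp (Complex.I * u * x) - 1)
      (F' := fun (u x : ℝ) => (Complex.I * x) ^ 1 * Complex.exp (Complex.I * u * x))
      (Metric.ball_mem_nhds u one_pos) (Eventually.of_forall fun s => by fun_prop) ?_
      (by fun_prop) (ae_of_all _ fun x s _ => ?_) (integrable_abs_pow_levy hν hm le_rfl)
      (ae_of_all _ fun x s _ => ?_)).2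
    · refine ((integrable_abs_pow_levy hν hm le_rfl).const_mul |u|).mono' (by fun_prop)
        (ae_of_all _ fun x => ?_)
      rw [show Complex.I * u * x = Complex.I * ((u * x : ℝ) : ℂ) by push_cast; ring]
      refine (Real.norm_exp_I_mul_ofReal_sub_one_le).trans_eq ?_
      simp
    · simp [hn]
    · have := (hexp s x).sub_const 1
      convert! this using 1
      ring
  have hJc : ∀ (n : ℕ) (k : ℕ), 1 ≤ k → ContDiff ℝ n (J k) := by
    intro n
    induction n with
    | zero =>
      intro k hk
      exact contDiff_zero.2 (continuous_iff_continuousAt.2 fun u => (hJ k hk u).continuousAt)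
    | succ n ih =>
      intro k hk
      push_cast
      refine contDiff_succ_iff_deriv.2 ⟨fun u => (hJ k hk u).differentiableAt, by simp, ?_⟩
      rw [show deriv (J k) = J (k + 1) from funext fun u => (hJ k hk u).deriv]
      exact ih (k + 1) (by omega)
  cases n with
  | zero => exact contDiff_zero.2 (continuous_iff_continuousAt.2 fun u => (h0 u).continuousAt)
  | succ n =>
    push_cast
    refine contDiff_succ_iff_deriv.2 ⟨fun u => (h0 u).differentiableAt, by simp, ?_⟩
    rw [show deriv (charExponent b ν) = fun u => Complex.I * b + J 1 u from
      funext fun u => (h0 u).deriv]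
    exact contDiff_const.add (hJc n 1 le_rfl)

variable {Ω : Type*} [MeasurableSpace Ω] {P : Measure Ω} {Z : ℝ → Ω → ℝ} {b : ℝ} {ν : Measure ℝ}

theorem IsLevyProcess.measurable_increment (hZ : IsLevyProcess Z P b ν) (h : ℝ) (n : ℤ) :
    Measurable (increment Z h n) := (hZ.measurable _).sub (hZ.measurable _)

theorem IsLevyProcess.charFun_increment (hZ : IsLevyProcess Z P b ν) {h : ℝ} (hh : 0 < h) (n : ℤ)
    (u : ℝ) : charFun (P.map (increment Z h n)) u = Complex.exp (h * charExponent b ν u) := by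
  have := hZ.law ((n - 1) * h) (n * h) (by nlinarith) u
  rw [show ((n : ℝ) * h - (n - 1) * h) = h by ring] at this
  exact this

theorem IsLevyProcess.map_increment [IsProbabilityMeasure P] (hZ : IsLevyProcess Z P b ν) {h : ℝ}
    (hh : 0 < h) (n m : ℤ) : P.map (increment Z h n) = P.map (increment Z h m) := by
  have := Measure.isProbabilityMeasure_map (μ := P) (hZ.measurable_increment h n).aemeasurable
  have := Measure.isProbabilityMeasure_map (μ := P) (hZ.measurable_increment h m).aemeasurable
  refine Measure.ext_of_charFun (funext fun u => ?_)
  rw [hZ.charFun_increment hh, hZ.charFun_increment hh]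

theorem IsLevyProcess.iIndepFun_increment (hZ : IsLevyProcess Z P b ν) {h : ℝ} (hh : 0 < h) :
    iIndepFun (increment Z h) P := by
  refine iIndepFun_iff_finset.2 fun s => ?_
  -- Independence of increments is available along monotone sequences of times indexed by `ℕ`; a
  -- finite set of integers is shifted there by a lower bound `K`.
  obtain ⟨K, hK⟩ : ∃ K : ℤ, ∀ n ∈ s, K < n := by
    obtain ⟨K, hK⟩ := s.bddBelow
    exact ⟨K - 1, fun n hn => by have := hK hn; omega⟩
  have h1 := hZ.indep.nat (t := fun i : ℕ => ((i : ℝ) + K) * h)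
    (fun i j hij => by
      have : (i : ℝ) ≤ j := by exact_mod_cast hij
      simp only
      gcongr)
  -- The `i`-th increment runs from `(i + K) h` to `(i + 1 + K) h`, so it is `ΔZ_n` for `n = i + K +
  -- 1`.
  let g : s → ℕ := fun n => (n.1 - 1 - K).toNat
  have hg : ∀ n : s, ((g n : ℕ) : ℤ) = n.1 - 1 - K := fun n =>
    Int.toNat_of_nonneg (by have := hK n.1 n.2; omega)
  have hinj : Function.Injective g := fun n m hnm => by
    have h2 := hg n; have h3 := hg m; rw [hnm] at h2
    exact Subtype.ext (by omega)
  have h2 := h1.precomp hinj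
  convert h2 using 1
  ext n ω
  have h3 : ((g n : ℕ) : ℝ) = (n.1 : ℝ) - 1 - K := by exact_mod_cast congrArg (Int.cast (R := ℝ)) (hg n)
  simp only [Finset.restrict, increment, Nat.cast_add, Nat.cast_one, h3]
  congr 3 <;> ring

/-- The moments of the Lévy measure make the exponent smooth, hence also the characteristic function
of an increment, and smoothness yields the even moments. -/
theorem IsLevyProcess.memLp_increment [IsProbabilityMeasure P] (hZ : IsLevyProcess Z P b ν) {h : ℝ}
    (hh : 0 < h) (hν : IsFiniteVariationLevyMeasure ν) (hm : MomentCondition Z P h ν) (n : ℤ)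
    (q : ℝ≥0) : MemLp (increment Z h n) q P := by
  have := Measure.isProbabilityMeasure_map (μ := P) (hZ.measurable_increment h n).aemeasurable
  obtain ⟨m, hqm⟩ := exists_nat_ge q
  have h1 : ContDiff ℝ (2 * (m + 1) : ℕ) (charFun (P.map (increment Z h n))) := by
    rw [show charFun (P.map (increment Z h n)) = fun u => Complex.exp (h * charExponent b ν u) from
      funext fun u => hZ.charFun_increment hh n u]
    exact (contDiff_const.mul (contDiff_charExponent hν hm.1 b _)).cexp
  have h2 := lintegral_pow_lt_top_of_contDiff_charFun _ _ h1
  rw [lintegral_map (by fun_prop) (hZ.measurable_increment h n)] at h2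
  have h3 : MemLp (increment Z h n) ((2 * (m + 1) : ℕ) : ℝ≥0) P := by
    refine ⟨(hZ.measurable_increment h n).aestronglyMeasurable, ?_⟩
    rw [eLpNorm_lt_top_iff_lintegral_rpow_enorm_lt_top (by simp) ENNReal.coe_ne_top]
    refine lt_of_eq_of_lt (lintegral_congr fun ω => ?_) h2
    rw [← ofReal_norm, ENNReal.ofReal_rpow_of_nonneg (norm_nonneg _) (by positivity),
      ENNReal.coe_toReal, NNReal.coe_natCast, Real.rpow_natCast, Real.norm_eq_abs]
  refine h3.mono_exponent ?_
  norm_cast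
  refine hqm.trans ?_
  exact_mod_cast (by omega : m ≤ 2 * (m + 1))

end Increments

/-! ### The impulse responses -/

section StateSpace

theorem pow_sub_pow_eq_sum {R : Type*} [Ring R] (A B : R) (n : ℕ) :
    A ^ n - B ^ n = ∑ j ∈ Finset.range n, A ^ (n - 1 - j) * (A - B) * B ^ j := by
  induction n with
  | zero => simp
  | succ n ih =>
    have h1 : A ^ (n + 1) - B ^ (n + 1) = A * (A ^ n - B ^ n) + (A - B) * B ^ n := by
      rw [pow_succ', pow_succ']; noncomm_ring
    rw [h1, ih, Finset.sum_range_succ, Finset.mul_sum]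
    congr 1
    · refine Finset.sum_congr rfl fun j hj => ?_
      have hj' := Finset.mem_range.1 hj
      rw [show n + 1 - 1 - j = (n - 1 - j) + 1 by omega, pow_succ']
      noncomm_ring
    · simp

variable {p d : ℕ} (S : SystemFamily p d)

/-- The two matrices differ by the rank-one matrix `K L`, so the middle terms of the convolution are
those of the telescoping formula for `H^i - (H - K L)^i`, and the two end terms cancel them. -/
theorem SystemFamily.sum_response_mul_invResponse (θ : Vec p) (i : ℕ) :
    ∑ k ∈ Finset.range (i + 1), S.response θ (i - k) * S.invResponse θ k =
      if i = 0 then 1 else 0 := by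
  cases i with
  | zero => simp [SystemFamily.response, SystemFamily.invResponse]
  | succ i =>
    rw [Finset.sum_range_succ, Finset.sum_range_succ']
    have h1 : ∀ j ∈ Finset.range i, S.response θ (i + 1 - (j + 1)) * S.invResponse θ (j + 1) =
        -(S.L θ ⬝ᵥ ((S.H θ ^ (i - 1 - j) * (S.H θ - S.invH θ) * S.invH θ ^ j) *ᵥ S.K θ)) := by
      intro j hj
      have hj' := Finset.mem_range.1 hj
      rw [show i + 1 - (j + 1) = (i - 1 - j) + 1 by omega]
      simp only [SystemFamily.response, SystemFamily.invResponse]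
      rw [show S.H θ - S.invH θ = Matrix.vecMulVec (S.K θ) (S.L θ) by
        simp [SystemFamily.invH]]
      rw [← Matrix.mulVec_mulVec, ← Matrix.mulVec_mulVec, Matrix.vecMulVec_mulVec]
      simp [Matrix.mulVec_smul, dotProduct_smul, mul_comm]
    rw [Finset.sum_congr rfl h1, Finset.sum_neg_distrib, ← dotProduct_sum, ← Matrix.sum_mulVec,
      ← pow_sub_pow_eq_sum]
    simp [SystemFamily.response, SystemFamily.invResponse, Matrix.sub_mulVec, dotProduct_sub]

attribute [local instance] Matrix.linftyOpNormedRing Matrix.linftyOpNormedAlgebra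

/-- Gelfand's formula for the complexified matrix: any `ρ` above the spectral radius eventually
dominates `‖A^n‖^(1/n)`, and finitely many powers are absorbed in the constant. -/
theorem IsStable.exists_pow_le {A : Matrix (Fin d) (Fin d) ℝ} (hA : IsStable A) :
    ∃ C ρ : ℝ, 0 < ρ ∧ ρ < 1 ∧ 0 ≤ C ∧ ∀ n i j, |(A ^ n) i j| ≤ C * ρ ^ n := by
  rcases isEmpty_or_nonempty (Fin d) with hd | hd
  · exact ⟨0, 1 / 2, by norm_num, by norm_num, le_rfl, fun n i => hd.elim i⟩
  set B : Matrix (Fin d) (Fin d) ℂ := A.map (fun x : ℝ => (x : ℂ)) with hB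
  have : CompleteSpace (Matrix (Fin d) (Fin d) ℂ) := FiniteDimensional.complete ℂ _
  have h1 : spectralRadius ℂ B < (1 : ℝ≥0) :=
    spectrum.spectralRadius_lt_of_forall_lt B fun z hz => by
      have := hA z hz
      exact_mod_cast this
  obtain ⟨ρ, hρ1, hρ2⟩ := ENNReal.lt_iff_exists_nnreal_btwn.1 h1
  have hρ0 : 0 < ρ := by exact_mod_cast (zero_le.trans_lt hρ1)
  have h2 := (spectrum.pow_nnnorm_pow_one_div_tendsto_nhds_spectralRadius B).eventually
    (gt_mem_nhds hρ1)
  have h3 : ∀ᶠ n : ℕ in atTop, ‖B ^ n‖ ≤ (ρ : ℝ) ^ n := by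
    filter_upwards [h2, eventually_gt_atTop 0] with n hn hn0
    have hn' : (0 : ℝ) < n := by exact_mod_cast hn0
    have h4 := ENNReal.rpow_le_rpow hn.le hn'.le
    rw [← ENNReal.rpow_mul, one_div, inv_mul_cancel₀ hn'.ne', ENNReal.rpow_one,
      ENNReal.rpow_natCast] at h4
    exact_mod_cast h4
  obtain ⟨n₀, hn₀⟩ := eventually_atTop.1 h3
  have hent : ∀ n i j, |(A ^ n) i j| ≤ ‖B ^ n‖ := fun n i j => by
    have h5 : (B ^ n) i j = ((A ^ n) i j : ℂ) := by
      have : B ^ n = (A ^ n).map (fun x : ℝ => (x : ℂ)) := by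
        have := (Matrix.map_pow A Complex.ofRealHom n)
        exact this.symm
      rw [this]; rfl
    have h6 : ‖(B ^ n) i j‖ ≤ ‖B ^ n‖ := by
      rw [Matrix.linfty_opNorm_def, ← coe_nnnorm, NNReal.coe_le_coe]
      exact (Finset.single_le_sum (f := fun j => ‖(B ^ n) i j‖₊) (fun _ _ => zero_le)
        (Finset.mem_univ j)).trans
        (Finset.le_sup (f := fun i => ∑ j, ‖(B ^ n) i j‖₊) (Finset.mem_univ i))
    rw [h5, Complex.norm_real] at h6
    exact h6
  refine ⟨1 + ∑ n ∈ Finset.range n₀, ‖B ^ n‖ * (ρ : ℝ)⁻¹ ^ n, ρ, by exact_mod_cast hρ0,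
    by exact_mod_cast hρ2, by positivity, fun n i j => (hent n i j).trans ?_⟩
  have hs : 0 ≤ ∑ n ∈ Finset.range n₀, ‖B ^ n‖ * (ρ : ℝ)⁻¹ ^ n := by positivity
  by_cases hn : n₀ ≤ n
  · exact (hn₀ n hn).trans (le_mul_of_one_le_left (by positivity) (by linarith))
  · have h7 := Finset.single_le_sum (f := fun n => ‖B ^ n‖ * (ρ : ℝ)⁻¹ ^ n)
      (fun n _ => by positivity) (Finset.mem_range.2 (not_le.1 hn))
    have h8 : ‖B ^ n‖ = ‖B ^ n‖ * (ρ : ℝ)⁻¹ ^ n * ρ ^ n := by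
      rw [mul_assoc, ← mul_pow, inv_mul_cancel₀ (by positivity), one_pow, mul_one]
    rw [h8]
    gcongr
    linarith

theorem SystemFamily.exists_abs_response_le {θ : Vec p} (h : IsStable (S.H θ)) :
    ∃ C ρ : ℝ, 0 < ρ ∧ ρ < 1 ∧ 0 ≤ C ∧ ∀ n, |S.response θ n| ≤ C * ρ ^ n := by
  obtain ⟨C, ρ, h0, h1, hC, h2⟩ := h.exists_pow_le
  set c : ℝ := ∑ i, ∑ j, |S.L θ i| * |S.K θ j| with hc
  have hc0 : 0 ≤ c := by positivity
  have hle : ∀ n, |S.L θ ⬝ᵥ ((S.H θ ^ n) *ᵥ S.K θ)| ≤ c * (C * ρ ^ n) := fun n => by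
    simp only [dotProduct, Matrix.mulVec, hc, Finset.mul_sum, Finset.sum_mul]
    refine (Finset.abs_sum_le_sum_abs _ _).trans (Finset.sum_le_sum fun i _ =>
      (Finset.abs_sum_le_sum_abs _ _).trans (Finset.sum_le_sum fun j _ => ?_))
    rw [abs_mul, abs_mul]
    calc |S.L θ i| * (|(S.H θ ^ n) i j| * |S.K θ j|)
        = |S.L θ i| * |S.K θ j| * |(S.H θ ^ n) i j| := by ring
      _ ≤ _ := by gcongr; exact h2 n i j
  refine ⟨1 + c * C / ρ, ρ, h0, h1, by positivity, fun n => ?_⟩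
  cases n with
  | zero =>
    simp only [SystemFamily.response, abs_one, pow_zero, mul_one]
    have : 0 ≤ c * C / ρ := by positivity
    linarith
  | succ n =>
    refine (hle n).trans ?_
    have : c * (C * ρ ^ n) = c * C / ρ * ρ ^ (n + 1) := by rw [pow_succ]; field_simp
    rw [this]
    gcongr
    linarith

end StateSpace

/-! ### Smooth dependence of the weighted inverse filter on the parameter. -/

section SmoothResponse

/-- The sequence `(c, 0, 0, …)`. -/
def seqSingle {V : Type*} [NormedAddCommGroup V] [NormedSpace ℝ V] : V →ₗ[ℝ] (ℕ →ᵇ V) where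
  toFun c := BoundedContinuousFunction.ofNormedAddCommGroupDiscrete
    (fun k => if k = 0 then c else 0) ‖c‖ fun k => by split_ifs <;> simp
  map_add' a b := by ext k; by_cases h : k = 0 <;> simp [h]
  map_smul' a b := by ext k; by_cases h : k = 0 <;> simp [h]

/-- The right shift of bounded sequences. -/
def seqShift {V : Type*} [NormedAddCommGroup V] [NormedSpace ℝ V] : (ℕ →ᵇ V) →L[ℝ] (ℕ →ᵇ V) :=
  LinearMap.mkContinuous
    { toFun := fun x => BoundedContinuousFunction.ofNormedAddCommGroupDiscrete
        (fun k => if k = 0 then 0 else x (k - 1)) ‖x‖ fun k => by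
          split_ifs
          · simp
          · exact x.norm_coe_le_norm _
      map_add' := fun a b => by ext k; by_cases h : k = 0 <;> simp [h]
      map_smul' := fun a b => by ext k; by_cases h : k = 0 <;> simp [h] } 1
    fun x => by
      rw [one_mul]
      refine (BoundedContinuousFunction.norm_le (norm_nonneg _)).2 fun k => ?_
      simp only [LinearMap.coe_mk, AddHom.coe_mk,
        BoundedContinuousFunction.coe_ofNormedAddCommGroupDiscrete]
      split_ifs
      · simp
      · exact x.norm_coe_le_norm _

variable {V W : Type*} [NormedAddCommGroup V] [NormedSpace ℝ V] [NormedAddCommGroup W]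
  [NormedSpace ℝ W]

theorem seqSingle_apply (c : V) (k : ℕ) : seqSingle c k = if k = 0 then c else 0 := rfl

theorem seqShift_zero (x : ℕ →ᵇ V) : seqShift x 0 = 0 := rfl

theorem seqShift_succ (x : ℕ →ᵇ V) (k : ℕ) : seqShift x (k + 1) = x k := rfl

/-- Shift and apply an operator to every entry. -/
def seqMap [FiniteDimensional ℝ V] [FiniteDimensional ℝ W] :
    (V →L[ℝ] W) →L[ℝ] ((ℕ →ᵇ V) →L[ℝ] (ℕ →ᵇ W)) :=
  LinearMap.toContinuousLinearMap
    { toFun := fun A => seqShift ∘L A.compLeftContinuousBounded ℕ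
      map_add' := fun A B => by ext x k; cases k <;> simp [seqShift_zero, seqShift_succ]
      map_smul' := fun c A => by ext x k; cases k <;> simp [seqShift_zero, seqShift_succ] }

theorem seqMap_zero [FiniteDimensional ℝ V] [FiniteDimensional ℝ W] (A : V →L[ℝ] W)
    (x : ℕ →ᵇ V) : seqMap A x 0 = 0 := rfl

theorem seqMap_succ [FiniteDimensional ℝ V] [FiniteDimensional ℝ W] (A : V →L[ℝ] W)
    (x : ℕ →ᵇ V) (k : ℕ) : seqMap A x (k + 1) = A (x k) := rfl

theorem contDiff_seqMap [FiniteDimensional ℝ V] [FiniteDimensional ℝ W] {n : WithTop ℕ∞} :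
    ContDiff ℝ n (fun A : V →L[ℝ] W => seqMap A) :=
  ContinuousLinearMap.contDiff (seqMap (V := V) (W := W))

/-- The `m`-th power shifts `m` times and applies `A^m` entrywise. Bounding powers, not the operator
itself, matters: stability controls the spectral radius but not the norm. -/
theorem norm_seqMap_pow_le [FiniteDimensional ℝ V] (A : V →L[ℝ] V) (m : ℕ) :
    ‖seqMap A ^ m‖ ≤ ‖A ^ m‖ := by
  refine ContinuousLinearMap.opNorm_le_bound _ (norm_nonneg _) fun x => ?_
  have h : ∀ (m k : ℕ), (seqMap A ^ m) x k = if k < m then 0 else (A ^ m) (x (k - m)) := by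
    intro m
    induction m with
    | zero => intro k; simp
    | succ m ih =>
      intro k
      rw [pow_succ']
      change seqMap A ((seqMap A ^ m) x) k = _
      cases k with
      | zero => simp [seqMap_zero]
      | succ k =>
        rw [seqMap_succ, ih, pow_succ']
        by_cases hk : k < m
        · simp [hk]
        · simp [hk]
  refine (BoundedContinuousFunction.norm_le (by positivity)).2 fun k => ?_
  rw [h]
  split_ifs
  · simp; positivity
  · refine ((A ^ m).le_opNorm _).trans ?_
    gcongr
    exact x.norm_coe_le_norm _

/-- `1 - t` is a factor of the unit `1 - t^m`, and it commutes with the complementary geometric sum.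
-/
theorem isUnit_one_sub_of_pow {R : Type*} [NormedRing R] [HasSummableGeomSeries R] {t : R} {m : ℕ}
    (h : ‖t ^ m‖ < 1) : IsUnit (1 - t) := by
  have h1 : IsUnit (1 - t ^ m) := isUnit_one_sub_of_norm_lt_one h
  have h2 : Commute (1 - t) (∑ i ∈ Finset.range m, t ^ i) :=
    Commute.sum_right _ _ _ fun i _ => (Commute.one_left _).sub_left (Commute.self_pow t i)
  rw [← mul_neg_geom_sum] at h1
  exact (h2.isUnit_mul_iff.1 h1).1

variable {p d : ℕ} (S : SystemFamily p d)

/-- The state matrix of the inverse system as an operator. -/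
def SystemFamily.invOp (θ : Vec p) : (Fin d → ℝ) →L[ℝ] (Fin d → ℝ) :=
  LinearMap.toContinuousLinearMap (Matrix.toLin' (S.invH θ))

theorem SystemFamily.invOp_pow_apply (θ : Vec p) (k : ℕ) (v : Fin d → ℝ) :
    (S.invOp θ ^ k) v = (S.invH θ ^ k) *ᵥ v := by
  induction k with
  | zero => simp
  | succ k ih =>
    rw [pow_succ', pow_succ', ← Matrix.mulVec_mulVec, ← ih]
    rfl

/-- The functional `L θ`. -/
def dotL : (Fin d → ℝ) →L[ℝ] ((Fin d → ℝ) →L[ℝ] ℝ) :=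
  LinearMap.toContinuousLinearMap
    { toFun := fun L => LinearMap.toContinuousLinearMap
        { toFun := fun v => L ⬝ᵥ v
          map_add' := fun v w => dotProduct_add _ _ _
          map_smul' := fun c v => dotProduct_smul _ _ _ }
      map_add' := fun v w => by ext x; simp
      map_smul' := fun c v => by ext x; simp }

theorem dotL_apply (L v : Fin d → ℝ) : dotL L v = L ⬝ᵥ v := rfl

/-- The sequence `(r ^ k b_k θ)` of the weighted coefficients of the inverse system. -/
def SystemFamily.weighted (r : ℝ) (θ : Vec p) : ℕ →ᵇ ℝ :=
  seqSingle (1 : ℝ) - r • seqMap (dotL (S.L θ))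
    (Ring.inverse (1 - r • seqMap (S.invOp θ)) (seqSingle (S.K θ)))

/-- The resolvent applied to `(K, 0, 0, …)` is the fixed point `x` of the weighted state recursion,
so its `k`-th entry is `r^k (H - K L)^k K`. Invertibility is essential, as `Ring.inverse` is zero
elsewhere. -/
theorem SystemFamily.weighted_apply {r : ℝ} {θ : Vec p} (h : IsUnit (1 - r • seqMap (S.invOp θ)))
    (k : ℕ) : S.weighted r θ k = r ^ k * S.invResponse θ k := by
  set x := Ring.inverse (1 - r • seqMap (S.invOp θ)) (seqSingle (S.K θ)) with hx
  have h1 : x = seqSingle (S.K θ) + r • seqMap (S.invOp θ) x := by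
    have h2 := congrArg (fun T => T (seqSingle (S.K θ))) (Ring.mul_inverse_cancel _ h)
    simp only [mul_apply_eq_comp, ← hx, one_apply_eq_self,
      sub_apply, smul_apply] at h2
    rw [← h2]; simp
  have h3 : ∀ k, x k = r ^ k • ((S.invOp θ ^ k) (S.K θ)) := fun k => by
    induction k with
    | zero =>
      rw [h1]
      simp [seqSingle_apply, seqMap_zero]
    | succ k ih =>
      rw [h1]
      simp only [BoundedContinuousFunction.coe_add, BoundedContinuousFunction.coe_smul,
        Pi.add_apply, seqSingle_apply, seqMap_succ, ih, Nat.succ_ne_zero, if_false, zero_add,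
        map_smul, pow_succ', mul_apply_eq_comp, smul_smul]
  cases k with
  | zero => simp [SystemFamily.weighted, seqSingle_apply, seqMap_zero, SystemFamily.invResponse]
  | succ k =>
    simp only [SystemFamily.weighted, ← hx, BoundedContinuousFunction.coe_sub,
      BoundedContinuousFunction.coe_smul, Pi.sub_apply, seqSingle_apply, seqMap_succ, h3,
      Nat.succ_ne_zero, if_false, zero_sub, map_smul, dotL_apply, smul_eq_mul,
      SystemFamily.invResponse, S.invOp_pow_apply]
    ring

theorem SystemFamily.contDiffAt_invOp {n : WithTop ℕ∞} {θ : Vec p}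
    (hH : ∀ i j, ContDiffAt ℝ n (fun τ => S.H τ i j) θ) (hK : ∀ i, ContDiffAt ℝ n (fun τ => S.K τ i) θ)
    (hL : ∀ i, ContDiffAt ℝ n (fun τ => S.L τ i) θ) : ContDiffAt ℝ n S.invOp θ := by
  let T : (Fin d → Fin d → ℝ) →ₗ[ℝ] ((Fin d → ℝ) →L[ℝ] (Fin d → ℝ)) :=
    LinearMap.toContinuousLinearMap.toLinearMap ∘ₗ Matrix.toLin'.toLinearMap ∘ₗ
      (Matrix.ofLinearEquiv ℝ).toLinearMap
  have h1 : ContDiffAt ℝ n (fun τ => (fun i j => S.H τ i j - S.K τ i * S.L τ j)) θ :=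
    contDiffAt_pi.2 fun i => contDiffAt_pi.2 fun j => (hH i j).sub ((hK i).mul (hL j))
  exact (LinearMap.toContinuousLinearMap T).contDiff.contDiffAt.comp θ h1

/-- Inversion is smooth at units, so the whole sequence of coefficients is differentiable at once,
in the sup norm. This carries all the uniformity in `k` used later. -/
theorem SystemFamily.contDiffAt_weighted {r : ℝ} {n : WithTop ℕ∞} {θ : Vec p}
    (h : IsUnit (1 - r • seqMap (S.invOp θ)))
    (hH : ∀ i j, ContDiffAt ℝ n (fun τ => S.H τ i j) θ) (hK : ∀ i, ContDiffAt ℝ n (fun τ => S.K τ i) θ)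
    (hL : ∀ i, ContDiffAt ℝ n (fun τ => S.L τ i) θ) : ContDiffAt ℝ n (S.weighted r) θ := by
  have h0' : ContDiffAt ℝ n (fun τ => r • seqMap (S.invOp τ)) θ :=
    (contDiff_seqMap.contDiffAt.comp θ (S.contDiffAt_invOp hH hK hL)).const_smul r
  have h1 : ContDiffAt ℝ n (fun τ => 1 - r • seqMap (S.invOp τ)) θ :=
    contDiffAt_const.sub h0'
  obtain ⟨v, hv⟩ := h
  have h2 : ContDiffAt ℝ n (fun τ => Ring.inverse (1 - r • seqMap (S.invOp τ))) θ := by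
    have h3 := contDiffAt_ringInverse ℝ (n := n) v
    rw [hv] at h3
    exact h3.comp θ h1
  have h4 : ContDiffAt ℝ n (fun τ => seqSingle (S.K τ)) θ :=
    (LinearMap.toContinuousLinearMap
      (seqSingle (V := Fin d → ℝ))).contDiff.contDiffAt.comp θ (contDiffAt_pi.2 hK)
  have h5 : ContDiffAt ℝ n (fun τ => seqMap (dotL (S.L τ))) θ :=
    (contDiff_seqMap.comp dotL.contDiff).contDiffAt.comp θ (contDiffAt_pi.2 hL)
  exact contDiffAt_const.sub ((h5.clm_apply (h2.clm_apply h4)).const_smul r)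

/-- On a compact set of stable parameters the weighted coefficients of the inverse system are
smooth for some weight `r > 1`. -/
theorem SystemFamily.exists_weight {D : Set (Vec p)} (hD : IsCompact D) (hS : S.SmoothOn D)
    (hstab : ∀ θ ∈ D, IsStable (S.invH θ)) : ∃ r : ℝ, 1 < r ∧ ∃ D' : Set (Vec p), IsCompact D' ∧
      D ⊆ interior D' ∧ ∀ θ ∈ D', ContDiffAt ℝ 3 (S.weighted r) θ ∧
        ∀ k, S.weighted r θ k = r ^ k * S.invResponse θ k := by
  have hcont : ∀ θ ∈ D, ContinuousAt S.invOp θ := fun θ hθ =>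
    (S.contDiffAt_invOp (hS θ hθ).1 (hS θ hθ).2.1 (hS θ hθ).2.2).continuousAt
  -- Only the weight has to be uniform on `D`; the power `m` may depend on `θ`. The property is
  -- local, with `m` fixed near a point, and survives unions on taking the smaller weight, so
  -- compactness applies.
  obtain ⟨r, hr, hrD⟩ : ∃ r : ℝ, 1 < r ∧ ∀ θ ∈ D, ∃ m : ℕ, r ^ m * ‖S.invOp θ ^ m‖ < 1 := by
    refine hD.induction_on (p := fun s => ∃ r : ℝ, 1 < r ∧ ∀ θ ∈ s, ∃ m : ℕ,
      r ^ m * ‖S.invOp θ ^ m‖ < 1) ⟨2, one_lt_two, by simp⟩ ?_ ?_ ?_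
    · rintro s t hst ⟨r, hr, h⟩
      exact ⟨r, hr, fun θ hθ => h θ (hst hθ)⟩
    · rintro s t ⟨r, hr, h⟩ ⟨r', hr', h'⟩
      refine ⟨min r r', lt_min hr hr', ?_⟩
      have hm : 0 ≤ min r r' := (zero_lt_one.trans (lt_min hr hr')).le
      rintro θ (hθ | hθ)
      · obtain ⟨m, hm'⟩ := h θ hθ
        refine ⟨m, lt_of_le_of_lt ?_ hm'⟩
        gcongr
        exact min_le_left _ _
      · obtain ⟨m, hm'⟩ := h' θ hθ
        refine ⟨m, lt_of_le_of_lt ?_ hm'⟩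
        gcongr
        exact min_le_right _ _
    · intro θ hθ
      obtain ⟨C, ρ, hρ0, hρ1, hC, hb⟩ := (hstab θ hθ).exists_pow_le
      have hnorm : ∀ m, ‖S.invOp θ ^ m‖ ≤ d * (C * ρ ^ m) := fun m => by
        refine ContinuousLinearMap.opNorm_le_bound _ (by positivity) fun v => ?_
        rw [S.invOp_pow_apply]
        refine (pi_norm_le_iff_of_nonneg (by positivity)).2 fun i => ?_
        simp only [Matrix.mulVec, dotProduct]
        refine (norm_sum_le _ _).trans ?_
        calc ∑ j, ‖(S.invH θ ^ m) i j * v j‖ ≤ ∑ _j : Fin d, C * ρ ^ m * ‖v‖ := by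
              refine Finset.sum_le_sum fun j _ => ?_
              rw [norm_mul]
              gcongr
              · exact hb m i j
              · exact norm_le_pi_norm v j
          _ = _ := by simp; ring
      obtain ⟨r, hr1, hr2⟩ : ∃ r : ℝ, 1 < r ∧ r * ρ < 1 := by
        obtain ⟨r, h1, h2⟩ := exists_between ((one_lt_inv₀ hρ0).2 hρ1)
        exact ⟨r, h1, by rwa [inv_eq_one_div, lt_div_iff₀ hρ0] at h2⟩
      have hr0 : 0 < r := by linarith
      have hlim : Tendsto (fun m : ℕ => (d * C) * (r * ρ) ^ m) atTop (𝓝 0) := by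
        simpa using (tendsto_pow_atTop_nhds_zero_of_lt_one (by positivity) hr2).const_mul (d * C)
      obtain ⟨m, hm⟩ := (hlim.eventually (gt_mem_nhds zero_lt_one)).exists
      have hm' : r ^ m * ‖S.invOp θ ^ m‖ < 1 := by
        refine lt_of_le_of_lt ?_ hm
        calc r ^ m * ‖S.invOp θ ^ m‖ ≤ r ^ m * (d * (C * ρ ^ m)) := by gcongr; exact hnorm m
          _ = _ := by rw [mul_pow]; ring
      have hev : ∀ᶠ τ in 𝓝 θ, r ^ m * ‖S.invOp τ ^ m‖ < 1 :=
        (((hcont θ hθ).pow m).norm.const_mul _).eventually (gt_mem_nhds hm')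
      exact ⟨_, mem_nhdsWithin_of_mem_nhds hev, r, hr1, fun τ hτ => ⟨m, hτ⟩⟩
  have hr0 : 0 < r := by linarith
  let U : Set (Vec p) := {θ | ContDiffAt ℝ 3 (S.weighted r) θ ∧
    ∀ k, S.weighted r θ k = r ^ k * S.invResponse θ k}
  have hU : D ⊆ interior U := fun θ hθ => by
    rw [mem_interior_iff_mem_nhds]
    obtain ⟨m, hm⟩ := hrD θ hθ
    have hev : ∀ᶠ τ in 𝓝 θ, r ^ m * ‖S.invOp τ ^ m‖ < 1 :=
      (((hcont θ hθ).pow m).norm.const_mul _).eventually (gt_mem_nhds hm)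
    have h1 : ∀ᶠ τ in 𝓝 θ, ∀ i j, ContDiffAt ℝ 3 (fun τ => S.H τ i j) τ :=
      eventually_all.2 fun i => eventually_all.2 fun j => ((hS θ hθ).1 i j).eventually (by simp)
    have h2 : ∀ᶠ τ in 𝓝 θ, ∀ i, ContDiffAt ℝ 3 (fun τ => S.K τ i) τ :=
      eventually_all.2 fun i => ((hS θ hθ).2.1 i).eventually (by simp)
    have h3 : ∀ᶠ τ in 𝓝 θ, ∀ i, ContDiffAt ℝ 3 (fun τ => S.L τ i) τ :=
      eventually_all.2 fun i => ((hS θ hθ).2.2 i).eventually (by simp)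
    filter_upwards [hev, h1, h2, h3] with τ h4 h5 h6 h7
    have hu : IsUnit (1 - r • seqMap (S.invOp τ)) := by
      refine isUnit_one_sub_of_pow (m := m) (lt_of_le_of_lt ?_ h4)
      rw [smul_pow, norm_smul, norm_pow, Real.norm_of_nonneg hr0.le]
      gcongr
      exact norm_seqMap_pow_le _ _
    exact ⟨S.contDiffAt_weighted hu h5 h6 h7, S.weighted_apply hu⟩
  -- A compact neighbourhood of `D` is kept, so that gradients can be computed at all points of `D`,
  -- including its boundary.
  obtain ⟨D', hD', h1, h2⟩ := exists_compact_between hD isOpen_interior hU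
  exact ⟨r, hr, D', hD', h1, fun θ hθ => (interior_subset (h2 hθ) : θ ∈ U)⟩

end SmoothResponse

/-! ### Linear processes driven by independent noise -/

section LinearProcess

variable {Ω : Type*} {G : Type*} [NormedAddCommGroup G] [NormedSpace ℝ G] {c : ℕ → G}
  {z : ℤ → Ω → ℝ}

/-- The linear process `∑_{i ≥ 0} z_{n-i} c_i`. -/
def linProc (c : ℕ → G) (z : ℤ → Ω → ℝ) (n : ℤ) (ω : Ω) : G := ∑' i : ℕ, z (n - i) ω • c i

/-- The truncated linear process `∑_{i < m} z_{n-i} c_i`. -/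
def truncProc (c : ℕ → G) (z : ℤ → Ω → ℝ) (m : ℕ) (n : ℤ) (ω : Ω) : G :=
  ∑ i ∈ Finset.range m, z (n - i) ω • c i

/-- The envelope `∑_{i ≥ m} |z_{n-i}| ‖c_i‖` of a linear process. -/
def envProc (c : ℕ → G) (z : ℤ → Ω → ℝ) (m : ℕ) (n : ℤ) (ω : Ω) : ℝ :=
  ∑' i : ℕ, ‖z (n - (i + m : ℕ)) ω • c (i + m)‖

/-- Exponential decay of a sequence of coefficients. -/
def ExpDecay (c : ℕ → G) : Prop := ∃ C κ : ℝ, 0 ≤ C ∧ 0 < κ ∧ κ < 1 ∧ ∀ i, ‖c i‖ ≤ C * κ ^ i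

theorem envProc_nonneg (m : ℕ) (n : ℤ) (ω : Ω) : 0 ≤ envProc c z m n ω :=
  tsum_nonneg fun _ => norm_nonneg _

theorem norm_truncProc_le {ω : Ω} {n : ℤ} (hs : Summable fun i : ℕ => ‖z (n - i) ω • c i‖) (m : ℕ) :
    ‖truncProc c z m n ω‖ ≤ envProc c z 0 n ω :=
  (norm_sum_le _ _).trans (by simpa [envProc] using hs.sum_le_tsum _ fun i _ => norm_nonneg _)

theorem norm_linProc_le {ω : Ω} {n : ℤ} (hs : Summable fun i : ℕ => ‖z (n - i) ω • c i‖) :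
    ‖linProc c z n ω‖ ≤ envProc c z 0 n ω :=
  (norm_tsum_le_tsum_norm hs).trans (by simp [envProc])

theorem norm_linProc_sub_truncProc_le [CompleteSpace G] {ω : Ω} {n : ℤ}
    (hs : Summable fun i : ℕ => ‖z (n - i) ω • c i‖) (m : ℕ) :
    ‖linProc c z n ω - truncProc c z m n ω‖ ≤ envProc c z m n ω := by
  have h1 := hs.of_norm.sum_add_tsum_nat_add m
  have h2 : linProc c z n ω - truncProc c z m n ω =
      ∑' i : ℕ, z (n - (i + m : ℕ)) ω • c (i + m) := by
    rw [linProc, truncProc, ← h1]; simp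
  rw [h2]
  exact norm_tsum_le_tsum_norm ((summable_nat_add_iff m).2 hs)

variable [MeasurableSpace Ω] {P : Measure Ω}

/-- The triangle inequality passes to infinite sums because the `L^q` norm is lower semicontinuous
along the almost everywhere convergent partial sums. -/
theorem eLpNorm_tsum_le [CompleteSpace G] {f : ℕ → Ω → G} (hf : ∀ i, AEStronglyMeasurable (f i) P)
    {q : ℝ≥0∞} (hq : 1 ≤ q) (hsum : ∑' i, eLpNorm (f i) q P ≠ ∞) :
    AEStronglyMeasurable (fun ω => ∑' i, f i ω) P ∧
      eLpNorm (fun ω => ∑' i, f i ω) q P ≤ ∑' i, eLpNorm (f i) q P := by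
  have h1 : ∀ᵐ ω ∂P, Tendsto (fun n => (∑ i ∈ Finset.range n, f i) ω) atTop (𝓝 (∑' i, f i ω)) := by
    filter_upwards [summable_norm_of_tsum_eLpNorm_ne_top hq hf hsum] with ω hω
    simpa using hω.of_norm.hasSum.tendsto_sum_nat
  have h2 : ∀ n, AEStronglyMeasurable (∑ i ∈ Finset.range n, f i) P := fun n =>
    Finset.aestronglyMeasurable_sum _ fun i _ => hf i
  refine ⟨aestronglyMeasurable_of_tendsto_ae atTop h2 h1,
    (Lp.eLpNorm_lim_le_liminf_eLpNorm h2 _ h1).trans ?_⟩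
  refine (liminf_le_liminf (Eventually.of_forall fun n =>
    (eLpNorm_sum_le (fun i _ => hf i) hq).trans (ENNReal.sum_le_tsum _))).trans_eq ?_
  simp

/-- Independent identically distributed centred noise with moments of all orders. -/
structure IsNoise (z : ℤ → Ω → ℝ) (P : Measure Ω) : Prop where
  meas : ∀ n, Measurable (z n)
  indep : iIndepFun z P
  law : ∀ n m, P.map (z n) = P.map (z m)
  memLp : ∀ n, ∀ q : ℝ≥0, MemLp (z n) q P
  mean : ∀ n, ∫ ω, z n ω ∂P = 0

theorem IsNoise.eLpNorm_eq (hz : IsNoise z P) (q : ℝ≥0∞) (n : ℤ) :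
    eLpNorm (z n) q P = eLpNorm (z 0) q P := by
  have h : ∀ n, eLpNorm (z n) q P = eLpNorm id q (P.map (z n)) := fun n => by
    rw [eLpNorm_map_measure aestronglyMeasurable_id (hz.meas n).aemeasurable]; rfl
  rw [h, h, hz.law n 0]

theorem IsNoise.mb (hz : IsNoise z P) : MB P z := by
  refine ⟨fun n => (hz.meas n).aestronglyMeasurable, fun q _ =>
    ⟨(eLpNorm (z 0) q P).toNNReal, fun n => ?_⟩⟩
  rw [hz.eLpNorm_eq, ENNReal.coe_toNNReal (hz.memLp 0 q).2.ne]

theorem IsNoise.envProc_bound (hz : IsNoise z P) {C κ : ℝ} (hC : 0 ≤ C) (hκ0 : 0 < κ) (hκ : κ < 1)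
    (hc : ∀ i, ‖c i‖ ≤ C * κ ^ i) {q : ℝ≥0∞} (hq : 1 ≤ q) {B : ℝ} (hB : 0 ≤ B)
    (hzq : ∀ n, eLpNorm (z n) q P ≤ ENNReal.ofReal B) (m : ℕ) (n : ℤ) :
    AEStronglyMeasurable (envProc c z m n) P ∧
    (∀ᵐ ω ∂P, Summable fun i : ℕ => ‖z (n - (i + m : ℕ)) ω • c (i + m)‖) ∧
    eLpNorm (envProc c z m n) q P ≤ ENNReal.ofReal (B * C / (1 - κ) * κ ^ m) := by
  let f : ℕ → Ω → ℝ := fun i ω => ‖z (n - (i + m : ℕ)) ω • c (i + m)‖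
  have hfm : ∀ i, AEStronglyMeasurable (f i) P := fun i =>
    ((hz.meas _).aestronglyMeasurable.smul_const _).norm
  have hf : ∀ i, eLpNorm (f i) q P ≤ ENNReal.ofReal (B * C * κ ^ m * κ ^ i) := fun i => by
    have h1 : eLpNorm (f i) q P = eLpNorm (fun ω => ‖c (i + m)‖ • z (n - (i + m : ℕ)) ω) q P := by
      refine eLpNorm_congr_norm_ae (ae_of_all _ fun ω => ?_)
      simp only [f, norm_norm, norm_smul, norm_mul]; ring
    rw [h1]
    refine (eLpNorm_const_smul_le (c := ‖c (i + m)‖) (f := z (n - (i + m : ℕ)))).trans ?_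
    have h2 : ‖‖c (i + m)‖‖ₑ ≤ ENNReal.ofReal (C * κ ^ (i + m)) := by
      rw [Real.enorm_of_nonneg (norm_nonneg _)]
      exact ENNReal.ofReal_le_ofReal (hc _)
    refine (mul_le_mul' h2 (hzq _)).trans_eq ?_
    rw [← ENNReal.ofReal_mul (by positivity)]
    congr 1; ring
  have hs : Summable fun i : ℕ => B * C * κ ^ m * κ ^ i :=
    (summable_geometric_of_lt_one hκ0.le hκ).mul_left _
  have hle : ∑' i, eLpNorm (f i) q P ≤ ENNReal.ofReal (B * C / (1 - κ) * κ ^ m) := by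
    refine (ENNReal.tsum_le_tsum hf).trans_eq ?_
    rw [← ENNReal.ofReal_tsum_of_nonneg (fun i => by positivity) hs, tsum_mul_left,
      tsum_geometric_of_lt_one hκ0.le hκ]
    congr 1; ring
  have hne : ∑' i, eLpNorm (f i) q P ≠ ∞ := (hle.trans_lt ENNReal.ofReal_lt_top).ne
  obtain ⟨h1, h2⟩ := eLpNorm_tsum_le hfm hq hne
  refine ⟨h1, ?_, h2.trans hle⟩
  filter_upwards [summable_norm_of_tsum_eLpNorm_ne_top hq hfm hne] with ω hω
  simpa [f] using hω

theorem IsNoise.exists_bound (hz : IsNoise z P) (q : ℝ≥0) :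
    ∃ B : ℝ, 0 ≤ B ∧ ∀ n, eLpNorm (z n) q P ≤ ENNReal.ofReal B :=
  ⟨(eLpNorm (z 0) q P).toReal, ENNReal.toReal_nonneg, fun n => by
    rw [hz.eLpNorm_eq, ENNReal.ofReal_toReal (hz.memLp 0 q).2.ne]⟩

theorem IsNoise.ae_summable (hz : IsNoise z P) (hc : ExpDecay c) :
    ∀ᵐ ω ∂P, ∀ n : ℤ, Summable fun i : ℕ => ‖z (n - i) ω • c i‖ := by
  obtain ⟨C, κ, hC, hκ0, hκ, h⟩ := hc
  obtain ⟨B, hB, hzB⟩ := hz.exists_bound 1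
  rw [ae_all_iff]
  intro n
  simpa using (hz.envProc_bound hC hκ0 hκ h (by simp) hB hzB 0 n).2.1

/-- The tails of the envelope decay exponentially in every `L^q`. -/
theorem IsNoise.exists_envProc_le (hz : IsNoise z P) (hc : ExpDecay c) : ∃ κ : ℝ, 0 < κ ∧ κ < 1 ∧
    (∀ m n, AEStronglyMeasurable (envProc c z m n) P) ∧
    ∀ q : ℝ≥0, 1 ≤ q → ∃ A : ℝ, 0 ≤ A ∧ ∀ m n,
      eLpNorm (envProc c z m n) q P ≤ ENNReal.ofReal (A * κ ^ m) := by
  obtain ⟨C, κ, hC, hκ0, hκ, h⟩ := hc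
  obtain ⟨B, hB, hzB⟩ := hz.exists_bound 1
  refine ⟨κ, hκ0, hκ, fun m n => (hz.envProc_bound hC hκ0 hκ h (by simp) hB hzB m n).1, fun q hq => ?_⟩
  obtain ⟨B, hB, hzB⟩ := hz.exists_bound q
  have : 0 < 1 - κ := by linarith
  exact ⟨B * C / (1 - κ), by positivity, fun m n =>
    (hz.envProc_bound hC hκ0 hκ h (by exact_mod_cast hq) hB hzB m n).2.2⟩

theorem IsNoise.mb_envProc (hz : IsNoise z P) (hc : ExpDecay c) :
    MB P (fun n : ℤ => envProc c z 0 n) := by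
  obtain ⟨κ, -, -, h1, h2⟩ := hz.exists_envProc_le hc
  refine ⟨h1 0, fun q hq => ?_⟩
  obtain ⟨A, hA, h⟩ := h2 q hq
  exact ⟨A.toNNReal, fun n => (h 0 n).trans (by simp [ENNReal.ofReal])⟩

theorem IsNoise.aestronglyMeasurable_linProc [CompleteSpace G] (hz : IsNoise z P) (hc : ExpDecay c)
    (n : ℤ) : AEStronglyMeasurable (linProc c z n) P := by
  refine aestronglyMeasurable_of_tendsto_ae atTop (f := fun m => truncProc c z m n) (fun m => ?_) ?_
  · exact Finset.aestronglyMeasurable_fun_sum _ fun i _ =>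
      (hz.meas _).aestronglyMeasurable.smul_const _
  · filter_upwards [hz.ae_summable hc] with ω hω
    exact (hω n).of_norm.hasSum.tendsto_sum_nat

/-- The law of the past does not depend on time. -/
theorem IsNoise.map_past (hz : IsNoise z P) (n m : ℤ) :
    P.map (fun ω (k : ℕ) => z (n - k) ω) = P.map (fun ω (k : ℕ) => z (m - k) ω) := by
  have h : ∀ n : ℤ, P.map (fun ω (k : ℕ) => z (n - k) ω) =
      Measure.infinitePi fun _ : ℕ => P.map (z 0) := fun n => by
    have h1 : iIndepFun (fun (k : ℕ) ω => z (n - k) ω) P :=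
      hz.indep.precomp (g := fun k : ℕ => n - (k : ℤ)) fun a b hab => by
        simp only at hab; omega
    rw [h1.map_fun_eq_infinitePi_map (fun k => hz.meas _)]
    congr 1
    ext1 k
    exact hz.law _ _
  rw [h, h]

/-- Stationarity: at every time the process is the same function of the past of the noise, and the
law of the past is a fixed product measure. -/
theorem IsNoise.integral_linProc [IsProbabilityMeasure P] [CompleteSpace G] (hz : IsNoise z P)
    (hc : ExpDecay c) {F : Type*} [NormedAddCommGroup F] [NormedSpace ℝ F] {f : G → F}
    (hf : Continuous f) (n m : ℤ) :
    ∫ ω, f (linProc c z n ω) ∂P = ∫ ω, f (linProc c z m ω) ∂P := by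
  have hmeas : ∀ n : ℤ, Measurable (fun ω (k : ℕ) => z (n - k) ω) := fun n =>
    measurable_pi_lambda _ fun k => hz.meas _
  -- `G` need not be separable, and the dual of the bounded sequences is not, so strong
  -- measurability is obtained from partial sums converging almost everywhere under the law of the
  -- past.
  have h : ∀ n : ℤ, AEStronglyMeasurable (fun x : ℕ → ℝ => ∑' i, x i • c i)
      (P.map (fun ω (k : ℕ) => z (n - k) ω)) := fun n => by
    refine aestronglyMeasurable_of_tendsto_ae atTop
      (f := fun m (x : ℕ → ℝ) => ∑ i ∈ Finset.range m, x i • c i) (fun m => ?_) ?_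
    · exact Finset.aestronglyMeasurable_fun_sum _ fun i _ =>
        ((measurable_pi_apply i).aestronglyMeasurable.smul_const _)
    · rw [hz.map_past n 0]
      have h3 : ∀ᵐ x ∂(P.map (fun ω (k : ℕ) => z (0 - k) ω)),
          Summable (fun i => ‖x i • c i‖) := by
        have hms : MeasurableSet {x : ℕ → ℝ | Summable (fun i => ‖x i • c i‖)} := by
          have : {x : ℕ → ℝ | Summable (fun i => ‖x i • c i‖)} =
              {x : ℕ → ℝ | ∑' i, ‖x i‖ₑ * ‖c i‖ₑ ≠ ∞} := by
            ext x
            rw [Set.mem_ofPred_eq, Set.mem_ofPred_eq, ← tsum_enorm_ne_top_iff_summable_norm]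
            simp [enorm_smul]
          rw [this]
          exact (measurableSet_singleton _).compl.preimage
            (Measurable.tsum fun i => (measurable_pi_apply i).enorm.mul_const _)
        rw [ae_map_iff (hmeas 0).aemeasurable hms]
        filter_upwards [hz.ae_summable hc] with ω hω
        exact hω 0
      filter_upwards [h3] with x hx
      exact hx.of_norm.hasSum.tendsto_sum_nat
  have h2 : ∀ n : ℤ, ∫ ω, f (linProc c z n ω) ∂P =
      ∫ x, f (∑' i, x i • c i) ∂(P.map (fun ω (k : ℕ) => z (n - k) ω)) := fun n => by
    rw [integral_map (hmeas n).aemeasurable (hf.comp_aestronglyMeasurable (h n))]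
    rfl
  rw [h2, h2, hz.map_past n m]

end LinearProcess

/-! ### Moment bounds for sums of variables with a finite range of dependence. -/

section WeakDependence

/-- Within one residue class modulo the window length, the terms will depend on disjoint stretches
of noise. Padding with zeros gives all classes the same number `N` of terms. -/
theorem sum_range_residues {M : Type*} [AddCommMonoid M] (g : ℕ → M) {L : ℕ} (hL : 0 < L) (N : ℕ) :
    ∑ n ∈ Finset.range N, g n = ∑ r ∈ Finset.range L, ∑ j ∈ Finset.range N,
      if r + j * L < N then g (r + j * L) else 0 := by
  rw [← Finset.sum_product', ← Finset.sum_filter]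
  refine Finset.sum_bij' (fun n _ => (n % L, n / L)) (fun x _ => x.1 + x.2 * L) ?_ ?_ ?_ ?_ ?_
  · intro n hn
    have hn' := Finset.mem_range.1 hn
    simp only [Finset.mem_filter, Finset.mem_product, Finset.mem_range]
    refine ⟨⟨Nat.mod_lt _ hL, (Nat.div_le_self _ _).trans_lt hn'⟩, ?_⟩
    rwa [mul_comm, Nat.mod_add_div]
  · intro x hx
    simp only [Finset.mem_filter] at hx
    exact Finset.mem_range.2 hx.2
  · intro n _
    simp only
    rw [mul_comm, Nat.mod_add_div]
  · intro x hx
    simp only [Finset.mem_filter, Finset.mem_product, Finset.mem_range] at hx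
    ext
    · simp [Nat.add_mul_mod_self_right, Nat.mod_eq_of_lt hx.1.1]
    · simp only
      rw [Nat.add_mul_div_right _ _ hL, Nat.div_eq_of_lt hx.1.1, zero_add]
  · intro n _
    simp only
    rw [mul_comm, Nat.mod_add_div]

variable {Ω : Type*} [MeasurableSpace Ω] {P : Measure Ω} [IsProbabilityMeasure P]

theorem integral_pow_two_mul_eq {Y : Ω → ℝ} {m : ℕ} (hm : m ≠ 0)
    (hY : MemLp Y ((2 * m : ℕ) : ℝ≥0) P) :
    eLpNorm Y ((2 * m : ℕ) : ℝ≥0) P =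
      ENNReal.ofReal ((∫ ω, Y ω ^ (2 * m) ∂P) ^ (((2 * m : ℕ) : ℝ)⁻¹)) := by
  rw [hY.eLpNorm_eq_integral_rpow_norm (by simpa using hm) ENNReal.coe_ne_top]
  congr 2
  · refine integral_congr_ae (ae_of_all _ fun ω => ?_)
    simp only [ENNReal.coe_toReal, NNReal.coe_natCast, Real.rpow_natCast, Real.norm_eq_abs]
    exact (even_two_mul m).pow_abs _

theorem eLpNorm_le_of_integral_pow_le {Y : Ω → ℝ} {m : ℕ} (hm : m ≠ 0)
    (hY : MemLp Y ((2 * m : ℕ) : ℝ≥0) P) {B : ℝ} (hB : 0 ≤ B)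
    (h : ∫ ω, Y ω ^ (2 * m) ∂P ≤ B ^ (2 * m)) :
    eLpNorm Y ((2 * m : ℕ) : ℝ≥0) P ≤ ENNReal.ofReal B := by
  rw [integral_pow_two_mul_eq hm hY]
  refine ENNReal.ofReal_le_ofReal ?_
  have h0 : 0 ≤ ∫ ω, Y ω ^ (2 * m) ∂P := integral_nonneg fun ω => (even_two_mul m).pow_nonneg _
  refine (Real.rpow_le_rpow h0 h (by positivity)).trans_eq ?_
  exact Real.pow_rpow_inv_natCast hB (by omega)

theorem integral_pow_le_of_eLpNorm_le {Y : Ω → ℝ} {m : ℕ} {B : ℝ} (hB : 0 ≤ B)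
    (hY : MemLp Y ((2 * m : ℕ) : ℝ≥0) P)
    (h : eLpNorm Y ((2 * m : ℕ) : ℝ≥0) P ≤ ENNReal.ofReal B) {j : ℕ} (hj : j ≤ m) :
    ∫ ω, Y ω ^ (2 * j) ∂P ≤ B ^ (2 * j) := by
  rcases Nat.eq_zero_or_pos j with rfl | hj0
  · simp
  have hjm : (((2 * j : ℕ) : ℝ≥0) : ℝ≥0∞) ≤ ((2 * m : ℕ) : ℝ≥0) := by
    norm_cast; omega
  have hYj : MemLp Y ((2 * j : ℕ) : ℝ≥0) P := hY.mono_exponent hjm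
  have h1 := (eLpNorm_le_eLpNorm_of_exponent_le hjm hY.1).trans h
  rw [integral_pow_two_mul_eq hj0.ne' hYj, ENNReal.ofReal_le_ofReal_iff hB] at h1
  have h0 : 0 ≤ ∫ ω, Y ω ^ (2 * j) ∂P := integral_nonneg fun ω => (even_two_mul j).pow_nonneg _
  have h2 := pow_le_pow_left₀ (by positivity) h1 (2 * j)
  rwa [Real.rpow_inv_natCast_pow h0 (by omega)] at h2

theorem eLpNorm_sub_integral_le {Y : Ω → ℝ} {q : ℝ≥0} (hq : 1 ≤ q) (hY : MemLp Y q P) {A : ℝ}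
    (hA : 0 ≤ A) (h : eLpNorm Y q P ≤ ENNReal.ofReal A) :
    eLpNorm (fun ω => Y ω - ∫ ω', Y ω' ∂P) q P ≤ ENNReal.ofReal (2 * A) := by
  have hq' : (1 : ℝ≥0∞) ≤ q := by exact_mod_cast hq
  refine (eLpNorm_sub_le hY.1 aestronglyMeasurable_const hq').trans ?_
  rw [two_mul, ENNReal.ofReal_add hA hA]
  refine add_le_add h ?_
  rw [eLpNorm_const _ (zero_lt_one.trans_le hq').ne' (IsProbabilityMeasure.ne_zero P)]
  simp only [measure_univ, ENNReal.one_rpow, mul_one]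
  calc ‖∫ ω', Y ω' ∂P‖ₑ ≤ ∫⁻ ω', ‖Y ω'‖ₑ ∂P := enorm_integral_le_lintegral_enorm _
    _ = eLpNorm Y 1 P := eLpNorm_one_eq_lintegral_enorm.symm
    _ ≤ eLpNorm Y q P := eLpNorm_le_eLpNorm_of_exponent_le hq' hY.1
    _ ≤ _ := h

variable {z : ℤ → Ω → ℝ}

/-- The σ-algebra generated by `z k`, `k ∈ s`. -/
abbrev sigmaOf (z : ℤ → Ω → ℝ) (s : Set ℤ) : MeasurableSpace Ω :=
  ⨆ k ∈ s, MeasurableSpace.comap (z k) inferInstance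

theorem measurable_sigmaOf {s : Set ℤ} {k : ℤ} (hk : k ∈ s) : Measurable[sigmaOf z s] (z k) := by
  have h : MeasurableSpace.comap (z k) inferInstance ≤ sigmaOf z s :=
    le_iSup₂_of_le k hk le_rfl
  exact (comap_measurable (z k)).mono h le_rfl

theorem sigmaOf_mono {s t : Set ℤ} (h : s ⊆ t) : sigmaOf z s ≤ sigmaOf z t :=
  biSup_mono fun _ hk => h hk

theorem IsNoise.indepFun_of_disjoint (hz : IsNoise z P) {s t : Set ℤ} (hst : Disjoint s t)
    {X Y : Ω → ℝ} (hX : Measurable[sigmaOf z s] X) (hY : Measurable[sigmaOf z t] Y) :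
    IndepFun X Y P := by
  have h1 : Indep (sigmaOf z s) (sigmaOf z t) P :=
    indep_iSup_of_disjoint (fun k => (hz.meas k).comap_le) hz.indep.iIndep hst
  rw [IndepFun_iff_Indep]
  exact indep_of_indep_of_le_left (indep_of_indep_of_le_right h1 hY.comap_le) hX.comap_le

/-- Moments of sums of variables which depend on a moving window of the noise. -/
theorem IsNoise.exists_window_sum_le (hz : IsNoise z P) {m : ℕ} (hm : m ≠ 0) :
    ∃ C : ℝ, 0 ≤ C ∧ ∀ (l : ℕ) (D : ℕ → Ω → ℝ) (A : ℝ) (N : ℕ), 0 ≤ A →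
      (∀ n : ℕ, Measurable[sigmaOf z (Set.Icc ((n : ℤ) + 1 - l) (n + 1))] (D n)) →
      (∀ n, ∀ q : ℝ≥0, MemLp (D n) q P) →
      (∀ n, eLpNorm (D n) ((2 * m : ℕ) : ℝ≥0) P ≤ ENNReal.ofReal A) →
      eLpNorm (fun ω => ∑ n ∈ Finset.range N, (D n ω - ∫ ω', D n ω' ∂P)) ((2 * m : ℕ) : ℝ≥0) P ≤
        ENNReal.ofReal (C * (l + 1) * A * √N) := by
  obtain ⟨C, hC, hmom⟩ := exists_integral_sum_pow_le P m
  have h2m : (1 : ℝ≥0) ≤ ((2 * m : ℕ) : ℝ≥0) := by exact_mod_cast (by omega : 1 ≤ 2 * m)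
  have h2m' : (1 : ℝ≥0∞) ≤ (((2 * m : ℕ) : ℝ≥0) : ℝ≥0∞) := by exact_mod_cast h2m
  refine ⟨C ^ (((2 * m : ℕ) : ℝ)⁻¹) * 2, by positivity, fun l D A N hA hD hDm hDA => ?_⟩
  set D' : ℕ → Ω → ℝ := fun n ω => D n ω - ∫ ω', D n ω' ∂P with hD'
  have hint : ∀ n, Integrable (D n) P := fun n => by
    have := hDm n 1
    rwa [ENNReal.coe_one, memLp_one_iff_integrable] at this
  have hD'm : ∀ n, ∀ q : ℝ≥0, MemLp (D' n) q P := fun n q => (hDm n q).sub (memLp_const _)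
  have hD'0 : ∀ n, ∫ ω, D' n ω ∂P = 0 := fun n => by
    simp only [hD']
    rw [integral_sub (hint n) (integrable_const _)]; simp
  -- A window contains `l + 1` noise variables, so indices `l + 1` apart have adjacent, disjoint
  -- windows. Each residue class contributes at most order `√N`, and there are `l + 1` classes.
  let Y : ℕ → ℕ → Ω → ℝ := fun r j =>
    if r + j * (l + 1) < N then D' (r + j * (l + 1)) else fun _ => 0
  have hYm : ∀ r j, ∀ q : ℝ≥0, MemLp (Y r j) q P := fun r j q => by
    simp only [Y]; split_ifs
    · exact hD'm _ q
    · exact memLp_const 0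
  have hY0 : ∀ r j, ∫ ω, Y r j ω ∂P = 0 := fun r j => by
    simp only [Y]; split_ifs
    · exact hD'0 _
    · simp
  have hYA : ∀ r j, eLpNorm (Y r j) ((2 * m : ℕ) : ℝ≥0) P ≤ ENNReal.ofReal (2 * A) := fun r j => by
    simp only [Y]; split_ifs
    · exact eLpNorm_sub_integral_le h2m (hDm _ _) hA (hDA _)
    · simp
  have hYmeas : ∀ r j, Measurable[sigmaOf z (Set.Icc (((r + j * (l + 1) : ℕ) : ℤ) + 1 - l)
      ((r + j * (l + 1) : ℕ) + 1))] (Y r j) := fun r j => by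
    simp only [Y]; split_ifs
    · exact (hD _).sub_const _
    · exact measurable_const
  -- The earlier terms of the class only see noise up to the time just before the current window
  -- opens.
  have hind : ∀ r n, IndepFun (fun ω => ∑ j ∈ Finset.range n, Y r j ω) (Y r n) P := fun r n => by
    refine hz.indepFun_of_disjoint (s := Set.Iic (((r + n * (l + 1) : ℕ) : ℤ) - l))
      (t := Set.Icc (((r + n * (l + 1) : ℕ) : ℤ) + 1 - l) ((r + n * (l + 1) : ℕ) + 1)) ?_ ?_
      (hYmeas r n)
    · rw [Set.disjoint_left]
      intro k hk hk'
      simp only [Set.mem_Iic, Set.mem_Icc] at hk hk'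
      omega
    · refine Finset.measurable_fun_sum _ fun j hj => ?_
      refine (hYmeas r j).mono (sigmaOf_mono fun k hk => ?_) le_rfl
      have hj' : j + 1 ≤ n := Finset.mem_range.1 hj
      have h1 : (j + 1) * (l + 1) ≤ n * (l + 1) := Nat.mul_le_mul_right _ hj'
      simp only [Set.mem_Iic, Set.mem_Icc] at hk ⊢
      have h2 : (j + 1) * (l + 1) = j * (l + 1) + l + 1 := by ring
      omega
  have hclass : ∀ r, eLpNorm (fun ω => ∑ j ∈ Finset.range N, Y r j ω) ((2 * m : ℕ) : ℝ≥0) P ≤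
      ENNReal.ofReal (C ^ (((2 * m : ℕ) : ℝ)⁻¹) * 2 * A * √N) := fun r => by
    refine eLpNorm_le_of_integral_pow_le hm (memLp_finsetSum _ fun j _ => hYm r j _)
      (by positivity) ?_
    refine (hmom (Y r) (2 * A) N (by positivity) (hind r) (hYm r) (hY0 r) fun j k hk =>
      integral_pow_le_of_eLpNorm_le (by positivity) (hYm r j _) (hYA r j) hk).trans_eq ?_
    have e : C ^ (((2 * m : ℕ) : ℝ)⁻¹) * 2 * A * √N = C ^ (((2 * m : ℕ) : ℝ)⁻¹) * ((2 * A) * √N) := by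
      ring
    rw [e, mul_pow (C ^ _), Real.rpow_inv_natCast_pow hC (by omega), mul_pow (2 * A), pow_mul (√N),
      Real.sq_sqrt (by positivity)]
    ring
  have hsum : (fun ω => ∑ n ∈ Finset.range N, D' n ω) =
      ∑ r ∈ Finset.range (l + 1), fun ω => ∑ j ∈ Finset.range N, Y r j ω := by
    ext ω
    rw [sum_range_residues (fun n => D' n ω) (Nat.succ_pos l) N, Finset.sum_apply]
    refine Finset.sum_congr rfl fun r _ => Finset.sum_congr rfl fun j _ => ?_
    simp only [Y, Nat.succ_eq_add_one]
    split_ifs <;> rfl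
  rw [hsum]
  refine (eLpNorm_sum_le (fun r _ => (memLp_finsetSum _ fun j _ => hYm r j 1).1) h2m').trans ?_
  refine (Finset.sum_le_sum fun r _ => hclass r).trans_eq ?_
  rw [Finset.sum_const, Finset.card_range, nsmul_eq_mul, ← ENNReal.ofReal_natCast,
    ← ENNReal.ofReal_mul (by positivity)]
  congr 1
  push_cast; ring

end WeakDependence

/-! ### Square-root growth of sums of functionals of a linear process. -/

section Ergodic

variable {G : Type*} [NormedAddCommGroup G]

theorem continuous_of_polyLip {F : Type*} [NormedAddCommGroup F] {f : G → F} {K : ℝ} {s : ℕ}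
    (h : ∀ x y, ‖f x - f y‖ ≤ K * (1 + ‖x‖ + ‖y‖) ^ s * ‖x - y‖) : Continuous f := by
  refine continuous_iff_continuousAt.2 fun x => ?_
  rw [ContinuousAt, tendsto_iff_norm_sub_tendsto_zero]
  refine squeeze_zero (fun _ => norm_nonneg _) (fun y => h y x) ?_
  have h1 : Continuous fun y => K * (1 + ‖y‖ + ‖x‖) ^ s * ‖y - x‖ := by fun_prop
  simpa using h1.tendsto x

variable [NormedSpace ℝ G] [CompleteSpace G] {c : ℕ → G}
  {Ω : Type*} [MeasurableSpace Ω] {P : Measure Ω} [IsProbabilityMeasure P] {z : ℤ → Ω → ℝ}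

/-- Hölder's inequality: the polynomial factor has bounded moments and the tail of the envelope
decays geometrically, at a rate independent of `q`. This one bound serves both the truncation
increments and the truncation errors. -/
theorem IsNoise.exists_env_mul_le (hz : IsNoise z P) (hc : ExpDecay c) {K : ℝ} (hK : 0 ≤ K) (s : ℕ) :
    ∃ κ : ℝ, 0 < κ ∧ κ < 1 ∧ ∀ q : ℝ≥0, 1 ≤ q → ∃ A : ℝ, 0 ≤ A ∧ ∀ (m : ℕ) (n : ℤ) (Y : Ω → ℝ),
      (∀ᵐ ω ∂P, |Y ω| ≤ K * (1 + 2 * envProc c z 0 n ω) ^ s * envProc c z m n ω) →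
      eLpNorm Y q P ≤ ENNReal.ofReal (A * κ ^ m) := by
  obtain ⟨κ, hκ0, hκ1, hm, henv⟩ := hz.exists_envProc_le hc
  refine ⟨κ, hκ0, hκ1, fun q hq => ?_⟩
  have hW : MB P (fun (n : ℤ) ω => K * (1 + 2 * envProc c z 0 n ω) ^ s) :=
    (MB.const K).mul (((MB.const 1).add ((MB.const 2).mul (hz.mb_envProc hc))).pow s)
  obtain ⟨B, hB⟩ := hW.bound (2 * q) (one_le_two_mul hq)
  obtain ⟨A, hA, hA'⟩ := henv (2 * q) (one_le_two_mul hq)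
  refine ⟨B * A, by positivity, fun m n Y hY => ?_⟩
  have h1 : eLpNorm Y q P ≤ eLpNorm (fun ω => K * (1 + 2 * envProc c z 0 n ω) ^ s *
      envProc c z m n ω) q P := by
    refine eLpNorm_mono_ae ?_
    filter_upwards [hY] with ω hω
    exact hω.trans (le_abs_self _)
  refine h1.trans ((eLpNorm_mul_le_two_mul (hW.meas n) (hm m n) hq).trans
    ((mul_le_mul' (hB n) (hA' m n)).trans_eq ?_))
  rw [← ENNReal.ofReal_coe_nnreal, ← ENNReal.ofReal_mul (by positivity), mul_assoc]

/-- Moment bounds for sums of functionals of a linear process. -/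
theorem IsNoise.exists_sum_le (hz : IsNoise z P) (hc : ExpDecay c) {ι : Type*} {f : ι → G → ℝ}
    {K : ℝ} {s : ℕ} (hK : 0 ≤ K)
    (hf : ∀ i x y, ‖f i x - f i y‖ ≤ K * (1 + ‖x‖ + ‖y‖) ^ s * ‖x - y‖) {q : ℝ≥0} (hq : 1 ≤ q) :
    ∃ C : ℝ, 0 ≤ C ∧ ∀ i (N : ℕ), eLpNorm (fun ω => ∑ n ∈ Finset.range N,
      (f i (linProc c z (n + 1) ω) - ∫ ω', f i (linProc c z (n + 1) ω') ∂P)) q P ≤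
        ENNReal.ofReal (C * √N) := by
  obtain ⟨m, hqm⟩ := exists_nat_ge q
  have hm : m ≠ 0 := by
    rintro rfl
    simp only [Nat.cast_zero] at hqm
    exact absurd (hq.trans hqm) (by norm_num)
  have h2m : (1 : ℝ≥0) ≤ ((2 * m : ℕ) : ℝ≥0) := by exact_mod_cast (by omega : 1 ≤ 2 * m)
  have hq2m : (q : ℝ≥0∞) ≤ ((2 * m : ℕ) : ℝ≥0) := by
    rw [ENNReal.coe_le_coe]
    exact hqm.trans (by exact_mod_cast (by omega : m ≤ 2 * m))
  obtain ⟨κ, hκ0, hκ1, henv⟩ := hz.exists_env_mul_le hc hK s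
  obtain ⟨A, hA, hAe⟩ := henv _ h2m
  obtain ⟨C, hC, hwin⟩ := hz.exists_window_sum_le hm
  have hcont : ∀ i, Continuous (f i) := fun i => continuous_of_polyLip (hf i)
  have hsum : Summable fun l : ℕ => ((l : ℝ) + 1) * κ ^ l := by
    have h1 := summable_pow_mul_geometric_of_norm_lt_one 1
      (r := κ) (by rwa [Real.norm_of_nonneg hκ0.le])
    have h2 := summable_geometric_of_lt_one hκ0.le hκ1
    exact (h1.add h2).congr fun l => by ring
  set σ₀ := ∑' l : ℕ, ((l : ℝ) + 1) * κ ^ l with hσ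
  refine ⟨C * A * σ₀, by positivity, fun i N => ?_⟩
  -- Telescoping in the truncation level: the value is `f i 0` plus the increments `D l n` for `l <
  -- M`, plus the error `T M n`. The increments at level `l` see a window of length `l + 1` and are
  -- of size `κ^l`, so their sum over `n` is of order `(l + 1) κ^l √N`, summable in `l`; the error
  -- vanishes as `M → ∞` with `N` fixed.
  let D : ℕ → ℕ → Ω → ℝ := fun l n ω =>
    f i (truncProc c z (l + 1) (n + 1) ω) - f i (truncProc c z l (n + 1) ω)
  let T : ℕ → ℕ → Ω → ℝ := fun M n ω =>
    f i (linProc c z (n + 1) ω) - f i (truncProc c z M (n + 1) ω)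
  have htm : ∀ (l : ℕ) (n : ℕ), StronglyMeasurable[sigmaOf z (Set.Icc ((n : ℤ) + 1 - l) (n + 1))]
      (truncProc c z (l + 1) (n + 1)) := fun l n => by
    refine Finset.stronglyMeasurable_fun_sum _ fun k hk => ?_
    refine StronglyMeasurable.smul_const (Measurable.stronglyMeasurable
      (measurable_sigmaOf (s := Set.Icc ((n : ℤ) + 1 - l) (n + 1)) ⟨?_, ?_⟩)) _ <;> have := Finset.mem_range.1 hk <;> omega
  have htm' : ∀ (l : ℕ) (n : ℕ), StronglyMeasurable[sigmaOf z (Set.Icc ((n : ℤ) + 1 - l) (n + 1))]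
      (truncProc c z l (n + 1)) := fun l n => by
    refine Finset.stronglyMeasurable_fun_sum _ fun k hk => ?_
    refine StronglyMeasurable.smul_const (Measurable.stronglyMeasurable
      (measurable_sigmaOf (s := Set.Icc ((n : ℤ) + 1 - l) (n + 1)) ⟨?_, ?_⟩)) _ <;> have := Finset.mem_range.1 hk <;> omega
  have hle : ∀ s, sigmaOf z s ≤ ‹MeasurableSpace Ω› := fun s =>
    iSup₂_le fun k _ => (hz.meas k).comap_le
  have hDmeas : ∀ l n : ℕ, Measurable[sigmaOf z (Set.Icc ((n : ℤ) + 1 - l) (n + 1))] (D l n) :=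
    fun l n => (((hcont i).comp_stronglyMeasurable (htm l n)).measurable).sub
      (((hcont i).comp_stronglyMeasurable (htm' l n)).measurable)
  have hgrow : ∀ (ω : Ω) (n : ℤ), ∀ x y : G, ‖x‖ ≤ envProc c z 0 n ω → ‖y‖ ≤ envProc c z 0 n ω →
      ∀ e : ℝ, ‖x - y‖ ≤ e → |f i x - f i y| ≤ K * (1 + 2 * envProc c z 0 n ω) ^ s * e :=
    fun ω n x y hx hy e he => by
      refine (hf i x y).trans ?_
      have : 0 ≤ envProc c z 0 n ω := envProc_nonneg 0 n ω
      have h1 : 1 + ‖x‖ + ‖y‖ ≤ 1 + 2 * envProc c z 0 n ω := by linarith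
      gcongr
  have hDb : ∀ l n : ℕ, ∀ᵐ ω ∂P, |D l n ω| ≤
      K * (1 + 2 * envProc c z 0 (n + 1) ω) ^ s * envProc c z l (n + 1) ω := fun l n => by
    filter_upwards [hz.ae_summable hc] with ω hω
    refine hgrow ω (n + 1) _ _ (norm_truncProc_le (hω _) _) (norm_truncProc_le (hω _) _) _ ?_
    have h1 : truncProc c z (l + 1) (n + 1) ω - truncProc c z l (n + 1) ω =
        z ((n : ℤ) + 1 - l) ω • c l := by
      simp [truncProc, Finset.sum_range_succ]
    rw [h1]
    have h2 := ((summable_nat_add_iff l).2 (hω (n + 1))).le_tsum 0 fun _ _ => norm_nonneg _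
    simpa [envProc] using h2
  have hTb : ∀ M n : ℕ, ∀ᵐ ω ∂P, |T M n ω| ≤
      K * (1 + 2 * envProc c z 0 (n + 1) ω) ^ s * envProc c z M (n + 1) ω := fun M n => by
    filter_upwards [hz.ae_summable hc] with ω hω
    exact hgrow ω (n + 1) _ _ (norm_linProc_le (hω _)) (norm_truncProc_le (hω _) _) _
      (norm_linProc_sub_truncProc_le (hω _) _)
  have hTm : ∀ M n, AEStronglyMeasurable (T M n) P := fun M n =>
    ((hcont i).comp_aestronglyMeasurable (hz.aestronglyMeasurable_linProc hc _)).sub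
      (((hcont i).comp_stronglyMeasurable (htm' M n)).mono (hle _)).aestronglyMeasurable
  have hmem : ∀ {l : ℕ} {n : ℤ} {Y : Ω → ℝ}, AEStronglyMeasurable Y P → (∀ᵐ ω ∂P, |Y ω| ≤
      K * (1 + 2 * envProc c z 0 n ω) ^ s * envProc c z l n ω) → ∀ q : ℝ≥0, MemLp Y q P :=
    fun {l n Y} hYm hY q => by
      obtain ⟨A', -, hA'⟩ := henv (max q 1) (le_max_right _ _)
      have h : MemLp Y (max q 1 : ℝ≥0) P := ⟨hYm, (hA' l n Y hY).trans_lt ENNReal.ofReal_lt_top⟩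
      exact h.mono_exponent (by exact_mod_cast le_max_left _ _)
  have hDm : ∀ l n, AEStronglyMeasurable (D l n) P := fun l n =>
    ((hDmeas l n).mono (hle _) le_rfl).aestronglyMeasurable
  have hint1 : ∀ {Y : Ω → ℝ}, (∀ q : ℝ≥0, MemLp Y q P) → Integrable Y P := fun h => by
    have := h 1
    rwa [ENNReal.coe_one, memLp_one_iff_integrable] at this
  have hDint : ∀ l n, Integrable (D l n) P := fun l n => hint1 (hmem (hDm l n) (hDb l n))
  have hTint : ∀ M n, Integrable (T M n) P := fun M n => hint1 (hmem (hTm M n) (hTb M n))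
  have hdec : ∀ (M n : ℕ) ω, f i (linProc c z (n + 1) ω) = f i 0 + ∑ l ∈ Finset.range M, D l n ω + T M n ω :=
    fun M n ω => by
      simp only [D, T]
      rw [Finset.sum_range_sub (fun l => f i (truncProc c z l (n + 1) ω))]
      simp [truncProc]
  have hkey : ∀ M, eLpNorm (fun ω => ∑ n ∈ Finset.range N,
      (f i (linProc c z (n + 1) ω) - ∫ ω', f i (linProc c z (n + 1) ω') ∂P)) q P ≤
        ENNReal.ofReal (C * A * σ₀ * √N) + ENNReal.ofReal (N * (2 * A) * κ ^ M) := fun M => by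
    have e1 : (fun ω => ∑ n ∈ Finset.range N,
        (f i (linProc c z (n + 1) ω) - ∫ ω', f i (linProc c z (n + 1) ω') ∂P)) =
        (∑ l ∈ Finset.range M, fun ω => ∑ n ∈ Finset.range N, (D l n ω - ∫ ω', D l n ω' ∂P)) +
        ∑ n ∈ Finset.range N, fun ω => (T M n ω - ∫ ω', T M n ω' ∂P) := by
      ext ω
      rw [Pi.add_apply, Finset.sum_apply, Finset.sum_apply, Finset.sum_comm,
        ← Finset.sum_add_distrib]
      refine Finset.sum_congr rfl fun n _ => ?_
      have e2 : ∫ ω', f i (linProc c z (n + 1) ω') ∂P =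
          f i 0 + ∑ l ∈ Finset.range M, ∫ ω', D l n ω' ∂P + ∫ ω', T M n ω' ∂P := by
        simp_rw [hdec M n]
        have hs : Integrable (fun ω => ∑ l ∈ Finset.range M, D l n ω) P :=
          integrable_finsetSum _ fun l _ => hDint l n
        have hi : Integrable (fun ω => f i 0 + ∑ l ∈ Finset.range M, D l n ω) P :=
          (integrable_const _).add hs
        rw [integral_add hi (hTint M n), integral_add (integrable_const _) hs,
          integral_finsetSum _ fun l _ => hDint l n]
        simp
      have e3 : ∑ l ∈ Finset.range M, (D l n ω - ∫ ω', D l n ω' ∂P) =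
          ∑ l ∈ Finset.range M, D l n ω - ∑ l ∈ Finset.range M, ∫ ω', D l n ω' ∂P :=
        Finset.sum_sub_distrib _ _
      rw [e2, hdec M n ω, e3]
      ring
    have hSm : ∀ l, AEStronglyMeasurable
        (fun ω => ∑ n ∈ Finset.range N, (D l n ω - ∫ ω', D l n ω' ∂P)) P := fun l =>
      Finset.aestronglyMeasurable_fun_sum _ fun n _ => (hDm l n).sub aestronglyMeasurable_const
    have hTm' : ∀ n, AEStronglyMeasurable (fun ω => T M n ω - ∫ ω', T M n ω' ∂P) P := fun n =>
      (hTm M n).sub aestronglyMeasurable_const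
    have h2m' : (1 : ℝ≥0∞) ≤ (((2 * m : ℕ) : ℝ≥0) : ℝ≥0∞) := by exact_mod_cast h2m
    have hA1 := Finset.aestronglyMeasurable_sum (Finset.range M) fun l _ => hSm l
    have hA2 := Finset.aestronglyMeasurable_sum (Finset.range N) fun n _ => hTm' n
    rw [e1]
    refine (eLpNorm_le_eLpNorm_of_exponent_le hq2m (hA1.add hA2)).trans
      ((eLpNorm_add_le hA1 hA2 h2m').trans (add_le_add ?_ ?_))
    · refine (eLpNorm_sum_le (fun l _ => hSm l) h2m').trans ?_
      have h3 : ∀ l ∈ Finset.range M, eLpNorm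
          (fun ω => ∑ n ∈ Finset.range N, (D l n ω - ∫ ω', D l n ω' ∂P)) ((2 * m : ℕ) : ℝ≥0) P ≤
          ENNReal.ofReal (C * A * √N * (((l : ℝ) + 1) * κ ^ l)) := fun l _ => by
        refine (hwin l (D l) (A * κ ^ l) N (by positivity) (hDmeas l)
          (fun n => hmem (hDm l n) (hDb l n)) fun n => hAe l _ _ (hDb l n)).trans_eq ?_
        congr 1; ring
      refine (Finset.sum_le_sum h3).trans ?_
      rw [← ENNReal.ofReal_sum_of_nonneg fun l _ => by positivity, ← Finset.mul_sum]
      refine ENNReal.ofReal_le_ofReal ?_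
      rw [mul_right_comm _ σ₀]
      gcongr
      exact hsum.sum_le_tsum _ fun l _ => by positivity
    · refine (eLpNorm_sum_le (fun n _ => hTm' n) h2m').trans ?_
      have h3 : ∀ n ∈ Finset.range N, eLpNorm (fun ω => T M n ω - ∫ ω', T M n ω' ∂P)
          ((2 * m : ℕ) : ℝ≥0) P ≤ ENNReal.ofReal (2 * (A * κ ^ M)) := fun n _ =>
        eLpNorm_sub_integral_le h2m (hmem (hTm M n) (hTb M n) _) (by positivity)
          (hAe M _ _ (hTb M n))
      refine (Finset.sum_le_sum h3).trans_eq ?_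
      rw [Finset.sum_const, Finset.card_range, nsmul_eq_mul, ← ENNReal.ofReal_natCast,
        ← ENNReal.ofReal_mul (by positivity)]
      congr 1; ring
  have hlim : Tendsto (fun M : ℕ => ENNReal.ofReal (C * A * σ₀ * √N) +
      ENNReal.ofReal (N * (2 * A) * κ ^ M)) atTop (𝓝 (ENNReal.ofReal (C * A * σ₀ * √N) + 0)) := by
    refine tendsto_const_nhds.add ?_
    have h1 : Tendsto (fun M : ℕ => N * (2 * A) * κ ^ M) atTop (𝓝 0) := by
      simpa using (tendsto_pow_atTop_nhds_zero_of_lt_one hκ0.le hκ1).const_mul (N * (2 * A))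
    simpa [Function.comp_def] using (ENNReal.continuous_ofReal.tendsto 0).comp h1
  rw [add_zero] at hlim
  exact ge_of_tendsto' hlim hkey

end Ergodic

/-! ### Functionals of polynomial growth -/

section PolynomialGrowth


variable {E G F F₁ F₂ F₃ : Type*} [NormedAddCommGroup E] [NormedAddCommGroup G]
  [NormedAddCommGroup F] [NormedAddCommGroup F₁] [NormedAddCommGroup F₂] [NormedAddCommGroup F₃]

/-- `f θ x`, `θ ∈ D`, is bounded and Lipschitz with constants of polynomial growth in `x`. -/
def PL (D : Set E) (f : E → G → F) : Prop :=
  ∃ (K : ℝ) (s : ℕ), 0 ≤ K ∧ (∀ θ ∈ D, ∀ x, ‖f θ x‖ ≤ K * (1 + ‖x‖) ^ s) ∧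
    ∀ θ ∈ D, ∀ θ' ∈ D, ∀ x y,
      ‖f θ x - f θ' y‖ ≤ K * (1 + ‖x‖ + ‖y‖) ^ s * (‖θ - θ'‖ + ‖x - y‖)

variable {D : Set E}

theorem PL.add {f g : E → G → F} (hf : PL D f) (hg : PL D g) : PL D (fun θ x => f θ x + g θ x) := by
  obtain ⟨K, s, hK, h1, h2⟩ := hf
  obtain ⟨K', s', hK', h1', h2'⟩ := hg
  refine ⟨K + K', max s s', by positivity, fun θ hθ x => ?_, fun θ hθ θ' hθ' x y => ?_⟩
  · have hx : 1 ≤ 1 + ‖x‖ := by linarith [norm_nonneg x]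
    refine (norm_add_le _ _).trans ?_
    rw [add_mul]
    refine add_le_add ((h1 θ hθ x).trans ?_) ((h1' θ hθ x).trans ?_)
    · gcongr
      exact le_max_left _ _
    · gcongr
      exact le_max_right _ _
  · have hx : 1 ≤ 1 + ‖x‖ + ‖y‖ := by linarith [norm_nonneg x, norm_nonneg y]
    rw [add_sub_add_comm, add_mul, add_mul]
    refine (norm_add_le _ _).trans (add_le_add ((h2 θ hθ θ' hθ' x y).trans ?_)
      ((h2' θ hθ θ' hθ' x y).trans ?_))
    · gcongr
      exact le_max_left _ _
    · gcongr
      exact le_max_right _ _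

theorem PL.of_lipschitz {b : E → F} {K : ℝ} (hK : 0 ≤ K) (h1 : ∀ θ ∈ D, ‖b θ‖ ≤ K)
    (h2 : ∀ θ ∈ D, ∀ θ' ∈ D, ‖b θ - b θ'‖ ≤ K * ‖θ - θ'‖) : PL D (fun θ (_ : G) => b θ) := by
  refine ⟨K, 0, hK, fun θ hθ x => by simpa using h1 θ hθ, fun θ hθ θ' hθ' x y => ?_⟩
  rw [pow_zero, mul_one]
  exact (h2 θ hθ θ' hθ').trans (by gcongr; exact le_add_of_nonneg_right (norm_nonneg _))

theorem PL.const (v : F) : PL D (fun _ (_ : G) => v) :=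
  PL.of_lipschitz (norm_nonneg v) (fun _ _ => le_rfl) fun θ _ θ' _ => by simp; positivity

theorem PL.id : PL D (fun (_ : E) (x : G) => x) := by
  refine ⟨1, 1, zero_le_one, fun θ hθ x => by simp, fun θ hθ θ' hθ' x y => ?_⟩
  have h1 : 1 ≤ 1 + ‖x‖ + ‖y‖ := by linarith [norm_nonneg x, norm_nonneg y]
  calc ‖x - y‖ ≤ 1 * (‖θ - θ'‖ + ‖x - y‖) := by
        rw [one_mul]; exact le_add_of_nonneg_left (norm_nonneg _)
    _ ≤ 1 * (1 + ‖x‖ + ‖y‖) ^ 1 * (‖θ - θ'‖ + ‖x - y‖) := by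
        rw [one_mul (_ ^ 1), pow_one]; gcongr

theorem PL.expI {f : E → G → ℝ} (hf : PL D f) (u : ℝ) :
    PL D (fun θ x => Complex.exp (Complex.I * u * f θ x)) := by
  obtain ⟨K, s, hK, h1, h2⟩ := hf
  have hexp : ∀ a b : ℝ, ‖Complex.exp (Complex.I * u * a) - Complex.exp (Complex.I * u * b)‖ ≤
      |u| * |a - b| := fun a b => by
    have e : Complex.exp (Complex.I * u * a) - Complex.exp (Complex.I * u * b) =
        Complex.exp (Complex.I * (u * b : ℝ)) * (Complex.exp (Complex.I * (u * (a - b) : ℝ)) - 1) := by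
      rw [mul_sub, ← Complex.exp_add, mul_one]
      push_cast
      ring_nf
    rw [e, norm_mul, mul_comm Complex.I, Complex.norm_exp_ofReal_mul_I, one_mul, ← abs_mul]
    exact Real.norm_exp_I_mul_ofReal_sub_one_le
  refine ⟨1 + |u| * K, s, by positivity, fun θ hθ x => ?_, fun θ hθ θ' hθ' x y => ?_⟩
  · beta_reduce
    rw [show Complex.I * u * f θ x = ((u * f θ x : ℝ) : ℂ) * Complex.I by push_cast; ring,
      Complex.norm_exp_ofReal_mul_I]
    have hx : 1 ≤ (1 + ‖x‖) ^ s := one_le_pow₀ (by linarith [norm_nonneg x])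
    have : 0 ≤ |u| * K := by positivity
    nlinarith
  · refine (hexp _ _).trans ?_
    have h3 := h2 θ hθ θ' hθ' x y
    rw [Real.norm_eq_abs] at h3
    calc |u| * |f θ x - f θ' y| ≤ |u| * (K * (1 + ‖x‖ + ‖y‖) ^ s * (‖θ - θ'‖ + ‖x - y‖)) := by gcongr
      _ = |u| * K * ((1 + ‖x‖ + ‖y‖) ^ s * (‖θ - θ'‖ + ‖x - y‖)) := by ring
      _ ≤ (1 + |u| * K) * ((1 + ‖x‖ + ‖y‖) ^ s * (‖θ - θ'‖ + ‖x - y‖)) := by gcongr; linarith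
      _ = _ := by ring

variable [NormedSpace ℝ F] [NormedSpace ℝ F₁] [NormedSpace ℝ F₂] [NormedSpace ℝ F₃]

theorem PL.clm {f : E → G → F₁} (hf : PL D f) (L : F₁ →L[ℝ] F₂) : PL D (fun θ x => L (f θ x)) := by
  obtain ⟨K, s, hK, h1, h2⟩ := hf
  refine ⟨‖L‖ * K, s, by positivity, fun θ hθ x => ?_, fun θ hθ θ' hθ' x y => ?_⟩
  · refine (L.le_opNorm _).trans ?_
    rw [mul_assoc]; gcongr; exact h1 θ hθ x
  · rw [← map_sub]
    refine (L.le_opNorm _).trans ?_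
    rw [mul_assoc, mul_assoc, ← mul_assoc K]; gcongr; exact h2 θ hθ θ' hθ' x y

theorem PL.bilin {f : E → G → F₁} {g : E → G → F₂} (hf : PL D f) (hg : PL D g)
    (B : F₁ →L[ℝ] F₂ →L[ℝ] F₃) : PL D (fun θ x => B (f θ x) (g θ x)) := by
  obtain ⟨K, s, hK, h1, h2⟩ := hf
  obtain ⟨K', s', hK', h1', h2'⟩ := hg
  refine ⟨‖B‖ * (2 * K * K'), s + s', by positivity, fun θ hθ x => ?_, fun θ hθ θ' hθ' x y => ?_⟩
  · have hx : 1 ≤ 1 + ‖x‖ := by linarith [norm_nonneg x]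
    calc ‖B (f θ x) (g θ x)‖ ≤ ‖B‖ * ‖f θ x‖ * ‖g θ x‖ := B.le_opNorm₂ _ _
      _ ≤ ‖B‖ * (K * (1 + ‖x‖) ^ s) * (K' * (1 + ‖x‖) ^ s') := by
        gcongr
        · exact h1 θ hθ x
        · exact h1' θ hθ x
      _ = ‖B‖ * (1 * K * K') * (1 + ‖x‖) ^ (s + s') := by rw [pow_add]; ring
      _ ≤ _ := by gcongr; norm_num
  · set w := 1 + ‖x‖ + ‖y‖ with hw
    have hx : 1 + ‖x‖ ≤ w := by simp [hw]
    have hy : 1 + ‖y‖ ≤ w := by simp [hw]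
    have e : B (f θ x) (g θ x) - B (f θ' y) (g θ' y) =
        B (f θ x - f θ' y) (g θ x) + B (f θ' y) (g θ x - g θ' y) := by
      simp [map_sub]
    rw [e]
    refine (norm_add_le _ _).trans ?_
    calc ‖B (f θ x - f θ' y) (g θ x)‖ + ‖B (f θ' y) (g θ x - g θ' y)‖
        ≤ ‖B‖ * ‖f θ x - f θ' y‖ * ‖g θ x‖ + ‖B‖ * ‖f θ' y‖ * ‖g θ x - g θ' y‖ :=
          add_le_add (B.le_opNorm₂ _ _) (B.le_opNorm₂ _ _)
      _ ≤ ‖B‖ * (K * w ^ s * (‖θ - θ'‖ + ‖x - y‖)) * (K' * w ^ s') +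
          ‖B‖ * (K * w ^ s) * (K' * w ^ s' * (‖θ - θ'‖ + ‖x - y‖)) := by
        gcongr
        · exact h2 θ hθ θ' hθ' x y
        · exact (h1' θ hθ x).trans (by gcongr)
        · exact (h1 θ' hθ' y).trans (by gcongr)
        · exact h2' θ hθ θ' hθ' x y
      _ = _ := by rw [pow_add]; ring

variable [NormedSpace ℝ E]

/-- `PL` functions whose derivative in `θ` exists on `D` and is `PL`. -/
structure SPL (D : Set E) (f : E → G → F) (f' : E → G → E →L[ℝ] F) : Prop where
  pl : PL D f
  pl' : PL D f'
  deriv : ∀ θ ∈ D, ∀ x, HasFDerivAt (fun τ => f τ x) (f' θ x) θ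

theorem SPL.id [NormedSpace ℝ G] : SPL D (fun (_ : E) (x : G) => x) (fun _ _ => 0) :=
  ⟨PL.id, PL.const 0, fun _ _ x => hasFDerivAt_const x _⟩

theorem SPL.clm {f : E → G → F₁} {f' : E → G → E →L[ℝ] F₁} (hf : SPL D f f') (L : F₁ →L[ℝ] F₂) :
    SPL D (fun θ x => L (f θ x)) (fun θ x => L ∘L f' θ x) :=
  ⟨hf.pl.clm L, hf.pl'.clm (ContinuousLinearMap.compL ℝ E F₁ F₂ L),
    fun θ hθ x => L.hasFDerivAt.comp θ (hf.deriv θ hθ x)⟩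

theorem SPL.bilin {f : E → G → F₁} {g : E → G → F₂} {f' : E → G → E →L[ℝ] F₁}
    {g' : E → G → E →L[ℝ] F₂} (hf : SPL D f f') (hg : SPL D g g') (B : F₁ →L[ℝ] F₂ →L[ℝ] F₃) :
    SPL D (fun θ x => B (f θ x) (g θ x))
      (fun θ x => B.precompR E (f θ x) (g' θ x) + B.precompL E (f' θ x) (g θ x)) :=
  ⟨hf.pl.bilin hg.pl B, (hf.pl.bilin hg.pl' _).add (hf.pl'.bilin hg.pl _),
    fun θ hθ x => B.hasFDerivAt_of_bilinear (hf.deriv θ hθ x) (hg.deriv θ hθ x)⟩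

theorem SPL.expI {f : E → G → ℝ} {f' : E → G → E →L[ℝ] ℝ} (hf : SPL D f f') (u : ℝ) :
    SPL D (fun θ x => Complex.exp (Complex.I * u * f θ x))
      (fun θ x => (f' θ x).smulRight (Complex.I * u * Complex.exp (Complex.I * u * f θ x))) := by
  refine ⟨hf.pl.expI u, ?_, fun θ hθ x => ?_⟩
  · have h1 := (hf.pl.expI u).clm ((Complex.I * u) • (ContinuousLinearMap.id ℝ ℂ))
    exact hf.pl'.bilin h1 (ContinuousLinearMap.smulRightL ℝ E ℂ)
  · have h1 : HasDerivAt (fun s : ℝ => Complex.exp (Complex.I * u * s))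
        (Complex.I * u * Complex.exp (Complex.I * u * f θ x)) (f θ x) := by
      have h2 : HasDerivAt (fun s : ℝ => Complex.I * u * (s : ℂ)) (Complex.I * u) (f θ x) := by
        simpa using ((hasDerivAt_id (f θ x)).ofReal_comp).const_mul (Complex.I * u)
      simpa [mul_comm] using h2.cexp
    refine (h1.hasFDerivAt.comp θ (hf.deriv θ hθ x)).congr_fderiv ?_
    ext v
    simp

/-- `D` is not assumed convex, so the mean value inequality is unavailable on it; local Lipschitz
continuity is made global by compactness. -/
theorem exists_lipschitz_of_contDiffAt {b : E → F} (hD : IsCompact D)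
    (hb : ∀ θ ∈ D, ContDiffAt ℝ 1 b θ) : ∃ K : ℝ, 0 ≤ K ∧ (∀ θ ∈ D, ‖b θ‖ ≤ K) ∧
      ∀ θ ∈ D, ∀ θ' ∈ D, ‖b θ - b θ'‖ ≤ K * ‖θ - θ'‖ := by
  obtain ⟨C, hC⟩ := hD.exists_bound_of_continuousOn
    fun θ hθ => (hb θ hθ).continuousAt.continuousWithinAt
  obtain ⟨K, hK⟩ := LocallyLipschitzOn.exists_lipschitzOnWith_of_compact hD (f := b)
    fun θ hθ => by
      obtain ⟨K, t, ht, h⟩ := (hb θ hθ).exists_lipschitzOnWith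
      exact ⟨K, t, mem_nhdsWithin_of_mem_nhds ht, h⟩
  refine ⟨max K C, le_max_of_le_left K.2, fun θ hθ => (hC θ hθ).trans (le_max_right _ _),
    fun θ hθ θ' hθ' => ?_⟩
  have := hK.dist_le_mul θ hθ θ' hθ'
  rw [dist_eq_norm, dist_eq_norm] at this
  exact this.trans (by gcongr; exact le_max_left _ _)

theorem SPL.of_contDiffAt {b : E → F} (hD : IsCompact D) (hb : ∀ θ ∈ D, ContDiffAt ℝ 2 b θ) :
    SPL D (fun θ (_ : G) => b θ) (fun θ _ => fderiv ℝ b θ) := by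
  obtain ⟨K, hK, h1, h2⟩ := exists_lipschitz_of_contDiffAt hD
    fun θ hθ => (hb θ hθ).of_le (by norm_num)
  obtain ⟨K', hK', h1', h2'⟩ := exists_lipschitz_of_contDiffAt hD (b := fderiv ℝ b)
    fun θ hθ => (hb θ hθ).fderiv_right (by norm_num)
  exact ⟨PL.of_lipschitz hK h1 h2, PL.of_lipschitz hK' h1' h2',
    fun θ hθ x => ((hb θ hθ).differentiableAt (by norm_num)).hasFDerivAt⟩

end PolynomialGrowth

/-! ### Averages over asymptotically stationary samples -/

section Averages

variable {Ω : Type*} [MeasurableSpace Ω] {P : Measure Ω}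

/-- Starting the filter at time `0` instead of `-∞` costs a total error bounded in `N`, hence one of
order `N⁻¹` in averages. -/
theorem MB.sum_bound {W : ℕ → Ω → ℝ} (hW : MB P W) {ϱ : ℝ} (h0 : 0 ≤ ϱ) (h1 : ϱ < 1) {q : ℝ≥0}
    (hq : 1 ≤ q) : ∃ C : ℝ≥0, ∀ N : ℕ,
      eLpNorm (fun ω => ∑ n ∈ Finset.Icc 1 N, ϱ ^ n * W n ω) q P ≤ C := by
  obtain ⟨C, hC⟩ := hW.bound q hq
  refine ⟨(1 - ϱ)⁻¹.toNNReal * C, fun N => ?_⟩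
  have h2 : eLpNorm (∑ n ∈ Finset.Icc 1 N, fun ω => ϱ ^ n * W n ω) q P ≤
      ∑ n ∈ Finset.Icc 1 N, eLpNorm (fun ω => ϱ ^ n * W n ω) q P :=
    eLpNorm_sum_le (fun n _ => (hW.meas n).const_mul _) (by exact_mod_cast hq)
  have e : (fun ω => ∑ n ∈ Finset.Icc 1 N, ϱ ^ n * W n ω) =
      ∑ n ∈ Finset.Icc 1 N, fun ω => ϱ ^ n * W n ω := by ext; simp
  rw [e]
  refine h2.trans ?_
  calc ∑ n ∈ Finset.Icc 1 N, eLpNorm (fun ω => ϱ ^ n * W n ω) q P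
      ≤ ∑ n ∈ Finset.Icc 1 N, ENNReal.ofReal (ϱ ^ n) * C := by
        refine Finset.sum_le_sum fun n _ => ?_
        have : (fun ω => ϱ ^ n * W n ω) = (ϱ ^ n) • W n := rfl
        rw [this, eLpNorm_const_smul, Real.enorm_eq_ofReal (by positivity)]
        gcongr
        exact hC n
    _ = ENNReal.ofReal (∑ n ∈ Finset.Icc 1 N, ϱ ^ n) * C := by
        rw [← Finset.sum_mul, ENNReal.ofReal_sum_of_nonneg fun _ _ => by positivity]
    _ ≤ _ := by
        rw [ENNReal.coe_mul]
        gcongr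
        refine ENNReal.ofReal_le_ofReal ?_
        rw [← tsum_geometric_of_lt_one h0 h1]
        exact (summable_geometric_of_lt_one h0 h1).sum_le_tsum _ fun _ _ => by positivity

theorem MB.om_average {W : ℕ → Ω → ℝ} (hW : MB P W) :
    OM P (fun N ω => (N : ℝ)⁻¹ * ∑ n ∈ Finset.Icc 1 N, W n ω) 0 := by
  refine ⟨fun N _ => (Finset.aestronglyMeasurable_fun_sum _ fun n _ => hW.meas n).const_mul _,
    fun q hq => ?_⟩
  obtain ⟨C, hC⟩ := hW.bound q hq
  refine ⟨C, fun N hN => ?_⟩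
  have h2 : eLpNorm (∑ n ∈ Finset.Icc 1 N, W n) q P ≤ ∑ n ∈ Finset.Icc 1 N, eLpNorm (W n) q P :=
    eLpNorm_sum_le (fun n _ => hW.meas n) (by exact_mod_cast hq)
  have e : (fun ω => (N : ℝ)⁻¹ * ∑ n ∈ Finset.Icc 1 N, W n ω) =
      (N : ℝ)⁻¹ • ∑ n ∈ Finset.Icc 1 N, W n := by ext; simp
  have hN0 : (0 : ℝ) < N := by exact_mod_cast hN
  rw [e, eLpNorm_const_smul, Real.enorm_eq_ofReal (by positivity)]
  calc ENNReal.ofReal ((N : ℝ)⁻¹) * eLpNorm (∑ n ∈ Finset.Icc 1 N, W n) q P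
      ≤ ENNReal.ofReal ((N : ℝ)⁻¹) * ∑ n ∈ Finset.Icc 1 N, (C : ℝ≥0∞) := by
        gcongr
        exact h2.trans (Finset.sum_le_sum fun n _ => hC n)
    _ = ENNReal.ofReal ((N : ℝ)⁻¹) * ENNReal.ofReal N * C := by
        rw [Finset.sum_const, Nat.card_Icc, Nat.add_sub_cancel, nsmul_eq_mul,
          ENNReal.ofReal_natCast, mul_assoc]
    _ = C * ENNReal.ofReal ((N : ℝ) ^ (-0 : ℝ)) := by
        rw [← ENNReal.ofReal_mul (by positivity), inv_mul_cancel₀ hN0.ne']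
        simp

variable {G : Type*} [NormedAddCommGroup G] [NormedSpace ℝ G]

/-- `X` is a sample approaching the linear process of `c` and `z` exponentially fast. -/
structure IsSample (c : ℕ → G) (z : ℤ → Ω → ℝ) (P : Measure Ω) (X : ℕ → Ω → G) : Prop where
  noise : IsNoise z P
  decay : ExpDecay c
  meas : ∀ n, AEStronglyMeasurable (X n) P
  close : ∃ (ϱ : ℝ) (Y : Ω → ℝ), 0 < ϱ ∧ ϱ < 1 ∧ MB P (fun _ : ℕ => Y) ∧
    ∀ᵐ ω ∂P, ∀ n : ℕ, ‖X n ω - linProc c z n ω‖ ≤ ϱ ^ n * Y ω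

variable {E F F₁ : Type*} [NormedAddCommGroup E] [NormedAddCommGroup F] [NormedSpace ℝ F]
  [NormedAddCommGroup F₁] [NormedSpace ℝ F₁]

/-- The average of `f θ` over a sample. -/
def avg (X : ℕ → Ω → G) (f : E → G → F) (N : ℕ) (θ : E) (ω : Ω) : F :=
  (N : ℝ)⁻¹ • ∑ n ∈ Finset.Icc 1 N, f θ (X n ω)

/-- The expectation of `f θ` under the stationary law. -/
def statMean (c : ℕ → G) (z : ℤ → Ω → ℝ) (P : Measure Ω) (f : E → G → F) (θ : E) : F :=
  ∫ ω, f θ (linProc c z 0 ω) ∂P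

variable [CompleteSpace G] {c : ℕ → G} {z : ℤ → Ω → ℝ} {X : ℕ → Ω → G} {D : Set E}

theorem PL.continuous {f : E → G → F} (hf : PL D f) {θ : E} (hθ : θ ∈ D) : Continuous (f θ) := by
  obtain ⟨K, s, hK, -, h⟩ := hf
  exact continuous_of_polyLip (K := K) (s := s) fun x y => by simpa using h θ hθ θ hθ x y

variable [IsProbabilityMeasure P]

theorem IsNoise.mb_linProc (hz : IsNoise z P) (hc : ExpDecay c) :
    MB P (fun (n : ℤ) ω => ‖linProc c z n ω‖) := by
  refine (hz.mb_envProc hc).mono (fun n => (hz.aestronglyMeasurable_linProc hc n).norm) fun n => ?_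
  filter_upwards [hz.ae_summable hc] with ω hω
  rw [abs_of_nonneg (norm_nonneg _)]
  exact (norm_linProc_le (hω n)).trans (le_abs_self _)

theorem IsSample.mb (hX : IsSample c z P X) : MB P (fun n ω => ‖X n ω‖) := by
  obtain ⟨ϱ, Y, h0, h1, hY, hcl⟩ := hX.close
  have hL : MB P (fun (n : ℕ) ω => ‖linProc c z n ω‖) := by
    have := hX.noise.mb_linProc hX.decay
    exact ⟨fun n => this.meas n, fun q hq => (this.bound q hq).imp fun C hC n => hC n⟩
  refine (hL.add hY).mono (fun n => (hX.meas n).norm) fun n => ?_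
  filter_upwards [hcl] with ω hω
  have h2 : ‖X n ω‖ ≤ ‖linProc c z n ω‖ + ‖X n ω - linProc c z n ω‖ := by
    simpa using norm_add_le (linProc c z n ω) (X n ω - linProc c z n ω)
  have h3 : ϱ ^ n * Y ω ≤ 1 * |Y ω| := by
    refine (mul_le_mul_of_nonneg_left (le_abs_self _) (by positivity)).trans ?_
    gcongr
    exact pow_le_one₀ h0.le h1.le
  have h4 : 0 ≤ Y ω := by
    have := (norm_nonneg _).trans (hω 0)
    simpa using this
  rw [abs_of_nonneg (norm_nonneg _), abs_of_nonneg (by positivity)]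
  rw [abs_of_nonneg h4] at h3
  linarith [hω n]

theorem PL.integrable {f : E → G → F} (hf : PL D f) (hz : IsNoise z P) (hc : ExpDecay c) {θ : E}
    (hθ : θ ∈ D) (n : ℤ) : Integrable (fun ω => f θ (linProc c z n ω)) P := by
  have hcont := hf.continuous hθ
  obtain ⟨K, s, hK, h, -⟩ := hf
  have hW : MB P (fun (n : ℤ) ω => K * (1 + ‖linProc c z n ω‖) ^ s) :=
    (MB.const K).mul (((MB.const 1).add (hz.mb_linProc hc)).pow s)
  exact (hW.integrable n).mono' (hcont.comp_aestronglyMeasurable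
    (hz.aestronglyMeasurable_linProc hc n)) (ae_of_all _ fun ω => h θ hθ _)

theorem PL.exists_statMean_bound {f : E → G → F} (hf : PL D f) (hz : IsNoise z P)
    (hc : ExpDecay c) : ∃ K : ℝ, 0 ≤ K ∧ (∀ θ ∈ D, ‖statMean c z P f θ‖ ≤ K) ∧
      ∀ θ ∈ D, ∀ θ' ∈ D, ‖statMean c z P f θ - statMean c z P f θ'‖ ≤ K * ‖θ - θ'‖ := by
  have hint := fun θ hθ => hf.integrable (θ := θ) hz hc hθ 0
  obtain ⟨K, s, hK, h, h'⟩ := hf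
  let W : ℤ → Ω → ℝ := fun n ω => K * (1 + 2 * ‖linProc c z n ω‖) ^ s
  have hW : MB P W := (MB.const K).mul (((MB.const 1).add ((MB.const 2).mul (hz.mb_linProc hc))).pow s)
  have hWi := hW.integrable 0
  refine ⟨∫ ω, W 0 ω ∂P, integral_nonneg fun ω => by positivity, fun θ hθ => ?_,
    fun θ hθ θ' hθ' => ?_⟩
  · refine (norm_integral_le_integral_norm _).trans (integral_mono (hint θ hθ).norm hWi fun ω => ?_)
    refine (h θ hθ _).trans ?_
    simp only [W]
    gcongr
    linarith [norm_nonneg (linProc c z 0 ω)]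
  · rw [statMean, statMean, ← integral_sub (hint θ hθ) (hint θ' hθ'), ← integral_mul_const]
    refine (norm_integral_le_integral_norm _).trans (integral_mono
      ((hint θ hθ).sub (hint θ' hθ')).norm (hWi.mul_const _) fun ω => ?_)
    have := h' θ hθ θ' hθ' (linProc c z 0 ω) (linProc c z 0 ω)
    simpa only [sub_self, norm_zero, add_zero, add_assoc, ← two_mul] using this

theorem PL.aestronglyMeasurable_avg {f : E → G → F} (hf : PL D f) (hX : IsSample c z P X) {θ : E}
    (hθ : θ ∈ D) (N : ℕ) : AEStronglyMeasurable (avg X f N θ) P :=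
  (Finset.aestronglyMeasurable_fun_sum _ fun n _ =>
    (hf.continuous hθ).comp_aestronglyMeasurable (hX.meas n)).const_smul _

/-- Replacing the sample by the stationary process costs a bounded total error, and the centred
stationary sum is of order `√N`. Uniformity of the constant in `θ` is what the maximal inequality
requires. -/
theorem PL.eLpNorm_avg_sub_le {f : E → G → ℝ} (hf : PL D f) (hX : IsSample c z P X) {q : ℝ≥0}
    (hq : 1 ≤ q) : ∃ C : ℝ≥0, ∀ N : ℕ, 1 ≤ N → ∀ θ ∈ D,
      eLpNorm (fun ω => avg X f N θ ω - statMean c z P f θ) q P ≤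
        C * ENNReal.ofReal ((N : ℝ) ^ (-(1 / 2) : ℝ)) := by
  have hcont := fun θ hθ => hf.continuous (θ := θ) hθ
  obtain ⟨K, s, hK, -, h⟩ := hf
  obtain ⟨ϱ, Y, h0, h1, hY, hcl⟩ := hX.close
  have hL : MB P (fun (n : ℕ) ω => ‖linProc c z n ω‖) := by
    have := hX.noise.mb_linProc hX.decay
    exact ⟨fun n => this.meas n, fun q hq => (this.bound q hq).imp fun C hC n => hC n⟩
  let W : ℕ → Ω → ℝ := fun n ω => K * (1 + ‖X n ω‖ + ‖linProc c z n ω‖) ^ s * Y ω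
  have hW : MB P W := ((MB.const K).mul ((((MB.const 1).add hX.mb).add hL).pow s)).mul hY
  obtain ⟨C, hC⟩ := hW.sum_bound h0.le h1 hq
  -- The index type is `D` itself, which makes the constant common to all parameters.
  obtain ⟨C', hC'0, hC'⟩ := hX.noise.exists_sum_le hX.decay (ι := D) (f := fun θ => f θ) hK
    (fun θ x y => by simpa using h θ θ.2 θ θ.2 x y) hq
  refine ⟨C + C'.toNNReal, fun N hN θ hθ => ?_⟩
  have hN0 : (0 : ℝ) < N := by exact_mod_cast hN
  let R : Ω → ℝ := fun ω => ∑ n ∈ Finset.Icc 1 N, (f θ (X n ω) - f θ (linProc c z n ω))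
  let T : Ω → ℝ := fun ω => ∑ n ∈ Finset.range N, (f θ (linProc c z (n + 1) ω) -
    ∫ ω', f θ (linProc c z (n + 1) ω') ∂P)
  have hLm := fun n => (hcont θ hθ).comp_aestronglyMeasurable
    (hX.noise.aestronglyMeasurable_linProc hX.decay n)
  have hRm : AEStronglyMeasurable R P := Finset.aestronglyMeasurable_fun_sum _ fun n _ =>
    ((hcont θ hθ).comp_aestronglyMeasurable (hX.meas n)).sub (hLm n)
  have hTm : AEStronglyMeasurable T P := Finset.aestronglyMeasurable_fun_sum _ fun n _ =>
    (hLm (n + 1)).sub aestronglyMeasurable_const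
  have e : (fun ω => avg X f N θ ω - statMean c z P f θ) = (N : ℝ)⁻¹ • (R + T) := by
    ext ω
    have e1 : ∀ n : ℕ, ∫ ω', f θ (linProc c z (n + 1) ω') ∂P = statMean c z P f θ := fun n =>
      hX.noise.integral_linProc hX.decay (hcont θ hθ) _ _
    have e2 : ∑ n ∈ Finset.Icc 1 N, f θ (linProc c z n ω) =
        ∑ n ∈ Finset.range N, f θ (linProc c z (n + 1) ω) := by
      have := Finset.sum_Ico_add' (fun n : ℕ => f θ (linProc c z n ω)) 0 N 1
      rw [Finset.range_eq_Ico]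
      simp only [Nat.cast_add, Nat.cast_one, zero_add] at this
      rw [this]
      rfl
    simp only [Pi.smul_apply, Pi.add_apply, R, T, e1, Finset.sum_sub_distrib, e2, avg, smul_eq_mul,
      Finset.sum_const, Finset.card_range, nsmul_eq_mul]
    field_simp
    ring
  have hR : eLpNorm R q P ≤ C := by
    refine (eLpNorm_mono_ae ?_).trans (hC N)
    filter_upwards [hcl] with ω hω
    have hY0 : 0 ≤ Y ω := by simpa using (norm_nonneg _).trans (hω 0)
    rw [Real.norm_of_nonneg (r := ∑ n ∈ Finset.Icc 1 N, ϱ ^ n * W n ω) (by positivity)]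
    refine (norm_sum_le _ _).trans (Finset.sum_le_sum fun n _ => ?_)
    have := h θ hθ θ hθ (X n ω) (linProc c z n ω)
    rw [sub_self, norm_zero, zero_add] at this
    refine this.trans ((mul_le_mul_of_nonneg_left (hω n) (by positivity)).trans_eq ?_)
    simp only [W]
    ring
  have hT : eLpNorm T q P ≤ ENNReal.ofReal (C' * √N) := hC' ⟨θ, hθ⟩ N
  rw [e, eLpNorm_const_smul, Real.enorm_eq_ofReal (by positivity)]
  have hsq : (N : ℝ) ^ (-(1 / 2) : ℝ) = (N : ℝ)⁻¹ * √N := by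
    rw [Real.sqrt_eq_rpow, ← Real.rpow_neg_one, ← Real.rpow_add hN0]; norm_num
  calc ENNReal.ofReal (N : ℝ)⁻¹ * eLpNorm (R + T) q P
      ≤ ENNReal.ofReal (N : ℝ)⁻¹ * (C * ENNReal.ofReal √N + ENNReal.ofReal (C' * √N)) := by
        gcongr
        refine (eLpNorm_add_le hRm hTm (by exact_mod_cast hq)).trans (add_le_add (hR.trans ?_) hT)
        refine le_mul_of_one_le_right' ?_
        rw [ENNReal.one_le_ofReal]
        exact Real.one_le_sqrt.2 (by exact_mod_cast hN)
    _ = _ := by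
        rw [hsq, ENNReal.ofReal_mul hC'0, ENNReal.ofReal_mul (by positivity), ENNReal.coe_add]
        simp only [ENNReal.ofReal]
        ring

theorem PL.om_avg_sub_real {f : E → G → ℝ} (hf : PL D f) (hX : IsSample c z P X) {θ : E}
    (hθ : θ ∈ D) : OM P (fun N ω => avg X f N θ ω - statMean c z P f θ) (1 / 2) :=
  ⟨fun N _ => (hf.aestronglyMeasurable_avg hX hθ N).sub aestronglyMeasurable_const, fun q hq => by
    obtain ⟨C, hC⟩ := hf.eLpNorm_avg_sub_le hX hq
    exact ⟨C, fun N hN => hC N hN θ hθ⟩⟩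

theorem PL.norm : PL D (fun (_ : E) (x : G) => ‖x‖) := by
  refine ⟨1, 1, zero_le_one, fun θ hθ x => by simp, fun θ hθ θ' hθ' x y => ?_⟩
  have h1 : 1 ≤ 1 + ‖x‖ + ‖y‖ := by linarith [norm_nonneg x, norm_nonneg y]
  calc ‖‖x‖ - ‖y‖‖ ≤ 1 * (‖θ - θ'‖ + ‖x - y‖) := by
        rw [one_mul]
        exact (abs_norm_sub_norm_le x y).trans (le_add_of_nonneg_left (norm_nonneg _))
    _ ≤ 1 * (1 + ‖x‖ + ‖y‖) ^ 1 * (‖θ - θ'‖ + ‖x - y‖) := by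
        rw [one_mul (_ ^ 1), pow_one]; gcongr

theorem PL.pow {f : E → G → ℝ} (hf : PL D f) (n : ℕ) : PL D (fun θ x => f θ x ^ n) := by
  induction n with
  | zero => simpa using PL.const (1 : ℝ)
  | succ n ih =>
    simp only [pow_succ]
    exact ih.bilin hf (ContinuousLinearMap.mul ℝ ℝ)

/-- Averages over a sample are bounded and Lipschitz in the parameter, with a constant that is
itself an average. -/
theorem PL.exists_avg_bound {f : E → G → F} (hf : PL D f) (hX : IsSample c z P X) :
    ∃ ξ : ℕ → Ω → ℝ, OM P ξ 0 ∧ (∀ N ω, 0 ≤ ξ N ω) ∧ (∀ N ω, ∀ θ ∈ D, ‖avg X f N θ ω‖ ≤ ξ N ω) ∧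
      (∀ N ω, ∀ θ ∈ D, ∀ θ' ∈ D, ‖avg X f N θ ω - avg X f N θ' ω‖ ≤ ξ N ω * ‖θ - θ'‖) ∧
      ∃ L : ℝ, OM P (fun N ω => ξ N ω - L) (1 / 2) := by
  obtain ⟨K, s, hK, h, h'⟩ := hf
  let W : ℕ → Ω → ℝ := fun n ω => K * (1 + 2 * ‖X n ω‖) ^ s
  have hW : MB P W := (MB.const K).mul (((MB.const 1).add ((MB.const 2).mul hX.mb)).pow s)
  -- The majorant is itself of polynomial growth and Lipschitz in the same sense, so its average
  -- concentrates at a number. Hence the random Lipschitz constant is bounded by a deterministic one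
  -- on a good event.
  have hpl : PL (Set.univ : Set ℝ) (fun _ (x : G) => K * (1 + 2 * ‖x‖) ^ s) :=
    (PL.const K).bilin (((PL.const 1).add ((PL.const 2).bilin PL.norm
      (ContinuousLinearMap.mul ℝ ℝ))).pow s) (ContinuousLinearMap.mul ℝ ℝ)
  refine ⟨_, hW.om_average, fun N ω => by positivity, fun N ω θ hθ => ?_,
    fun N ω θ hθ θ' hθ' => ?_, _, hpl.om_avg_sub_real hX (Set.mem_univ 0)⟩
  · rw [avg, norm_smul, Real.norm_of_nonneg (by positivity)]
    gcongr
    refine (norm_sum_le _ _).trans (Finset.sum_le_sum fun n _ => (h θ hθ _).trans ?_)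
    simp only [W]
    gcongr
    linarith [norm_nonneg (X n ω)]
  · rw [avg, avg, ← smul_sub, ← Finset.sum_sub_distrib, norm_smul, Real.norm_of_nonneg (by positivity),
      mul_assoc, Finset.sum_mul]
    gcongr
    refine (norm_sum_le _ _).trans (Finset.sum_le_sum fun n _ => ?_)
    have := h' θ hθ θ' hθ' (X n ω) (X n ω)
    simpa only [sub_self, norm_zero, add_zero, add_assoc, ← two_mul] using this

theorem PL.exists_unif_real {p : ℕ} {D : Set (Vec p)} {f : Vec p → G → ℝ} (hf : PL D f)
    (hD : Bornology.IsBounded D) (hX : IsSample c z P X) : ∃ Y : ℕ → Ω → ℝ, OM P Y (1 / 4) ∧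
      ∀ N, 1 ≤ N → ∀ᵐ ω ∂P, ∀ θ ∈ D, |avg X f N θ ω - statMean c z P f θ| ≤ Y N ω := by
  obtain ⟨ξ, hξ, hξ0, -, hlip, -⟩ := hf.exists_avg_bound hX
  obtain ⟨K, hK, -, hlip'⟩ := hf.exists_statMean_bound hX.noise hX.decay
  refine exists_uniform_bound hD (ξ := fun N ω => ξ N ω + K)
    (fun N _ θ hθ => (hf.aestronglyMeasurable_avg hX hθ N).sub aestronglyMeasurable_const)
    (fun q hq => hf.eLpNorm_avg_sub_le hX hq) (hξ.add (OM.const K))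
    fun N _ => ae_of_all _ fun ω θ hθ θ' hθ' => ?_
  have h1 := hlip N ω θ hθ θ' hθ'
  have h2 := hlip' θ hθ θ' hθ'
  rw [Real.norm_eq_abs] at h1 h2
  calc _ = |(avg X f N θ ω - avg X f N θ' ω) - (statMean c z P f θ - statMean c z P f θ')| := by
        congr 1; ring
    _ ≤ _ := (abs_sub _ _).trans (by rw [add_mul]; exact add_le_add h1 h2)

theorem avg_clm (f : E → G → F) (L : F →L[ℝ] F₁) (N : ℕ) (θ : E) (ω : Ω) :
    avg X (fun θ x => L (f θ x)) N θ ω = L (avg X f N θ ω) := by simp [avg]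

theorem PL.statMean_clm [CompleteSpace F] [CompleteSpace F₁] {f : E → G → F} (hf : PL D f)
    (hz : IsNoise z P) (hc : ExpDecay c) (L : F →L[ℝ] F₁) {θ : E} (hθ : θ ∈ D) :
    statMean c z P (fun θ x => L (f θ x)) θ = L (statMean c z P f θ) :=
  L.integral_comp_comm (hf.integrable hz hc hθ 0)

/-- Used to deduce the statements for vector-valued averages from the scalar ones. -/
theorem exists_coord (F : Type*) [NormedAddCommGroup F] [NormedSpace ℝ F] [FiniteDimensional ℝ F] :
    ∃ (n : ℕ) (L : Fin n → F →L[ℝ] ℝ) (C : ℝ), 0 ≤ C ∧ ∀ v, ‖v‖ ≤ C * ∑ i, |L i v| := by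
  let b := Module.finBasis ℝ F
  refine ⟨_, fun i => LinearMap.toContinuousLinearMap (b.coord i), ∑ i, ‖b i‖, by positivity,
    fun v => ?_⟩
  calc ‖v‖ = ‖∑ i, b.coord i v • b i‖ := by simp [b.sum_repr]
    _ ≤ ∑ i, ‖b i‖ * |b.coord i v| := (norm_sum_le _ _).trans
      (Finset.sum_le_sum fun i _ => by rw [norm_smul, mul_comm, Real.norm_eq_abs])
    _ ≤ ∑ i, (∑ j, ‖b j‖) * |b.coord i v| := Finset.sum_le_sum fun i _ => by
      gcongr
      exact Finset.single_le_sum (f := fun j => ‖b j‖) (fun j _ => norm_nonneg _) (Finset.mem_univ i)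
    _ = _ := by rw [Finset.mul_sum]; rfl

variable [FiniteDimensional ℝ F]

theorem PL.om_norm_avg_sub {f : E → G → F} (hf : PL D f) (hX : IsSample c z P X) {θ : E}
    (hθ : θ ∈ D) : OM P (fun N ω => ‖avg X f N θ ω - statMean c z P f θ‖) (1 / 2) := by
  have := FiniteDimensional.complete ℝ F
  obtain ⟨n, L, C, hC, hL⟩ := exists_coord F
  have h : ∀ i, OM P (fun N ω => |avg X (fun θ x => L i (f θ x)) N θ ω -
    statMean c z P (fun θ x => L i (f θ x)) θ|) (1 / 2) := fun i =>
      ((hf.clm (L i)).om_avg_sub_real hX hθ).abs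
  refine ((OM.sum Finset.univ fun i _ => h i).const_mul C).mono (fun N _ =>
    ((hf.aestronglyMeasurable_avg hX hθ N).sub aestronglyMeasurable_const).norm)
    fun N _ => ae_of_all _ fun ω => ?_
  rw [abs_norm, abs_of_nonneg (by positivity)]
  refine (hL _).trans_eq ?_
  simp_rw [avg_clm, hf.statMean_clm hX.noise hX.decay _ hθ, ← map_sub]

theorem PL.exists_unif {p : ℕ} {D : Set (Vec p)} {f : Vec p → G → F} (hf : PL D f)
    (hD : Bornology.IsBounded D) (hX : IsSample c z P X) : ∃ Y : ℕ → Ω → ℝ, OM P Y (1 / 4) ∧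
      ∀ N, 1 ≤ N → ∀ᵐ ω ∂P, ∀ θ ∈ D, ‖avg X f N θ ω - statMean c z P f θ‖ ≤ Y N ω := by
  have := FiniteDimensional.complete ℝ F
  obtain ⟨n, L, C, hC, hL⟩ := exists_coord F
  choose Y hY hY' using fun i => (hf.clm (L i)).exists_unif_real hD hX
  refine ⟨_, (OM.sum Finset.univ fun i _ => hY i).const_mul C, fun N hN => ?_⟩
  filter_upwards [ae_all_iff.2 fun i => hY' i N hN] with ω hω θ hθ
  refine (hL _).trans ?_
  gcongr with i _
  have := hω i θ hθ
  rwa [avg_clm, hf.statMean_clm hX.noise hX.decay _ hθ, ← map_sub] at this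

end Averages

/-! ### Differentiation of averages and of stationary means. -/

section Derivatives

variable {Ω : Type*} [MeasurableSpace Ω] {P : Measure Ω} [IsProbabilityMeasure P]
  {G E F : Type*} [NormedAddCommGroup G] [NormedSpace ℝ G] [CompleteSpace G]
  [NormedAddCommGroup E] [NormedSpace ℝ E] [NormedAddCommGroup F] [NormedSpace ℝ F]
  {c : ℕ → G} {z : ℤ → Ω → ℝ} {X : ℕ → Ω → G} {D : Set E}

theorem SPL.hasFDerivAt_avg {f : E → G → F} {f' : E → G → E →L[ℝ] F} (hf : SPL D f f') (N : ℕ)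
    (ω : Ω) {θ : E} (hθ : θ ∈ D) : HasFDerivAt (fun τ => avg X f N τ ω) (avg X f' N θ ω) θ :=
  (HasFDerivAt.fun_sum fun n _ => hf.deriv θ hθ (X n ω)).const_smul _

theorem SPL.hasFDerivAt_statMean [CompleteSpace F] {f : E → G → F} {f' : E → G → E →L[ℝ] F}
    (hf : SPL D f f') (hz : IsNoise z P) (hc : ExpDecay c) {θ : E} (hθ : θ ∈ interior D) :
    HasFDerivAt (statMean c z P f) (statMean c z P f' θ) θ := by
  have hint' := hf.pl'.integrable hz hc (interior_subset hθ) 0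
  obtain ⟨K, s, hK, h, -⟩ := hf.pl'
  have hW : MB P (fun (n : ℤ) ω => K * (1 + ‖linProc c z n ω‖) ^ s) :=
    (MB.const K).mul (((MB.const 1).add (hz.mb_linProc hc)).pow s)
  have hnhds : D ∈ 𝓝 θ := mem_interior_iff_mem_nhds.1 hθ
  obtain ⟨ε, hε, hball⟩ := Metric.mem_nhds_iff.1 hnhds
  exact hasFDerivAt_integral_of_dominated_of_fderiv_le (Metric.ball_mem_nhds θ hε)
    (F := fun τ ω => f τ (linProc c z 0 ω)) (F' := fun τ ω => f' τ (linProc c z 0 ω))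
    (by filter_upwards [hnhds] with τ hτ using (hf.pl.integrable hz hc hτ 0).1)
    (hf.pl.integrable hz hc (interior_subset hθ) 0) hint'.1
    (ae_of_all _ fun ω τ hτ => h τ (hball hτ) _) (hW.integrable 0)
    (ae_of_all _ fun ω τ hτ => hf.deriv τ (hball hτ) _)

end Derivatives

/-! ### The innovations as functionals of the weighted inverse filter -/

theorem tsum_antidiagonal {f : ℕ × ℕ → ℝ}
    (h : Summable fun i => ∑ x ∈ Finset.HasAntidiagonal.antidiagonal i, |f x|) :
    Summable f ∧ ∑' i, ∑ x ∈ Finset.HasAntidiagonal.antidiagonal i, f x = ∑' k, ∑' j, f (k, j) := by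
  let e := Finset.HasAntidiagonal.sigmaAntidiagonalEquivProd (A := ℕ)
  have h1 : Summable fun x => |f (e x)| := by
    refine (summable_sigma_of_nonneg fun _ => abs_nonneg _).2 ⟨fun i => Summable.of_finite, ?_⟩
    refine h.congr fun i => ?_
    exact (Finset.tsum_subtype (Finset.HasAntidiagonal.antidiagonal i) fun x => |f x|).symm
  have h2 : Summable fun x => f (e x) := h1.of_abs
  have h3 : Summable f := e.summable_iff.1 h2
  refine ⟨h3, ?_⟩
  rw [← h3.tsum_prod, ← e.tsum_eq, h2.tsum_sigma]
  exact tsum_congr fun i => (Finset.tsum_subtype (Finset.HasAntidiagonal.antidiagonal i) f).symm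

section Filter

variable (a : ℕ → ℝ) (r : ℝ)

/-- The functional `∑_{k + j = i} r⁻ᵏ a_j e_k*`. -/
def delayKernel (i : ℕ) : (ℕ →ᵇ ℝ) →L[ℝ] ℝ :=
  ∑ x ∈ Finset.HasAntidiagonal.antidiagonal i, (r⁻¹ ^ x.1 * a x.2) • BoundedContinuousFunction.evalCLM ℝ x.1

/-- The dominating coefficients `∑_{k + j = i} r⁻ᵏ |a_j|`. -/
def absKernel (i : ℕ) : ℝ := ∑ x ∈ Finset.HasAntidiagonal.antidiagonal i, r⁻¹ ^ x.1 * |a x.2|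

variable {a r}

theorem delayKernel_apply (i : ℕ) (β : ℕ →ᵇ ℝ) :
    delayKernel a r i β = ∑ x ∈ Finset.HasAntidiagonal.antidiagonal i, r⁻¹ ^ x.1 * a x.2 * β x.1 := by
  simp [delayKernel, sum_apply]

theorem norm_delayKernel_le (hr : 0 ≤ r) (i : ℕ) : ‖delayKernel a r i‖ ≤ absKernel a r i := by
  have h0 : ∀ k, 0 ≤ r⁻¹ ^ k := fun k => by positivity
  refine ContinuousLinearMap.opNorm_le_bound _
    (Finset.sum_nonneg fun x _ => mul_nonneg (h0 _) (abs_nonneg _)) fun β => ?_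
  rw [delayKernel_apply, absKernel, Finset.sum_mul]
  refine (norm_sum_le _ _).trans (Finset.sum_le_sum fun x _ => ?_)
  rw [norm_mul, norm_mul, Real.norm_of_nonneg (h0 _), Real.norm_eq_abs (a _)]
  have := h0 x.1
  gcongr
  exact β.norm_coe_le_norm _

theorem expDecay_absKernel (hr : 1 < r) (ha : ExpDecay a) : ExpDecay (absKernel a r) := by
  obtain ⟨C, κ, hC, hκ0, hκ1, h⟩ := ha
  have hr1 : r⁻¹ < 1 := inv_lt_one_of_one_lt₀ hr
  have hr0 : 0 < r⁻¹ := by positivity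
  -- Strict inequality above both rates absorbs the linear factor that a convolution of two
  -- geometric sequences can produce.
  obtain ⟨τ, hτ, hτ1⟩ := exists_between (max_lt hκ1 hr1)
  have hτκ : κ < τ := (le_max_left _ _).trans_lt hτ
  have hτr : r⁻¹ < τ := (le_max_right _ _).trans_lt hτ
  have hτ0 : 0 < τ := hκ0.trans hτκ
  have hs0 : 0 ≤ r⁻¹ / τ := by positivity
  have hs1 : r⁻¹ / τ < 1 := (div_lt_one hτ0).2 hτr
  refine ⟨C * (1 - r⁻¹ / τ)⁻¹, τ, mul_nonneg hC (inv_nonneg.2 (by linarith)), hτ0, hτ1, fun i => ?_⟩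
  rw [absKernel, Real.norm_of_nonneg (Finset.sum_nonneg fun x _ => by positivity),
    ← tsum_geometric_of_lt_one hs0 hs1]
  calc ∑ x ∈ Finset.HasAntidiagonal.antidiagonal i, r⁻¹ ^ x.1 * |a x.2|
      ≤ ∑ x ∈ Finset.HasAntidiagonal.antidiagonal i, C * τ ^ i * (r⁻¹ / τ) ^ x.1 := by
        refine Finset.sum_le_sum fun x hx => ?_
        rw [Finset.HasAntidiagonal.mem_antidiagonal] at hx
        calc r⁻¹ ^ x.1 * |a x.2| ≤ r⁻¹ ^ x.1 * (C * τ ^ x.2) := by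
              gcongr
              exact (h x.2).trans (by gcongr)
          _ = C * τ ^ i * (r⁻¹ / τ) ^ x.1 := by
              rw [← hx, pow_add, div_pow]
              field_simp
    _ = C * τ ^ i * ∑ k ∈ Finset.range (i + 1), (r⁻¹ / τ) ^ k := by
        rw [← Finset.mul_sum,
          Finset.Nat.sum_antidiagonal_eq_sum_range_succ (fun k _ => (r⁻¹ / τ) ^ k)]
    _ ≤ C * τ ^ i * ∑' k, (r⁻¹ / τ) ^ k := by
        gcongr
        exact (summable_geometric_of_lt_one hs0 hs1).sum_le_tsum _ fun _ _ => by positivity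
    _ = _ := by ring

theorem expDecay_delayKernel (hr : 1 < r) (ha : ExpDecay a) : ExpDecay (delayKernel a r) := by
  obtain ⟨C, κ, hC, hκ0, hκ1, h⟩ := expDecay_absKernel hr ha
  exact ⟨C, κ, hC, hκ0, hκ1, fun i => (norm_delayKernel_le (by linarith) i).trans
    ((le_abs_self _).trans (h i))⟩

variable {Ω : Type*} {z : ℤ → Ω → ℝ}

theorem map_linProc {G : Type*} [NormedAddCommGroup G] [NormedSpace ℝ G] [CompleteSpace G]
    {c : ℕ → G} (L : G →L[ℝ] ℝ) {ω : Ω} {n : ℤ} {d : ℕ → ℝ} (hd : ∀ i, ‖c i‖ ≤ d i)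
    (hs : Summable fun i : ℕ => ‖z (n - i) ω • d i‖) :
    L (linProc c z n ω) = ∑' i : ℕ, z (n - i) ω * L (c i) := by
  have hs' : Summable fun i : ℕ => z (n - i) ω • c i := by
    refine Summable.of_norm_bounded hs fun i => ?_
    rw [norm_smul, norm_smul]
    gcongr
    exact (hd i).trans (le_abs_self _)
  rw [linProc, L.map_tsum hs']
  simp

/-- By Fubini over `k + j = i`, evaluating the dual-valued process at `β` means forming the output
first and then filtering it with coefficients `r⁻¹ ^ k β_k`. At the weighted inverse response the
weights cancel, and the value is the stationary innovation. -/
theorem linProc_delayKernel (hr : 0 ≤ r) {ω : Ω} {n : ℤ}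
    (hs : Summable fun i : ℕ => ‖z (n - i) ω • absKernel a r i‖) (β : ℕ →ᵇ ℝ) :
    linProc (delayKernel a r) z n ω β =
      ∑' k : ℕ, r⁻¹ ^ k * β k * ∑' j : ℕ, a j * z (n - k - j) ω := by
  have h0 : ∀ k, 0 ≤ r⁻¹ ^ k := fun k => by positivity
  have h1 : linProc (delayKernel a r) z n ω β = ∑' i : ℕ, z (n - i) ω * delayKernel a r i β := by
    have := map_linProc (G := (ℕ →ᵇ ℝ) →L[ℝ] ℝ) (c := delayKernel a r)
      (ContinuousLinearMap.apply ℝ ℝ β) (norm_delayKernel_le (a := a) hr) hs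
    simpa only [ContinuousLinearMap.apply_apply] using this
  let f : ℕ × ℕ → ℝ := fun x => r⁻¹ ^ x.1 * β x.1 * (a x.2 * z (n - x.1 - x.2) ω)
  have hf : ∀ i : ℕ, ∀ x ∈ Finset.HasAntidiagonal.antidiagonal i, n - (x.1 : ℤ) - x.2 = n - (i : ℤ) := fun i x hx => by
    rw [Finset.HasAntidiagonal.mem_antidiagonal] at hx
    rw [← hx]; push_cast; ring
  have h2 : Summable fun i => ∑ x ∈ Finset.HasAntidiagonal.antidiagonal i, |f x| := by
    refine Summable.of_nonneg_of_le (fun i => Finset.sum_nonneg fun _ _ => abs_nonneg _)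
      (fun i => ?_) (hs.mul_left ‖β‖)
    rw [norm_smul, absKernel, Real.norm_of_nonneg (r := ∑ x ∈ _, _)
      (Finset.sum_nonneg fun x _ => mul_nonneg (h0 _) (abs_nonneg _)), Finset.mul_sum, Finset.mul_sum]
    refine Finset.sum_le_sum fun x hx => ?_
    simp only [f, hf i x hx, abs_mul, abs_of_nonneg (h0 _)]
    calc r⁻¹ ^ x.1 * |β x.1| * (|a x.2| * |z (n - i) ω|)
        ≤ r⁻¹ ^ x.1 * ‖β‖ * (|a x.2| * |z (n - i) ω|) := by
          have := h0 x.1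
          gcongr
          exact β.norm_coe_le_norm _
      _ = _ := by rw [Real.norm_eq_abs]; ring
  rw [h1]
  refine Eq.trans (tsum_congr fun i => ?_) ((tsum_antidiagonal h2).2.trans
    (tsum_congr fun k => by simp only [f, tsum_mul_left]))
  rw [delayKernel_apply, Finset.mul_sum]
  refine Finset.sum_congr rfl fun x hx => ?_
  simp only [f, hf i x hx]
  ring

/-- The functional giving the innovations of the filter started at time `0`. -/
def startedFunctional (r : ℝ) (y : ℤ → Ω → ℝ) (n : ℕ) (ω : Ω) : (ℕ →ᵇ ℝ) →L[ℝ] ℝ :=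
  ∑ k ∈ Finset.range n, (r⁻¹ ^ k * y ((n : ℤ) - k) ω) • BoundedContinuousFunction.evalCLM ℝ k

theorem startedFunctional_apply (y : ℤ → Ω → ℝ) (n : ℕ) (ω : Ω) (β : ℕ →ᵇ ℝ) :
    startedFunctional r y n ω β = ∑ k ∈ Finset.range n, r⁻¹ ^ k * y ((n : ℤ) - k) ω * β k := by
  simp [startedFunctional, sum_apply]

/-- Only lags of at least `n`, that is, outputs at times at most `0`, distinguish the two
functionals. Their weights contain the factor `r⁻¹ ^ n`, and what remains is bounded by one random
variable not depending on `n`. -/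
theorem norm_startedFunctional_sub_le (hr : 0 ≤ r) {y : ℤ → Ω → ℝ}
    {ω : Ω} (hy : ∀ n, y n ω = ∑' j : ℕ, a j * z (n - j) ω)
    (hs : ∀ n : ℤ, Summable fun i : ℕ => ‖z (n - i) ω • absKernel a r i‖) (n : ℕ) :
    ‖startedFunctional r y n ω - linProc (delayKernel a r) z n ω‖ ≤
      r⁻¹ ^ n * envProc (absKernel a r) z 0 0 ω := by
  have h0 : ∀ k, 0 ≤ r⁻¹ ^ k := fun k => by positivity
  let f : ℤ → ℕ × ℕ → ℝ := fun n x => r⁻¹ ^ x.1 * |a x.2 * z (n - x.1 - x.2) ω|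
  have hf : ∀ n x, |f n x| = f n x := fun n x => abs_of_nonneg (mul_nonneg (h0 _) (abs_nonneg _))
  have hfs : ∀ (n : ℤ) (i : ℕ), ∑ x ∈ Finset.HasAntidiagonal.antidiagonal i, f n x =
      ‖z (n - i) ω • absKernel a r i‖ := fun n i => by
    rw [norm_smul, absKernel, Real.norm_of_nonneg (r := ∑ x ∈ _, _)
      (Finset.sum_nonneg fun x _ => mul_nonneg (h0 _) (abs_nonneg _)), Finset.mul_sum]
    refine Finset.sum_congr rfl fun x hx => ?_
    rw [Finset.HasAntidiagonal.mem_antidiagonal] at hx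
    have : n - (x.1 : ℤ) - x.2 = n - (i : ℤ) := by rw [← hx]; push_cast; ring
    simp only [f, this, abs_mul, Real.norm_eq_abs]
    ring
  have hfsum : ∀ n, Summable fun i => ∑ x ∈ Finset.HasAntidiagonal.antidiagonal i, |f n x| := fun n => by
    simp only [hf, hfs]; exact hs n
  have hys : ∀ (n : ℤ) (k : ℕ), r⁻¹ ^ k * |y (n - k) ω| ≤ ∑' j, f n (k, j) := fun n k => by
    have h1 := (tsum_antidiagonal (hfsum n)).1.prod_factor k
    simp only [f] at h1 ⊢
    rcases (h0 k).eq_or_lt with h2 | h2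
    · simp [← h2]
    · rw [tsum_mul_left, hy]
      have h3 : Summable fun j : ℕ => ‖a j * z (n - k - j) ω‖ :=
        (summable_mul_left_iff h2.ne').1 h1
      exact mul_le_mul_of_nonneg_left (norm_tsum_le_tsum_norm h3) h2.le
  have hysum : ∀ n : ℤ, Summable fun k : ℕ => r⁻¹ ^ k * |y (n - k) ω| := fun n =>
    Summable.of_nonneg_of_le (fun k => mul_nonneg (h0 k) (abs_nonneg _)) (hys n)
      (tsum_antidiagonal (hfsum n)).1.prod
  have henv : ∑' k : ℕ, r⁻¹ ^ k * |y (0 - k) ω| ≤ envProc (absKernel a r) z 0 0 ω := by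
    have h1 := (tsum_antidiagonal (hfsum 0)).2
    simp only [hfs] at h1
    refine ((hysum 0).tsum_le_tsum (hys 0) (tsum_antidiagonal (hfsum 0)).1.prod).trans_eq ?_
    rw [← h1]
    simp [envProc]
  refine ContinuousLinearMap.opNorm_le_bound _
    (mul_nonneg (h0 n) (envProc_nonneg _ _ _)) fun β => ?_
  have hb : ∀ k : ℕ, ‖r⁻¹ ^ k * β k * y (n - k) ω‖ ≤ ‖β‖ * (r⁻¹ ^ k * |y (n - k) ω|) := fun k => by
    rw [norm_mul, norm_mul, Real.norm_of_nonneg (h0 k), Real.norm_eq_abs (y _ ω)]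
    calc _ ≤ r⁻¹ ^ k * ‖β‖ * |y (n - k) ω| := by
          have := h0 k
          gcongr
          exact β.norm_coe_le_norm _
      _ = _ := by ring
  have hsb : Summable fun k : ℕ => r⁻¹ ^ k * β k * y (n - k) ω :=
    Summable.of_norm_bounded ((hysum n).mul_left _) hb
  have e : (startedFunctional r y n ω - linProc (delayKernel a r) z n ω) β =
      -∑' k : ℕ, r⁻¹ ^ (k + n) * β (k + n) * y (n - (k + n : ℕ)) ω := by
    rw [sub_apply, linProc_delayKernel hr (hs n), startedFunctional_apply]
    simp only [← hy]
    rw [← hsb.sum_add_tsum_nat_add n, sub_add_eq_sub_sub]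
    simp only [mul_right_comm _ (y _ ω), sub_self, zero_sub]
  rw [e, norm_neg]
  have h4 : ∀ k : ℕ, ‖r⁻¹ ^ (k + n) * β (k + n) * y (n - (k + n : ℕ)) ω‖ ≤
      r⁻¹ ^ n * ‖β‖ * (r⁻¹ ^ k * |y (0 - k) ω|) := fun k => by
    refine (hb (k + n)).trans_eq ?_
    have : (n : ℤ) - (k + n : ℕ) = 0 - k := by push_cast; ring
    rw [this, pow_add]
    ring
  refine (tsum_of_norm_bounded ((hysum 0).mul_left _).hasSum h4).trans ?_
  rw [tsum_mul_left]
  calc r⁻¹ ^ n * ‖β‖ * ∑' k : ℕ, r⁻¹ ^ k * |y (0 - k) ω|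
      ≤ r⁻¹ ^ n * ‖β‖ * envProc (absKernel a r) z 0 0 ω := by
        have := h0 n
        gcongr
    _ = _ := by ring

end Filter

/-! ### The started filter as a sample, and orthogonality of the present noise to its past. -/

section Sample

variable {Ω : Type*} [MeasurableSpace Ω] {P : Measure Ω} {a : ℕ → ℝ} {r : ℝ} {z : ℤ → Ω → ℝ}

theorem IsNoise.isSample_startedFunctional (hz : IsNoise z P) (hr : 1 < r) (ha : ExpDecay a)
    {y : ℤ → Ω → ℝ} (hy : ∀ n ω, y n ω = ∑' j : ℕ, a j * z (n - j) ω) :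
    IsSample (delayKernel a r) z P (startedFunctional r y) := by
  refine ⟨hz, expDecay_delayKernel hr ha, fun n => ?_, r⁻¹, envProc (absKernel a r) z 0 0,
    by positivity, inv_lt_one_of_one_lt₀ hr, ?_, ?_⟩
  · have hym : ∀ m, AEStronglyMeasurable (y m) P := fun m => by
      have h := hz.aestronglyMeasurable_linProc ha m
      have e : y m = linProc a z m := by
        ext ω; rw [hy, linProc]; exact tsum_congr fun j => mul_comm _ _
      rwa [e]
    exact Finset.aestronglyMeasurable_fun_sum _ fun k _ => ((hym _).const_mul _).smul_const _
  · have := hz.mb_envProc (expDecay_absKernel hr ha)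
    exact ⟨fun _ => this.meas 0, fun q hq => (this.bound q hq).imp fun C hC _ => hC 0⟩
  · filter_upwards [hz.ae_summable (expDecay_absKernel hr ha)] with ω hω n
    exact norm_startedFunctional_sub_le (by linarith) (fun n => hy n ω) hω n

variable {G : Type*} [NormedAddCommGroup G] [NormedSpace ℝ G] [CompleteSpace G] {c : ℕ → G}

/-- The present value of the noise is uncorrelated with functionals of its past. -/
theorem IsNoise.integral_mul_linProc_eq_zero [IsProbabilityMeasure P] (hz : IsNoise z P)
    (hc : ExpDecay c) (L : G →L[ℝ] ℝ) (hL : L (c 0) = 0) {f : ℝ → ℂ} (hf : Continuous f) {K : ℝ}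
    (hfK : ∀ x, ‖f x‖ ≤ K * (1 + |x|)) :
    ∫ ω, f (z 0 ω) * (L (linProc c z 0 ω) : ℂ) ∂P = 0 := by
  have hK : 0 ≤ K := by simpa using (norm_nonneg _).trans (hfK 0)
  have hfm : ∀ n, AEStronglyMeasurable (fun ω => f (z n ω)) P := fun n =>
    hf.comp_aestronglyMeasurable (hz.meas n).aestronglyMeasurable
  have hzc : ∀ n, AEStronglyMeasurable (fun ω => (z n ω : ℂ)) P := fun n =>
    (Complex.continuous_ofReal.comp_aestronglyMeasurable (hz.meas n).aestronglyMeasurable)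
  let T : ℕ → Ω → ℂ := fun i ω => f (z 0 ω) * (z (0 - i) ω * L (c i) : ℝ)
  have hmb : MB P (fun (i : ℕ) ω => K * (1 + |z 0 ω|) * |z (0 - i) ω|) := by
    have h1 : MB P (fun (i : ℕ) ω => |z (0 - i) ω|) := by
      refine ⟨fun i => (hz.mb.meas (0 - i)).norm, fun q hq => ?_⟩
      obtain ⟨C, hC⟩ := hz.mb.bound q hq
      exact ⟨C, fun i => (eLpNorm_norm (z (0 - i))).le.trans (hC _)⟩
    have h2 : MB P (fun (_ : ℕ) ω => |z 0 ω|) := by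
      refine ⟨fun i => (hz.mb.meas 0).norm, fun q hq => ?_⟩
      obtain ⟨C, hC⟩ := hz.mb.bound q hq
      exact ⟨C, fun i => (eLpNorm_norm (z 0)).le.trans (hC _)⟩
    exact ((MB.const K).mul ((MB.const 1).add h2)).mul h1
  obtain ⟨C, hC⟩ := hmb.bound 1 le_rfl
  have hTle : ∀ i ω, ‖T i ω‖ ≤ K * (1 + |z 0 ω|) * |z (0 - i) ω| * |L (c i)| := fun i ω => by
    simp only [T, norm_mul, Complex.norm_real, Real.norm_eq_abs]
    rw [← mul_assoc]
    gcongr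
    exact hfK _
  have hTm : ∀ i, AEStronglyMeasurable (T i) P := fun i => (hfm 0).mul
    (Complex.continuous_ofReal.comp_aestronglyMeasurable
      ((hz.meas _).aestronglyMeasurable.mul_const _))
  have hTi : ∀ i, Integrable (T i) P := fun i =>
    ((hmb.integrable i).mul_const _).mono' (hTm i) (ae_of_all _ fun ω => hTle i ω)
  -- Lag `0` is removed by the assumption on `L`; at positive lags independence factors the integral
  -- and the past noise has mean zero.
  have hTint : ∀ i, ∫ ω, T i ω ∂P = 0 := fun i => by
    rcases Nat.eq_zero_or_pos i with rfl | hi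
    · simp [T, hL]
    · have hind : IndepFun (fun ω => f (z 0 ω)) (fun ω => (z (0 - i) ω : ℂ)) P :=
        (hz.indep.indepFun (show (0 : ℤ) ≠ 0 - i by omega)).comp hf.measurable
          Complex.measurable_ofReal
      have := hind.integral_fun_mul_eq_mul_integral (hfm 0) (hzc _)
      simp only [T, Complex.ofReal_mul, ← mul_assoc]
      rw [integral_mul_const, this]
      have hm := hz.mean (0 - i)
      have : ∫ ω, (z (0 - i) ω : ℂ) ∂P = ((∫ ω, z (0 - i) ω ∂P : ℝ) : ℂ) := integral_ofReal
      rw [this, hm]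
      simp
  have hsum : Summable fun i => ∫ ω, ‖T i ω‖ ∂P := by
    obtain ⟨C', κ, hC', hκ0, hκ1, h⟩ := hc
    refine Summable.of_nonneg_of_le (fun i => integral_nonneg fun _ => norm_nonneg _) (fun i => ?_)
      ((summable_geometric_of_lt_one hκ0.le hκ1).mul_left (C * (‖L‖ * C')))
    have h1 : ∫ ω, K * (1 + |z 0 ω|) * |z (0 - i) ω| ∂P ≤ C := by
      have h2 := hC i
      rw [ENNReal.coe_one, eLpNorm_one_eq_lintegral_enorm] at h2
      rw [integral_eq_lintegral_of_nonneg_ae (ae_of_all _ fun ω => by positivity) (hmb.meas i)]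
      refine ENNReal.toReal_le_coe_of_le_coe ((lintegral_mono fun ω => ?_).trans h2)
      rw [Real.enorm_eq_ofReal_abs]
      exact ENNReal.ofReal_le_ofReal (le_abs_self _)
    calc ∫ ω, ‖T i ω‖ ∂P ≤ ∫ ω, K * (1 + |z 0 ω|) * |z (0 - i) ω| * |L (c i)| ∂P :=
          integral_mono (hTi i).norm ((hmb.integrable i).mul_const _) (hTle i)
      _ = (∫ ω, K * (1 + |z 0 ω|) * |z (0 - i) ω| ∂P) * |L (c i)| := integral_mul_const _ _
      _ ≤ C * (‖L‖ * (C' * κ ^ i)) := by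
          gcongr
          exact (L.le_opNorm _).trans (by gcongr; exact h i)
      _ = _ := by ring
  have key := integral_tsum_of_summable_integral_norm hTi hsum
  simp only [hTint, tsum_zero] at key
  rw [key]
  refine integral_congr_ae ?_
  filter_upwards [hz.ae_summable hc] with ω hω
  have h1 := L.map_tsum (hω 0).of_norm
  simp only [T, tsum_mul_left, linProc]
  rw [h1, Complex.ofReal_tsum]
  simp

end Sample

/-! ### Stability of isolated zeros under perturbation -/

/-- A unique nondegenerate zero of `G` in a compact set persists, and is localised, for all
functions `H` that are uniformly close to `G` and whose linear part near the zero is close to that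
of `G`. -/
theorem exists_root_radius {E : Type*} [NormedAddCommGroup E] [NormedSpace ℝ E] [CompleteSpace E]
    {G : E → E} {D : Set E} (hD : IsCompact D) (hG : ContinuousOn G D) {xs : E}
    (hxs : xs ∈ interior D) (h0 : G xs = 0) (huniq : ∀ x ∈ D, G x = 0 → x = xs) {A : E ≃L[ℝ] E}
    (hA : HasFDerivAt G (A : E →L[ℝ] E) xs) :
    ∃ δ ρ₀ C : ℝ, 0 < δ ∧ 0 < ρ₀ ∧ 0 ≤ C ∧ Metric.closedBall xs ρ₀ ⊆ D ∧
      ∀ ρ, 0 < ρ → ρ ≤ ρ₀ → ∀ H : E → E,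
        (∀ x ∈ Metric.closedBall xs ρ, ∀ y ∈ Metric.closedBall xs ρ,
          ‖H x - H y - A (x - y)‖ ≤ δ * ‖x - y‖) →
        (∀ x ∈ D, ‖H x - G x‖ ≤ δ * ρ) →
        (∃! x, x ∈ D ∧ H x = 0) ∧ ∀ x ∈ D, H x = 0 → ‖x - xs‖ ≤ ρ ∧ ‖x - xs‖ ≤ C * ‖H xs‖ := by
  -- The summand `1` keeps `m` positive even on the trivial space.
  set m : ℝ≥0 := ‖(A.symm : E →L[ℝ] E)‖₊ + 1 with hm
  have hm0 : (0 : ℝ) < m := by rw [hm]; push_cast; positivity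
  set c : ℝ := (m : ℝ)⁻¹ with hc
  have hc0 : 0 < c := inv_pos.2 hm0
  have hcA : ∀ v, c * ‖v‖ ≤ ‖A v‖ := fun v => by
    rw [hc, inv_mul_le_iff₀ hm0]
    calc ‖v‖ = ‖(A.symm : E →L[ℝ] E) (A v)‖ := by simp
      _ ≤ ‖(A.symm : E →L[ℝ] E)‖ * ‖A v‖ := ContinuousLinearMap.le_opNorm _ _
      _ ≤ m * ‖A v‖ := by gcongr; rw [hm]; push_cast; linarith
  obtain ⟨ρ₀, hρ₀, hball, hlin⟩ : ∃ ρ₀ > 0, Metric.closedBall xs ρ₀ ⊆ D ∧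
      ∀ x ∈ Metric.closedBall xs ρ₀, c / 2 * ‖x - xs‖ ≤ ‖G x‖ := by
    have h1 := (hasFDerivAt_iff_isLittleO.1 hA).def (half_pos hc0)
    have h2 : D ∈ 𝓝 xs := mem_interior_iff_mem_nhds.1 hxs
    obtain ⟨ε, hε, h3⟩ := Metric.nhds_basis_closedBall.mem_iff.1 (inter_mem h1 h2)
    refine ⟨ε, hε, fun x hx => (h3 hx).2, fun x hx => ?_⟩
    have h4 := (h3 hx).1
    simp only [Set.mem_ofPred_eq, h0, sub_zero, ContinuousLinearEquiv.coe_coe] at h4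
    have h5 := hcA (x - xs)
    have h6 : ‖A (x - xs)‖ ≤ ‖G x‖ + ‖G x - A (x - xs)‖ := by
      have := norm_sub_le (G x) (G x - A (x - xs))
      simpa using this
    linarith
  obtain ⟨μ, hμ, hfar⟩ : ∃ μ > 0, ∀ x ∈ D, ρ₀ ≤ ‖x - xs‖ → μ ≤ ‖G x‖ := by
    let S : Set E := D ∩ {x | ρ₀ ≤ ‖x - xs‖}
    have hS : IsCompact S := hD.inter_right
      (isClosed_le continuous_const (continuous_id.sub continuous_const).norm)
    rcases S.eq_empty_or_nonempty with h | h
    · exact ⟨1, one_pos, fun x hx hx' => absurd (show x ∈ S from ⟨hx, hx'⟩) (by simp [h])⟩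
    · obtain ⟨x, hx, hmin⟩ := hS.exists_isMinOn h (hG.mono Set.inter_subset_left).norm
      refine ⟨‖G x‖, norm_pos_iff.2 fun h' => ?_, fun y hy hy' => hmin ⟨hy, hy'⟩⟩
      have h7 : ρ₀ ≤ ‖x - xs‖ := hx.2
      rw [huniq x hx.1 h', sub_self, norm_zero] at h7
      linarith
  -- The first bound keeps `H` expanding by `c / 2` on the ball and excludes zeros between radii `ρ`
  -- and `ρ₀`; the second excludes zeros beyond `ρ₀`, where `G` is at least `μ`.
  set δ : ℝ := min (c / 4) (μ / (2 * ρ₀)) with hδ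
  have hδ0 : 0 < δ := by positivity
  have hδc : δ ≤ c / 4 := min_le_left _ _
  have hδμ : δ * ρ₀ ≤ μ / 2 := by
    calc δ * ρ₀ ≤ μ / (2 * ρ₀) * ρ₀ := by gcongr; exact min_le_right _ _
      _ = μ / 2 := by field_simp
  refine ⟨δ, ρ₀, 2 / c, hδ0, hρ₀, by positivity, hball, fun ρ hρ hρρ₀ H hH hHG => ?_⟩
  have hsub : Metric.closedBall xs ρ ⊆ D := (Metric.closedBall_subset_closedBall hρρ₀).trans hball
  have hxsb : xs ∈ Metric.closedBall xs ρ := Metric.mem_closedBall_self hρ.le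
  have hloc : ∀ x ∈ D, H x = 0 → x ∈ Metric.closedBall xs ρ := fun x hx hx0 => by
    have h1 := hHG x hx
    rw [hx0, zero_sub, norm_neg] at h1
    rw [mem_closedBall_iff_norm]
    by_contra! h2
    rcases le_or_gt ρ₀ ‖x - xs‖ with h3 | h3
    · have h4 := hfar x hx h3
      have h5 : δ * ρ ≤ δ * ρ₀ := by gcongr
      linarith
    · have h4 := hlin x (mem_closedBall_iff_norm.2 h3.le)
      have h5 : c / 2 * ρ < c / 2 * ‖x - xs‖ := by gcongr
      have h6 : δ * ρ ≤ c / 4 * ρ := by gcongr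
      have h7 : 0 < c * ρ := by positivity
      linarith
  have hexp : ∀ x ∈ Metric.closedBall xs ρ, ∀ y ∈ Metric.closedBall xs ρ,
      c / 2 * ‖x - y‖ ≤ ‖H x - H y‖ := fun x hx y hy => by
    have h1 := hH x hx y hy
    have h2 := hcA (x - y)
    have h3 : ‖A (x - y)‖ ≤ ‖H x - H y‖ + ‖H x - H y - A (x - y)‖ := by
      have := norm_sub_le (H x - H y) (H x - H y - A (x - y))
      simpa using this
    have h4 : δ * ‖x - y‖ ≤ c / 4 * ‖x - y‖ := by gcongr
    have h5 : 0 ≤ c * ‖x - y‖ := by positivity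
    linarith
  -- Quantitative surjectivity of approximately linear maps: the image of the ball covers radius `(c
  -- - δ) ρ` around `H xs`, and `‖H xs‖ ≤ δ ρ`.
  have hex : ∃ x ∈ Metric.closedBall xs ρ, H x = 0 := by
    have happ : ApproximatesLinearOn H (A : E →L[ℝ] E) (Metric.closedBall xs ρ) δ.toNNReal :=
      fun x hx y hy => by
        rw [Real.coe_toNNReal _ hδ0.le]
        exact hH x hx y hy
    let s : (A : E →L[ℝ] E).NonlinearRightInverse :=
      { toFun := A.symm
        nnnorm := m
        bound' := fun y => by
          refine ((A.symm : E →L[ℝ] E).le_opNorm y).trans ?_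
          gcongr
          rw [hm]; push_cast; linarith
        right_inv' := fun y => by simp }
    have h1 := happ.surjOn_closedBall_of_nonlinearRightInverse s hρ.le le_rfl
    obtain ⟨x, hx, hx0⟩ := h1 (show (0 : E) ∈ _ by
      rw [mem_closedBall_iff_norm, zero_sub, norm_neg, Real.coe_toNNReal _ hδ0.le]
      have h2 := hHG xs (hsub hxsb)
      rw [h0, sub_zero] at h2
      have h3 : δ * ρ ≤ (c - δ) * ρ := by gcongr; linarith
      exact h2.trans h3)
    exact ⟨x, hx, hx0⟩
  obtain ⟨x, hx, hx0⟩ := hex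
  refine ⟨⟨x, ⟨hsub hx, hx0⟩, fun y hy => ?_⟩, fun y hy hy0 =>
    ⟨mem_closedBall_iff_norm.1 (hloc y hy hy0), ?_⟩⟩
  · have h1 := hexp y (hloc y hy.1 hy.2) x hx
    rw [hy.2, hx0, sub_self, norm_zero] at h1
    have h2 : ‖y - x‖ ≤ 0 := by
      by_contra! h3
      have : 0 < c / 2 * ‖y - x‖ := by positivity
      linarith
    exact sub_eq_zero.1 (norm_le_zero_iff.1 h2)
  · have h1 := hexp y (hloc y hy hy0) xs hxsb
    rw [hy0, zero_sub, norm_neg] at h1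
    calc ‖y - xs‖ = 2 / c * (c / 2 * ‖y - xs‖) := by field_simp
      _ ≤ _ := by gcongr

/-- The version for perturbations close together with their derivatives: continuity of `G'` at the
zero gives a ball on which `H'` is close to its inverse-admitting limit, and the mean value
inequality turns this into approximate linearity. -/
theorem exists_root_perturbation {E : Type*} [NormedAddCommGroup E] [NormedSpace ℝ E]
    [CompleteSpace E] {G : E → E} {G' : E → E →L[ℝ] E} {D : Set E} (hD : IsCompact D)
    (hG : ContinuousOn G D) {xs : E} (hxs : xs ∈ interior D) (h0 : G xs = 0)
    (huniq : ∀ x ∈ D, G x = 0 → x = xs) (hG' : ∀ x ∈ interior D, HasFDerivAt G (G' x) x)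
    (hG'c : ContinuousAt G' xs) (hA : (G' xs).IsInvertible) :
    ∃ δ ρ C : ℝ, 0 < δ ∧ 0 < ρ ∧ 0 ≤ C ∧ Metric.closedBall xs ρ ⊆ interior D ∧
      ∀ (H : E → E) (H' : E → E →L[ℝ] E), (∀ x ∈ interior D, HasFDerivAt H (H' x) x) →
        (∀ x ∈ D, ‖H x - G x‖ ≤ δ) → (∀ x ∈ D, ‖H' x - G' x‖ ≤ δ) →
        (∃! x, x ∈ D ∧ H x = 0) ∧ ∀ x ∈ D, H x = 0 → ‖x - xs‖ ≤ ρ ∧ ‖x - xs‖ ≤ C * ‖H xs‖ := by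
  obtain ⟨A, hA⟩ := hA
  obtain ⟨δ, ρ₀, C, hδ, hρ₀, hC, hball, key⟩ := exists_root_radius hD hG hxs h0 huniq (A := A)
    (hA ▸ hG' xs hxs)
  have h1 : ∀ᶠ x in 𝓝 xs, ‖G' x - G' xs‖ < δ / 2 := by
    have := Metric.tendsto_nhds.1 hG'c _ (half_pos hδ)
    simpa [dist_eq_norm] using this
  obtain ⟨ε, hε, h2⟩ := Metric.nhds_basis_closedBall.mem_iff.1
    (inter_mem h1 (isOpen_interior.mem_nhds hxs))
  set ρ := min ε ρ₀ with hρ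
  have hρ0 : 0 < ρ := lt_min hε hρ₀
  have h3 : Metric.closedBall xs ρ ⊆ Metric.closedBall xs ε :=
    Metric.closedBall_subset_closedBall (min_le_left _ _)
  refine ⟨min (δ / 2) (δ * ρ), ρ, C, by positivity, hρ0, hC, fun x hx => (h2 (h3 hx)).2,
    fun H H' hH hHG hHG' => key ρ hρ0 (min_le_right _ _) H (fun x hx y hy => ?_)
      fun x hx => (hHG x hx).trans (min_le_right _ _)⟩
  have h4 : ∀ x ∈ Metric.closedBall xs ρ, HasFDerivWithinAt (fun x => H x - A x)
      (H' x - (A : E →L[ℝ] E)) (Metric.closedBall xs ρ) x := fun x hx =>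
    ((hH x (h2 (h3 hx)).2).sub A.hasFDerivAt).hasFDerivWithinAt
  have h5 : ∀ x ∈ Metric.closedBall xs ρ, ‖H' x - (A : E →L[ℝ] E)‖ ≤ δ := fun x hx => by
    have h6 := (h2 (h3 hx)).1
    have h7 := (hHG' x (interior_subset (h2 (h3 hx)).2)).trans (min_le_left _ _)
    simp only [Set.mem_ofPred_eq] at h6
    rw [hA]
    calc ‖H' x - G' xs‖ = ‖(H' x - G' x) + (G' x - G' xs)‖ := by rw [sub_add_sub_cancel]
      _ ≤ _ := (norm_add_le _ _).trans (by linarith)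
  have h8 := (convex_closedBall xs ρ).norm_image_sub_le_of_norm_hasFDerivWithin_le h4 h5 hy hx
  refine le_trans (le_of_eq ?_) h8
  congr 1
  simp only [map_sub]
  abel

/-! ### Quadratic costs and their gradients -/

section Quadratic

variable {ι : Type*} [Fintype ι] [DecidableEq ι]

/-- The symmetric real bilinear form of the weighted square. -/
def weightedBil (K : Matrix ι ι ℂ) : (ι → ℂ) →L[ℝ] (ι → ℂ) →L[ℝ] ℝ :=
  (LinearMap.mk₂ ℝ (fun v w => (1 / 2) * ((star v ⬝ᵥ (K⁻¹ *ᵥ w)).re + (star w ⬝ᵥ (K⁻¹ *ᵥ v)).re))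
    (fun v v' w => by
      simp only [star_add, add_dotProduct, Matrix.mulVec_add, dotProduct_add, Complex.add_re]; ring)
    (fun c v w => by
      simp only [star_smul, star_trivial, smul_dotProduct, Matrix.mulVec_smul, dotProduct_smul,
        Complex.smul_re, smul_eq_mul]; ring)
    (fun v w w' => by
      simp only [star_add, add_dotProduct, Matrix.mulVec_add, dotProduct_add, Complex.add_re]; ring)
    (fun c v w => by
      simp only [star_smul, star_trivial, smul_dotProduct, Matrix.mulVec_smul, dotProduct_smul,
        Complex.smul_re, smul_eq_mul]; ring)).toContinuousBilinearMap

theorem weightedBil_apply (K : Matrix ι ι ℂ) (v w : ι → ℂ) : weightedBil K v w =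
    (1 / 2) * ((star v ⬝ᵥ (K⁻¹ *ᵥ w)).re + (star w ⬝ᵥ (K⁻¹ *ᵥ v)).re) := rfl

theorem weightedBil_self (K : Matrix ι ι ℂ) (v : ι → ℂ) : weightedBil K v v = weightedSq K v := by
  rw [weightedBil_apply, weightedSq]; ring

theorem weightedBil_comm (K : Matrix ι ι ℂ) (v w : ι → ℂ) :
    weightedBil K v w = weightedBil K w v := by
  rw [weightedBil_apply, weightedBil_apply]; ring

variable {p : ℕ}

/-- The Riesz isomorphism of `ℝᵖ`, as a real linear map. -/
def riesz (p : ℕ) : (Vec p →L[ℝ] ℝ) →L[ℝ] Vec p :=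
  LinearMap.toContinuousLinearMap
    { toFun := fun f => (InnerProductSpace.toDual ℝ (Vec p)).symm f
      map_add' := fun f g => map_add _ f g
      map_smul' := fun c f => by simp }

theorem inner_riesz (f : Vec p →L[ℝ] ℝ) (v : Vec p) : inner ℝ (riesz p f) v = f v := by
  simp [riesz]

theorem riesz_apply (f : Vec p →L[ℝ] ℝ) (j : Fin p) :
    riesz p f j = f (EuclideanSpace.single j 1) := by
  rw [← inner_riesz, EuclideanSpace.inner_single_right]
  simp

theorem gradient_eq_riesz {f : Vec p → ℝ} {f' : Vec p →L[ℝ] ℝ} {x : Vec p}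
    (h : HasFDerivAt f f' x) : gradient f x = riesz p f' := h.hasGradientAt.gradient

variable {V : Type*} [NormedAddCommGroup V] [NormedSpace ℝ V]

/-- The gradient of the quadratic form of `B` at a vector `v` with derivative `T`. -/
def gradBil (p : ℕ) (B : V →L[ℝ] V →L[ℝ] ℝ) : V →L[ℝ] (Vec p →L[ℝ] V) →L[ℝ] Vec p :=
  ContinuousLinearMap.compL ℝ (Vec p →L[ℝ] V) (Vec p →L[ℝ] ℝ) (Vec p) (riesz p) ∘L
    ContinuousLinearMap.compL ℝ (Vec p) V ℝ ∘L ((2 : ℝ) • B)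

theorem gradBil_apply (B : V →L[ℝ] V →L[ℝ] ℝ) (v : V) (T : Vec p →L[ℝ] V) :
    gradBil p B v T = riesz p (((2 : ℝ) • B v) ∘L T) := rfl

theorem gradient_quadratic {B : V →L[ℝ] V →L[ℝ] ℝ} (hB : ∀ v w, B v w = B w v) {f : Vec p → V}
    {f' : Vec p →L[ℝ] V} {x : Vec p} (h : HasFDerivAt f f' x) :
    gradient (fun τ => B (f τ) (f τ)) x = gradBil p B (f x) f' := by
  have h1 := B.hasFDerivAt_of_bilinear h h
  rw [gradient_eq_riesz h1, gradBil_apply]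
  congr 1
  ext v
  simp only [ContinuousLinearMap.precompR_apply, ContinuousLinearMap.precompL_apply, add_apply,
    ContinuousLinearMap.comp_apply, smul_apply, smul_eq_mul]
  rw [hB (f' v), ContinuousLinearMap.compL_apply, ContinuousLinearMap.comp_apply]
  ring

/-- The derivative of `gradBil (h θ) (h' θ)`, `h'` being the derivative of `h`. -/
def gradBilDeriv (p : ℕ) (B : V →L[ℝ] V →L[ℝ] ℝ) (v : V) (T : Vec p →L[ℝ] V)
    (U : Vec p →L[ℝ] Vec p →L[ℝ] V) : Vec p →L[ℝ] Vec p :=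
  (gradBil p B).precompR (Vec p) v U + (gradBil p B).precompL (Vec p) T T

theorem hasFDerivAt_gradBil (B : V →L[ℝ] V →L[ℝ] ℝ) {f : Vec p → V} {f' : Vec p → Vec p →L[ℝ] V}
    {f'' : Vec p →L[ℝ] Vec p →L[ℝ] V} {x : Vec p} (h : HasFDerivAt f (f' x) x)
    (h' : HasFDerivAt f' f'' x) : HasFDerivAt (fun τ => gradBil p B (f τ) (f' τ))
      (gradBilDeriv p B (f x) (f' x) f'') x :=
  (gradBil p B).hasFDerivAt_of_bilinear h h'

end Quadratic

/-! ### Finite families of functionals of polynomial growth. -/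

section Pi

variable {E G F ι : Type*} [NormedAddCommGroup E] [NormedAddCommGroup G] [NormedAddCommGroup F]
  [NormedSpace ℝ F] [Fintype ι] {D : Set E}

theorem PL.sum (s : Finset ι) {f : ι → E → G → F} (hf : ∀ i ∈ s, PL D (f i)) :
    PL D (fun θ x => ∑ i ∈ s, f i θ x) := by
  classical
  induction s using Finset.induction_on with
  | empty => simpa using PL.const (0 : F)
  | insert i s hi ih =>
    simp only [Finset.sum_insert hi]
    exact (hf i (Finset.mem_insert_self i s)).add (ih fun j hj => hf j (Finset.mem_insert_of_mem hj))

theorem PL.pi {f : ι → E → G → F} (hf : ∀ i, PL D (f i)) : PL D (fun θ x i => f i θ x) := by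
  classical
  have h := PL.sum Finset.univ fun i _ =>
    (hf i).clm (ContinuousLinearMap.single ℝ (fun _ : ι => F) i)
  convert h using 3 with θ x
  ext j
  simp [Finset.sum_apply, Pi.single_apply]

variable [NormedSpace ℝ E]

theorem SPL.pi {f : ι → E → G → F} {f' : ι → E → G → E →L[ℝ] F} (hf : ∀ i, SPL D (f i) (f' i)) :
    SPL D (fun θ x i => f i θ x) (fun θ x => ContinuousLinearMap.pi fun i => f' i θ x) := by
  classical
  refine ⟨PL.pi fun i => (hf i).pl, ?_, fun θ hθ x => hasFDerivAt_pi.2 fun i => (hf i).deriv θ hθ x⟩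
  have h := PL.sum Finset.univ fun i _ => (hf i).pl'.clm
    (ContinuousLinearMap.compL ℝ E F (ι → F) (ContinuousLinearMap.single ℝ (fun _ : ι => F) i))
  convert h using 3 with θ x
  ext v j
  simp [Finset.sum_apply, Pi.single_apply]

theorem SPL.add {f g : E → G → F} {f' g' : E → G → E →L[ℝ] F} (hf : SPL D f f') (hg : SPL D g g') :
    SPL D (fun θ x => f θ x + g θ x) (fun θ x => f' θ x + g' θ x) :=
  ⟨hf.pl.add hg.pl, hf.pl'.add hg.pl', fun θ hθ x => (hf.deriv θ hθ x).add (hg.deriv θ hθ x)⟩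

end Pi

/-! ### The innovations and their derivatives -/

section InnovationFunctionals

variable {p d : ℕ} (S : SystemFamily p d) (r : ℝ)

/-- The innovation with parameter `θ` of a sample functional `x`. -/
def innovFun (θ : Vec p) (x : (ℕ →ᵇ ℝ) →L[ℝ] ℝ) : ℝ := x (S.weighted r θ)

/-- The derivative of the innovation. -/
def innovDeriv (θ : Vec p) (x : (ℕ →ᵇ ℝ) →L[ℝ] ℝ) : Vec p →L[ℝ] ℝ :=
  x ∘L fderiv ℝ (S.weighted r) θ

/-- The second derivative of the innovation. -/
def innovDeriv₂ (θ : Vec p) (x : (ℕ →ᵇ ℝ) →L[ℝ] ℝ) : Vec p →L[ℝ] Vec p →L[ℝ] ℝ :=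
  ContinuousLinearMap.compL ℝ (Vec p) (ℕ →ᵇ ℝ) ℝ x ∘L fderiv ℝ (fderiv ℝ (S.weighted r)) θ

variable {S r} {D : Set (Vec p)}

theorem spl_innovFun (hD : IsCompact D) (hS : ∀ θ ∈ D, ContDiffAt ℝ 3 (S.weighted r) θ) :
    SPL D (innovFun S r) (innovDeriv S r) := by
  have h := (SPL.id (D := D)).bilin (SPL.of_contDiffAt (G := (ℕ →ᵇ ℝ) →L[ℝ] ℝ) hD
    fun θ hθ => (hS θ hθ).of_le (by norm_num)) (ContinuousLinearMap.id ℝ ((ℕ →ᵇ ℝ) →L[ℝ] ℝ))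
  refine ⟨h.pl, ?_, fun θ hθ x => ?_⟩
  · convert h.pl' using 3 with θ x
    ext v
    simp [innovDeriv]
  · refine (h.deriv θ hθ x).congr_fderiv ?_
    ext v
    simp [innovDeriv]

/-- All three derivatives are used here: the second derivative of the innovation must itself be
Lipschitz in `θ`. -/
theorem spl_innovDeriv (hD : IsCompact D) (hS : ∀ θ ∈ D, ContDiffAt ℝ 3 (S.weighted r) θ) :
    SPL D (innovDeriv S r) (innovDeriv₂ S r) := by
  have h := (SPL.id (D := D)).bilin (SPL.of_contDiffAt (G := (ℕ →ᵇ ℝ) →L[ℝ] ℝ)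
    (b := fderiv ℝ (S.weighted r)) hD fun θ hθ => (hS θ hθ).fderiv_right (by norm_num))
      (ContinuousLinearMap.compL ℝ (Vec p) (ℕ →ᵇ ℝ) ℝ)
  refine ⟨h.pl, ?_, fun θ hθ x => ?_⟩
  · convert h.pl' using 3 with θ x
    ext v w
    simp [innovDeriv₂]
  · refine (h.deriv θ hθ x).congr_fderiv ?_
    ext v w
    simp [innovDeriv₂]

end InnovationFunctionals

/-- The data of the estimation problem: the noise `z`, the output `y` of the system with parameter
`θs`, and a compact neighbourhood `D` of the parameter set on which the inverse filter, weighted by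
the powers of `r`, is smooth. -/
structure IsSetup {Ω : Type*} [MeasurableSpace Ω] {p d : ℕ} (S : SystemFamily p d) (θs : Vec p)
    (z y : ℤ → Ω → ℝ) (P : Measure Ω) (r : ℝ) (D : Set (Vec p)) : Prop where
  noise : IsNoise z P
  one_lt : 1 < r
  decay : ExpDecay (S.response θs)
  out : y = output S θs z
  compact : IsCompact D
  smooth : ∀ θ ∈ D, ContDiffAt ℝ 3 (S.weighted r) θ
  weights : ∀ θ ∈ D, ∀ k, S.weighted r θ k = r ^ k * S.invResponse θ k
  mem : θs ∈ interior D

/-! ### The innovations at the true parameter and their orthogonality relations. -/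

section Setup

variable {Ω : Type*} [MeasurableSpace Ω] {P : Measure Ω} {p d : ℕ} {S : SystemFamily p d}
  {θs : Vec p} {z y : ℤ → Ω → ℝ} {r : ℝ} {D : Set (Vec p)}

namespace IsSetup

/-- The stationary functional at time `0`. -/
def stat (_ : IsSetup S θs z y P r D) (ω : Ω) : (ℕ →ᵇ ℝ) →L[ℝ] ℝ :=
  linProc (delayKernel (S.response θs) r) z 0 ω

theorem isSample (h : IsSetup S θs z y P r D) :
    IsSample (delayKernel (S.response θs) r) z P (startedFunctional r y) :=
  h.noise.isSample_startedFunctional h.one_lt h.decay fun n ω => by rw [h.out, output]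

theorem decay' (h : IsSetup S θs z y P r D) : ExpDecay (delayKernel (S.response θs) r) :=
  expDecay_delayKernel h.one_lt h.decay

theorem cancel (h : IsSetup S θs z y P r D) {θ : Vec p} (hθ : θ ∈ D) (k : ℕ) :
    r⁻¹ ^ k * S.weighted r θ k = S.invResponse θ k := by
  have : r ≠ 0 := (zero_lt_one.trans h.one_lt).ne'
  rw [h.weights θ hθ, ← mul_assoc, ← mul_pow, inv_mul_cancel₀ this, one_pow, one_mul]

theorem innov_eq (h : IsSetup S θs z y P r D) {θ : Vec p} (hθ : θ ∈ D) (n : ℕ) (ω : Ω) :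
    innov S y n θ ω = innovFun S r θ (startedFunctional r y n ω) := by
  rw [innovFun, startedFunctional_apply, innov]
  refine Finset.sum_congr rfl fun k _ => ?_
  rw [mul_right_comm, h.cancel hθ]

theorem innovGrad_eq (h : IsSetup S θs z y P r D) {θ : Vec p} (hθ : θ ∈ interior D) (n : ℕ)
    (ω : Ω) : innovGrad S y n θ ω = riesz p (innovDeriv S r θ (startedFunctional r y n ω)) := by
  refine gradient_eq_riesz (((spl_innovFun h.compact h.smooth).deriv θ (interior_subset hθ)
    _).congr_of_eventuallyEq ?_)
  filter_upwards [isOpen_interior.mem_nhds hθ] with τ hτ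
  exact h.innov_eq (interior_subset hτ) n ω

theorem ae_statInnov_eq (h : IsSetup S θs z y P r D) :
    ∀ᵐ ω ∂P, ∀ θ ∈ D, statInnov S y 0 θ ω = innovFun S r θ (h.stat ω) := by
  filter_upwards [h.noise.ae_summable (expDecay_absKernel h.one_lt h.decay)] with ω hω θ hθ
  rw [innovFun, stat, linProc_delayKernel (zero_lt_one.trans h.one_lt).le (hω 0), statInnov]
  refine tsum_congr fun k => ?_
  rw [h.cancel hθ, h.out, output]

theorem ae_statInnovGrad_eq (h : IsSetup S θs z y P r D) : ∀ᵐ ω ∂P, ∀ θ ∈ interior D,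
    statInnovGrad S y 0 θ ω = riesz p (innovDeriv S r θ (h.stat ω)) := by
  filter_upwards [h.ae_statInnov_eq] with ω hω θ hθ
  refine gradient_eq_riesz (((spl_innovFun h.compact h.smooth).deriv θ (interior_subset hθ)
    _).congr_of_eventuallyEq ?_)
  filter_upwards [isOpen_interior.mem_nhds hθ] with τ hτ
  exact hω τ (interior_subset hτ)

/-- The system and its inverse cancel at the true parameter, so the stationary innovation there is
the noise itself. -/
theorem delayKernel_true (h : IsSetup S θs z y P r D) (i : ℕ) :
    delayKernel (S.response θs) r i (S.weighted r θs) = if i = 0 then 1 else 0 := by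
  rw [delayKernel_apply, ← S.sum_response_mul_invResponse θs i,
    ← Finset.Nat.sum_antidiagonal_eq_sum_range_succ
      (fun k j => S.response θs j * S.invResponse θs k)]
  refine Finset.sum_congr rfl fun x _ => ?_
  rw [mul_right_comm, h.cancel (interior_subset h.mem), mul_comm]

theorem ae_innovFun_true (h : IsSetup S θs z y P r D) :
    ∀ᵐ ω ∂P, innovFun S r θs (h.stat ω) = z 0 ω := by
  filter_upwards [h.noise.ae_summable (expDecay_absKernel h.one_lt h.decay)] with ω hω
  have h1 := map_linProc (G := (ℕ →ᵇ ℝ) →L[ℝ] ℝ) (c := delayKernel (S.response θs) r)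
    (ContinuousLinearMap.apply ℝ ℝ (S.weighted r θs))
    (norm_delayKernel_le (a := S.response θs) (zero_lt_one.trans h.one_lt).le) (hω 0)
  simp only [ContinuousLinearMap.apply_apply, h.delayKernel_true] at h1
  rw [innovFun, stat, h1, tsum_eq_single 0 fun i hi => by simp [hi]]
  simp

theorem eventually_weighted_zero (h : IsSetup S θs z y P r D) {θ : Vec p} (hθ : θ ∈ interior D) :
    ∀ᶠ τ in 𝓝 θ, BoundedContinuousFunction.evalCLM ℝ 0 (S.weighted r τ) = (1 : ℝ) := by
  filter_upwards [isOpen_interior.mem_nhds hθ] with τ hτ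
  have := h.weights τ (interior_subset hτ) 0
  simpa [SystemFamily.invResponse] using this

/-- The leading coefficient of the inverse filter is `1` for every parameter. Thus derivatives of
the innovation contain no present noise. -/
theorem fderiv_weighted_zero (h : IsSetup S θs z y P r D) {θ : Vec p} (hθ : θ ∈ interior D)
    (v : Vec p) : fderiv ℝ (S.weighted r) θ v 0 = 0 := by
  have h1 := (BoundedContinuousFunction.evalCLM ℝ (0 : ℕ) (β := ℝ)).hasFDerivAt.comp θ
    ((h.smooth θ (interior_subset hθ)).differentiableAt (by norm_num)).hasFDerivAt
  have h2 : HasFDerivAt (fun τ => BoundedContinuousFunction.evalCLM ℝ 0 (S.weighted r τ))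
      (0 : Vec p →L[ℝ] ℝ) θ :=
    (hasFDerivAt_const (1 : ℝ) θ).congr_of_eventuallyEq (h.eventually_weighted_zero hθ)
  simpa using congrArg (fun T => T v) (h1.unique h2)

theorem fderiv_fderiv_weighted_zero (h : IsSetup S θs z y P r D) {θ : Vec p} (hθ : θ ∈ interior D)
    (v w : Vec p) : fderiv ℝ (fderiv ℝ (S.weighted r)) θ v w 0 = 0 := by
  have h1 := ((BoundedContinuousFunction.evalCLM ℝ (0 : ℕ) (β := ℝ)) ∘L
    (ContinuousLinearMap.apply ℝ (ℕ →ᵇ ℝ) w)).hasFDerivAt.comp θ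
    (((h.smooth θ (interior_subset hθ)).fderiv_right (m := 2) (by norm_num)).differentiableAt
      (by norm_num)).hasFDerivAt
  have h2 : HasFDerivAt (((BoundedContinuousFunction.evalCLM ℝ (0 : ℕ) (β := ℝ)) ∘L
      (ContinuousLinearMap.apply ℝ (ℕ →ᵇ ℝ) w)) ∘ (fderiv ℝ (S.weighted r)))
      (0 : Vec p →L[ℝ] ℝ) θ := by
    refine (hasFDerivAt_const (0 : ℝ) θ).congr_of_eventuallyEq ?_
    filter_upwards [isOpen_interior.mem_nhds hθ] with τ hτ
    simpa using h.fderiv_weighted_zero hτ w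
  simpa using congrArg (fun T => T v) (h1.unique h2)

variable [IsProbabilityMeasure P]

/-- A sequence with vanishing entry at lag `0` pairs with strictly earlier noise only. -/
theorem integral_mul_eq_zero (h : IsSetup S θs z y P r D) {b : ℕ →ᵇ ℝ} (hb : b 0 = 0) {f : ℝ → ℂ}
    (hf : Continuous f) {K : ℝ} (hfK : ∀ x, ‖f x‖ ≤ K * (1 + |x|)) :
    ∫ ω, f (z 0 ω) * (h.stat ω b : ℂ) ∂P = 0 :=
  h.noise.integral_mul_linProc_eq_zero h.decay' (ContinuousLinearMap.apply ℝ ℝ b)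
    (by simp [delayKernel_apply, hb]) hf hfK

theorem integral_mul_innovDeriv (h : IsSetup S θs z y P r D) {f : ℝ → ℂ} (hf : Continuous f) {K : ℝ}
    (hfK : ∀ x, ‖f x‖ ≤ K * (1 + |x|)) (v : Vec p) :
    ∫ ω, f (innovFun S r θs (h.stat ω)) * (innovDeriv S r θs (h.stat ω) v : ℂ) ∂P = 0 := by
  rw [← h.integral_mul_eq_zero (h.fderiv_weighted_zero h.mem v) hf hfK]
  refine integral_congr_ae ?_
  filter_upwards [h.ae_innovFun_true] with ω hω
  rw [hω]; rfl

theorem integral_mul_innovDeriv₂ (h : IsSetup S θs z y P r D) {f : ℝ → ℂ} (hf : Continuous f)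
    {K : ℝ} (hfK : ∀ x, ‖f x‖ ≤ K * (1 + |x|)) (v w : Vec p) :
    ∫ ω, f (innovFun S r θs (h.stat ω)) * (innovDeriv₂ S r θs (h.stat ω) v w : ℂ) ∂P = 0 := by
  rw [← h.integral_mul_eq_zero (h.fderiv_fderiv_weighted_zero h.mem v w) hf hfK]
  refine integral_congr_ae ?_
  filter_upwards [h.ae_innovFun_true] with ω hω
  rw [hω]; rfl

end IsSetup

end Setup

theorem isInvertible_of_injective {p : ℕ} {A : Vec p →L[ℝ] Vec p} (h : ∀ v, A v = 0 → v = 0) :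
    A.IsInvertible := by
  have h1 : Function.Injective (A : Vec p →ₗ[ℝ] Vec p) :=
    (injective_iff_map_eq_zero (A : Vec p →ₗ[ℝ] Vec p)).2 h
  refine ⟨(LinearEquiv.ofInjectiveEndo _ h1).toContinuousLinearEquiv, ?_⟩
  ext v
  simp

theorem PL.continuousOn_statMean {Ω : Type*} [MeasurableSpace Ω] {P : Measure Ω}
    [IsProbabilityMeasure P] {G E F : Type*} [NormedAddCommGroup G] [NormedSpace ℝ G]
    [CompleteSpace G] [NormedAddCommGroup E] [NormedAddCommGroup F] [NormedSpace ℝ F]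
    {c : ℕ → G} {z : ℤ → Ω → ℝ} {D : Set E} {f : E → G → F} (hf : PL D f) (hz : IsNoise z P)
    (hc : ExpDecay c) : ContinuousOn (statMean c z P f) D := by
  obtain ⟨K, hK, -, h⟩ := hf.exists_statMean_bound hz hc
  refine LipschitzOnWith.continuousOn (K := K.toNNReal)
    (LipschitzOnWith.of_dist_le_mul fun x hx y hy => ?_)
  rw [dist_eq_norm, dist_eq_norm, Real.coe_toNNReal _ hK]
  exact h x hx y hy

/-! ### The prediction error stage -/

section PredictionError

variable {p d : ℕ} (S : SystemFamily p d) (r : ℝ)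

/-- Half the squared innovation. -/
def peFun (θ : Vec p) (x : (ℕ →ᵇ ℝ) →L[ℝ] ℝ) : ℝ := (1 / 2) * innovFun S r θ x ^ 2

/-- The derivative of half the squared innovation. -/
def peDeriv (θ : Vec p) (x : (ℕ →ᵇ ℝ) →L[ℝ] ℝ) : Vec p →L[ℝ] ℝ :=
  innovFun S r θ x • innovDeriv S r θ x

/-- The second derivative of half the squared innovation. -/
def peDeriv₂ (θ : Vec p) (x : (ℕ →ᵇ ℝ) →L[ℝ] ℝ) : Vec p →L[ℝ] Vec p →L[ℝ] ℝ :=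
  innovFun S r θ x • innovDeriv₂ S r θ x + (innovDeriv S r θ x).smulRight (innovDeriv S r θ x)

variable {S r} {D : Set (Vec p)}

theorem spl_peDeriv (hD : IsCompact D) (hS : ∀ θ ∈ D, ContDiffAt ℝ 3 (S.weighted r) θ) :
    SPL D (peDeriv S r) (peDeriv₂ S r) := by
  have h1 := spl_innovFun hD hS
  have h2 := spl_innovDeriv hD hS
  refine ⟨h1.pl.bilin h2.pl (ContinuousLinearMap.lsmul ℝ ℝ), ?_, fun θ hθ x => ?_⟩
  · have h3 := h2.pl.bilin (F₃ := Vec p →L[ℝ] Vec p →L[ℝ] ℝ) h2.pl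
      (ContinuousLinearMap.smulRightL ℝ (Vec p) (Vec p →L[ℝ] ℝ))
    exact (h1.pl.bilin h2.pl' (ContinuousLinearMap.lsmul ℝ ℝ)).add h3
  · exact (h1.deriv θ hθ x).smul (h2.deriv θ hθ x)

theorem spl_peFun (hD : IsCompact D) (hS : ∀ θ ∈ D, ContDiffAt ℝ 3 (S.weighted r) θ) :
    SPL D (peFun S r) (peDeriv S r) := by
  have h1 := spl_innovFun hD hS
  refine ⟨?_, (spl_peDeriv hD hS).pl, fun θ hθ x => ?_⟩
  · have := (h1.pl.bilin h1.pl (ContinuousLinearMap.mul ℝ ℝ)).clm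
      ((1 / 2 : ℝ) • ContinuousLinearMap.id ℝ ℝ)
    have e : peFun S r = fun θ x => ((1 / 2 : ℝ) • ContinuousLinearMap.id ℝ ℝ)
        (ContinuousLinearMap.mul ℝ ℝ (innovFun S r θ x) (innovFun S r θ x)) := by
      ext θ x; simp [peFun, sq]
    rwa [e]
  · refine (((h1.deriv θ hθ x).pow 2).const_mul (1 / 2)).congr_fderiv ?_
    ext v
    simp [peDeriv]
    ring

variable {Ω : Type*} [MeasurableSpace Ω] {P : Measure Ω} {θs : Vec p} {z y : ℤ → Ω → ℝ}

namespace IsSetup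

theorem peCost_eq (h : IsSetup S θs z y P r D) {N : ℕ} (hN : 1 ≤ N) {θ : Vec p} (hθ : θ ∈ D) (ω : Ω) :
    peCost S y N θ ω = N * avg (startedFunctional r y) (peFun S r) N θ ω := by
  have hN0 : (N : ℝ) ≠ 0 := by positivity
  rw [peCost, avg, smul_eq_mul, mul_inv_cancel_left₀ hN0, Finset.mul_sum]
  exact Finset.sum_congr rfl fun n _ => by rw [h.innov_eq hθ, peFun]

theorem gradient_peCost (h : IsSetup S θs z y P r D) {N : ℕ} (hN : 1 ≤ N) {θ : Vec p}
    (hθ : θ ∈ interior D) (ω : Ω) : gradient (fun τ => peCost S y N τ ω) θ =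
      (N : ℝ) • riesz p (avg (startedFunctional r y) (peDeriv S r) N θ ω) := by
  have h1 := ((spl_peFun h.compact h.smooth).hasFDerivAt_avg (X := startedFunctional r y) N ω
    (interior_subset hθ)).const_mul (N : ℝ)
  rw [← map_smul]
  refine gradient_eq_riesz (h1.congr_of_eventuallyEq ?_)
  filter_upwards [isOpen_interior.mem_nhds hθ] with τ hτ
  exact h.peCost_eq hN (interior_subset hτ) ω

/-- The stationary mean of a function of the sample functional. -/
abbrev mean (_ : IsSetup S θs z y P r D) {F : Type*} [NormedAddCommGroup F] [NormedSpace ℝ F]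
    (f : Vec p → ((ℕ →ᵇ ℝ) →L[ℝ] ℝ) → F) (θ : Vec p) : F :=
  statMean (delayKernel (S.response θs) r) z P f θ

variable [IsProbabilityMeasure P]

theorem gradient_peAsympCost (h : IsSetup S θs z y P r D) {θ : Vec p} (hθ : θ ∈ interior D) :
    gradient (peAsympCost S P y) θ = riesz p (h.mean (peDeriv S r) θ) := by
  refine gradient_eq_riesz (((spl_peFun h.compact h.smooth).hasFDerivAt_statMean h.noise h.decay'
    hθ).congr_of_eventuallyEq ?_)
  filter_upwards [isOpen_interior.mem_nhds hθ] with τ hτ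
  rw [peAsympCost, ← integral_const_mul, statMean]
  refine integral_congr_ae ?_
  filter_upwards [h.ae_statInnov_eq] with ω hω
  rw [hω τ (interior_subset hτ)]; rfl

theorem integral_innovFun_mul {v : Vec p} (h : IsSetup S θs z y P r D) :
    ∫ ω, innovFun S r θs (h.stat ω) * innovDeriv S r θs (h.stat ω) v ∂P = 0 := by
  have h1 := h.integral_mul_innovDeriv Complex.continuous_ofReal (K := 1) (fun x => by simp) v
  rw [← Complex.ofReal_eq_zero, ← h1, ← integral_complex_ofReal]
  simp

theorem integral_innovFun_mul₂ {v w : Vec p} (h : IsSetup S θs z y P r D) :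
    ∫ ω, innovFun S r θs (h.stat ω) * innovDeriv₂ S r θs (h.stat ω) v w ∂P = 0 := by
  have h1 := h.integral_mul_innovDeriv₂ Complex.continuous_ofReal (K := 1) (fun x => by simp) v w
  rw [← Complex.ofReal_eq_zero, ← h1, ← integral_complex_ofReal]
  simp

theorem mean_peDeriv_true (h : IsSetup S θs z y P r D) : h.mean (peDeriv S r) θs = 0 := by
  have hθs := interior_subset h.mem
  ext v
  have h1 := (spl_peDeriv h.compact h.smooth).pl.statMean_clm h.noise h.decay'
    (ContinuousLinearMap.apply ℝ ℝ v) hθs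
  rw [ContinuousLinearMap.apply_apply] at h1
  rw [← h1, zero_apply, ← h.integral_innovFun_mul (v := v)]
  rfl

/-- The innovation is orthogonal to its own second derivative, so only the square of the first
derivative survives in the Hessian. -/
theorem mean_peDeriv₂_apply (h : IsSetup S θs z y P r D) (v : Vec p) :
    h.mean (peDeriv₂ S r) θs v v = ∫ ω, innovDeriv S r θs (h.stat ω) v ^ 2 ∂P := by
  have hθs := interior_subset h.mem
  have hs1 := spl_innovFun h.compact h.smooth
  have hs2 := spl_innovDeriv h.compact h.smooth
  have h1 := (spl_peDeriv h.compact h.smooth).pl'.statMean_clm h.noise h.decay'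
    (ContinuousLinearMap.apply ℝ ℝ v ∘L ContinuousLinearMap.apply ℝ (Vec p →L[ℝ] ℝ) v) hθs
  rw [ContinuousLinearMap.comp_apply, ContinuousLinearMap.apply_apply,
    ContinuousLinearMap.apply_apply] at h1
  rw [← h1]
  have h2 : Integrable (fun ω => innovFun S r θs (h.stat ω) * innovDeriv₂ S r θs (h.stat ω) v v) P :=
    (hs1.pl.bilin (hs2.pl'.clm (ContinuousLinearMap.apply ℝ ℝ v ∘L
      ContinuousLinearMap.apply ℝ (Vec p →L[ℝ] ℝ) v)) (ContinuousLinearMap.mul ℝ ℝ)).integrable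
        h.noise h.decay' hθs 0
  have h3 : Integrable (fun ω => innovDeriv S r θs (h.stat ω) v *
      innovDeriv S r θs (h.stat ω) v) P :=
    ((hs2.pl.clm (ContinuousLinearMap.apply ℝ ℝ v)).bilin
      (hs2.pl.clm (ContinuousLinearMap.apply ℝ ℝ v)) (ContinuousLinearMap.mul ℝ ℝ)).integrable
        h.noise h.decay' hθs 0
  have h4 := integral_add h2 h3
  rw [h.integral_innovFun_mul₂, zero_add] at h4
  simp only [sq]
  rw [← h4]
  rfl

/-- The Hessian of the asymptotic prediction error cost is nonsingular if the gradient of the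
innovation is nondegenerate. -/
theorem isInvertible_mean_peDeriv₂ (h : IsSetup S θs z y P r D)
    (hnd : ∀ v, (∀ᵐ ω ∂P, innovDeriv S r θs (h.stat ω) v = 0) → v = 0) :
    (riesz p ∘L h.mean (peDeriv₂ S r) θs).IsInvertible := by
  refine isInvertible_of_injective fun v hv => hnd v ?_
  have h1 : h.mean (peDeriv₂ S r) θs v v = 0 := by
    rw [← inner_riesz, ← ContinuousLinearMap.comp_apply, hv, inner_zero_left]
  rw [h.mean_peDeriv₂_apply, integral_eq_zero_iff_of_nonneg (fun ω => sq_nonneg _)] at h1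
  · filter_upwards [h1] with ω hω
    exact pow_eq_zero_iff two_ne_zero |>.1 hω
  · have hs2 := (spl_innovDeriv h.compact h.smooth).pl.clm (ContinuousLinearMap.apply ℝ ℝ v)
    simp only [sq]
    exact (hs2.bilin hs2 (ContinuousLinearMap.mul ℝ ℝ)).integrable h.noise h.decay'
      (interior_subset h.mem) 0

/-- On the event where the averaged gradient and Hessian are uniformly close to their means, the
estimator is the unique root, at a distance from `θ*` bounded by the averaged gradient at `θ*`. The
missing normalisation of the cost by `N` does not move its critical points. -/
theorem om_peEstimator (h : IsSetup S θs z y P r D) {Dθ : Set (Vec p)} (hDθ : IsCompact Dθ)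
    (hDD : Dθ ⊆ interior D) (hθs : θs ∈ interior Dθ)
    (hnd : ∀ v, (∀ᵐ ω ∂P, innovDeriv S r θs (h.stat ω) v = 0) → v = 0)
    (hPE : ∀ θ ∈ Dθ, gradient (peAsympCost S P y) θ = 0 → θ = θs) {θhat : ℕ → Ω → Vec p}
    (hθhat : ∀ N, 1 ≤ N → IsRootEstimator Dθ
      (fun θ ω => gradient (fun τ => peCost S y N τ ω) θ) (θhat N)) :
    OM P (fun N ω => ‖θhat N ω - θs‖) (1 / 2) := by
  have hspl := spl_peDeriv h.compact h.smooth
  have hsub : Dθ ⊆ D := hDD.trans interior_subset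
  have hint : interior Dθ ⊆ interior D := interior_subset.trans hDD
  obtain ⟨δ, ρ, C, hδ, -, hC, -, key⟩ := exists_root_perturbation hDθ
    (G := fun θ => riesz p (h.mean (peDeriv S r) θ))
    (G' := fun θ => riesz p ∘L h.mean (peDeriv₂ S r) θ)
    ((riesz p).continuous.comp_continuousOn
      ((hspl.pl.continuousOn_statMean h.noise h.decay').mono hsub)) hθs
    (by rw [h.mean_peDeriv_true, map_zero])
    (fun θ hθ hz => hPE θ hθ (by rw [h.gradient_peAsympCost (hDD hθ), hz]))
    (fun θ hθ => (riesz p).hasFDerivAt.comp θ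
      (hspl.hasFDerivAt_statMean h.noise h.decay' (hint hθ)))
    ((ContinuousLinearMap.compL ℝ (Vec p) (Vec p →L[ℝ] ℝ) (Vec p) (riesz p)).continuous.continuousAt.comp
      ((hspl.pl'.continuousOn_statMean h.noise h.decay').continuousAt
        (mem_interior_iff_mem_nhds.1 h.mem)))
    (h.isInvertible_mean_peDeriv₂ hnd)
  obtain ⟨Y₁, hY₁, hY₁'⟩ := hspl.pl.exists_unif h.compact.isBounded h.isSample
  obtain ⟨Y₂, hY₂, hY₂'⟩ := hspl.pl'.exists_unif h.compact.isBounded h.isSample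
  obtain ⟨R, hR⟩ := hDθ.isBounded.subset_closedBall θs
  have hm : ∀ N, 1 ≤ N → AEStronglyMeasurable (fun ω => ‖θhat N ω - θs‖) P := fun N hN =>
    ((hθhat N hN).1.sub_const _).norm.aestronglyMeasurable
  -- The uniform deviations are of order `N^{-1/4}`, so their second power already gives the rate
  -- `N^{-1/2}` on the bad event.
  refine OM.of_good (b := 0) (c := 1 / 4)
    (G := fun N ω => C * ‖riesz p‖ * ‖avg (startedFunctional r y) (peDeriv S r) N θs ω -
      h.mean (peDeriv S r) θs‖)
    (B := fun _ _ => R) (T := fun N ω => ‖riesz p‖ * (Y₁ N ω + Y₂ N ω)) 2 hδ hm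
    ((hspl.pl.om_norm_avg_sub h.isSample (interior_subset h.mem)).const_mul _) (OM.const R)
    ((hY₁.add hY₂).const_mul _) (by norm_num) (fun N hN => ?_) fun N hN => ae_of_all _ fun ω => ?_
  · filter_upwards [hY₁' N hN, hY₂' N hN] with ω h1 h2 hT
    have hY1 : 0 ≤ Y₁ N ω := (norm_nonneg _).trans (h1 θs (interior_subset h.mem))
    have hY2 : 0 ≤ Y₂ N ω := (norm_nonneg _).trans (h2 θs (interior_subset h.mem))
    have hT' : ‖riesz p‖ * (Y₁ N ω + Y₂ N ω) ≤ δ := (le_abs_self _).trans hT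
    have hT1 : ‖riesz p‖ * Y₁ N ω ≤ δ := le_trans (by gcongr; linarith) hT'
    have hT2 : ‖riesz p‖ * Y₂ N ω ≤ δ := le_trans (by gcongr; linarith) hT'
    obtain ⟨hex, hloc⟩ := key (fun θ => riesz p (avg (startedFunctional r y) (peDeriv S r) N θ ω))
      (fun θ => riesz p ∘L avg (startedFunctional r y) (peDeriv₂ S r) N θ ω)
      (fun θ hθ => (riesz p).hasFDerivAt.comp θ (hspl.hasFDerivAt_avg N ω (interior_subset (hint hθ))))
      (fun θ hθ => by
        rw [← map_sub]
        refine ((riesz p).le_opNorm _).trans (le_trans ?_ hT1)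
        gcongr
        exact h1 θ (hsub hθ))
      (fun θ hθ => by
        rw [← ContinuousLinearMap.comp_sub]
        refine (ContinuousLinearMap.opNorm_comp_le _ _).trans (le_trans ?_ hT2)
        gcongr
        exact h2 θ (hsub hθ))
    have hN0 : (N : ℝ) ≠ 0 := by positivity
    have hiff : ∀ θ, (θ ∈ Dθ ∧ riesz p (avg (startedFunctional r y) (peDeriv S r) N θ ω) = 0) ↔
        (θ ∈ Dθ ∧ gradient (fun τ => peCost S y N τ ω) θ = 0) := fun θ =>
      and_congr_right fun hθ => by
        rw [h.gradient_peCost hN (hDD hθ), smul_eq_zero, or_iff_right hN0]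
    have hroot := (hθhat N hN).2.2 ω ((existsUnique_congr hiff).1 hex)
    have hmem := (hθhat N hN).2.1 ω
    have := (hloc _ hmem ((hiff _).2 ⟨hmem, hroot⟩).2).2
    rw [abs_norm, abs_of_nonneg (by positivity), mul_assoc]
    refine this.trans ?_
    gcongr
    rw [h.mean_peDeriv_true, sub_zero]
    exact (riesz p).le_opNorm _
  · rw [abs_norm]
    refine le_trans ?_ (le_abs_self _)
    exact mem_closedBall_iff_norm.1 (hR ((hθhat N hN).2.1 ω))

end IsSetup

end PredictionError

/-! ### The noise parameter stage -/

theorem hasFDerivAt_fderiv_of_contDiffAt {E F : Type*} [NormedAddCommGroup E] [NormedSpace ℝ E]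
    [NormedAddCommGroup F] [NormedSpace ℝ F] {φ : E → F} {x : E} (h : ContDiffAt ℝ 2 φ x) :
    HasFDerivAt (fderiv ℝ φ) (fderiv ℝ (fderiv ℝ φ) x) x ∧
      ContinuousAt (fderiv ℝ (fderiv ℝ φ)) x := by
  have h1 : ContDiffAt ℝ 1 (fderiv ℝ φ) x := h.fderiv_right (by norm_num)
  have h2 : ContDiffAt ℝ 0 (fderiv ℝ (fderiv ℝ φ)) x := h1.fderiv_right (by norm_num)
  exact ⟨(h1.differentiableAt (by norm_num)).hasFDerivAt, h2.continuousAt⟩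

/-! ### The generalised method of moments for the noise parameter. -/

section Moments

variable {V : Type*} [NormedAddCommGroup V] [NormedSpace ℝ V] {r : ℕ} {B : V →L[ℝ] V →L[ℝ] ℝ}

theorem hasFDerivAt_momentScore {φ : Vec r → V} {η : Vec r} (h : ContDiffAt ℝ 2 φ η)
    (m : V) : HasFDerivAt (fun ζ => gradBil r B (m - φ ζ) (-fderiv ℝ φ ζ))
      (gradBilDeriv r B (m - φ η) (-fderiv ℝ φ η) (-fderiv ℝ (fderiv ℝ φ) η)) η :=
  hasFDerivAt_gradBil B (f := fun ζ => m - φ ζ) (f' := fun ζ => -fderiv ℝ φ ζ)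
    ((h.differentiableAt (by norm_num)).hasFDerivAt.const_sub m)
    (hasFDerivAt_fderiv_of_contDiffAt h).1.neg

theorem gradient_quadratic_sub (hB : ∀ v w, B v w = B w v) {φ : Vec r → V} {η : Vec r} (h : ContDiffAt ℝ 2 φ η)
    (m : V) : gradient (fun ζ => B (m - φ ζ) (m - φ ζ)) η =
      gradBil r B (m - φ η) (-fderiv ℝ φ η) :=
  gradient_quadratic hB (f := fun ζ => m - φ ζ)
    ((h.differentiableAt (by norm_num)).hasFDerivAt.const_sub m)

/-- Stability of the generalised method of moments with respect to the moments. -/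
theorem exists_moment_root (hB : ∀ v w, B v w = B w v) {φ : Vec r → V} {D : Set (Vec r)} (hD : IsCompact D)
    (hφ : ∀ η ∈ D, ContDiffAt ℝ 2 φ η) {ηs : Vec r} (hηs : ηs ∈ interior D)
    (huniq : ∀ η ∈ D, gradient (fun ζ => B (φ ηs - φ ζ) (φ ηs - φ ζ)) η = 0 → η = ηs)
    (hinv : (hessian (fun ζ => B (φ ηs - φ ζ) (φ ηs - φ ζ)) ηs).IsInvertible) :
    ∃ δ C : ℝ, 0 < δ ∧ 0 ≤ C ∧ ∀ m : V, ‖m - φ ηs‖ ≤ δ →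
      (∃! η, η ∈ D ∧ gradient (fun ζ => B (m - φ ζ) (m - φ ζ)) η = 0) ∧
      ∀ η ∈ D, gradient (fun ζ => B (m - φ ζ) (m - φ ζ)) η = 0 → ‖η - ηs‖ ≤ C * ‖m - φ ηs‖ := by
  have hs := interior_subset hηs
  have hgrad : ∀ m, ∀ η ∈ D, gradient (fun ζ => B (m - φ ζ) (m - φ ζ)) η =
      gradBil r B (m - φ η) (-fderiv ℝ φ η) := fun m η hη => gradient_quadratic_sub hB (hφ η hη) m
  have hhess : hessian (fun ζ => B (φ ηs - φ ζ) (φ ηs - φ ζ)) ηs =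
      gradBilDeriv r B (φ ηs - φ ηs) (-fderiv ℝ φ ηs) (-fderiv ℝ (fderiv ℝ φ) ηs) := by
    refine ((hasFDerivAt_momentScore (hφ ηs hs) (φ ηs)).congr_of_eventuallyEq ?_).fderiv
    filter_upwards [mem_interior_iff_mem_nhds.1 hηs] with η hη
    exact hgrad _ η hη
  have hφc : ContinuousAt φ ηs := (hφ ηs hs).continuousAt
  have hφc' : ContinuousAt (fderiv ℝ φ) ηs :=
    (hasFDerivAt_fderiv_of_contDiffAt (hφ ηs hs)).1.continuousAt
  have hφc'' := (hasFDerivAt_fderiv_of_contDiffAt (hφ ηs hs)).2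
  obtain ⟨δ, ρ, C, hδ, -, hC, -, key⟩ := exists_root_perturbation hD
    (G := fun ζ => gradBil r B (φ ηs - φ ζ) (-fderiv ℝ φ ζ))
    (G' := fun η => gradBilDeriv r B (φ ηs - φ η) (-fderiv ℝ φ η) (-fderiv ℝ (fderiv ℝ φ) η))
    (fun η hη => (hasFDerivAt_momentScore (hφ η hη) (φ ηs)).continuousAt.continuousWithinAt)
    hηs (by simp) (fun η hη h0 => huniq η hη ((hgrad _ η hη).trans h0))
    (fun η hη => hasFDerivAt_momentScore (hφ η (interior_subset hη)) (φ ηs))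
    (by
      unfold gradBilDeriv
      exact ((((gradBil r B).precompR (Vec r)).continuous.continuousAt.comp
        (continuousAt_const.sub hφc)).clm_apply hφc''.neg).add
          ((((gradBil r B).precompL (Vec r)).continuous.continuousAt.comp hφc'.neg).clm_apply
            hφc'.neg))
    (hhess ▸ hinv)
  obtain ⟨B₁, hB₁⟩ := hD.exists_bound_of_continuousOn (f := fderiv ℝ φ) fun η hη =>
    (hasFDerivAt_fderiv_of_contDiffAt (hφ η hη)).1.continuousAt.continuousWithinAt
  obtain ⟨B₂, hB₂⟩ := hD.exists_bound_of_continuousOn (f := fderiv ℝ (fderiv ℝ φ)) fun η hη =>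
    (hasFDerivAt_fderiv_of_contDiffAt (hφ η hη)).2.continuousWithinAt
  have hB₁0 : 0 ≤ B₁ := (norm_nonneg _).trans (hB₁ ηs hs)
  have hB₂0 : 0 ≤ B₂ := (norm_nonneg _).trans (hB₂ ηs hs)
  -- The score and its derivative are affine in the moment vector `m`; `Q` is a common Lipschitz
  -- constant on `D`, made positive by the last summand.
  set Q : ℝ := ‖gradBil r B‖ * B₁ + ‖(gradBil r B).precompR (Vec r)‖ * B₂ + 1 with hQ
  have hQ0 : 0 < Q := by positivity
  have hd1 : ∀ m, ∀ η ∈ D, ‖gradBil r B (m - φ η) (-fderiv ℝ φ η) -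
      gradBil r B (φ ηs - φ η) (-fderiv ℝ φ η)‖ ≤ Q * ‖m - φ ηs‖ := fun m η hη => by
    have e : gradBil r B (m - φ η) (-fderiv ℝ φ η) - gradBil r B (φ ηs - φ η) (-fderiv ℝ φ η) =
        gradBil r B (m - φ ηs) (-fderiv ℝ φ η) := by
      rw [← sub_apply, ← map_sub, sub_sub_sub_cancel_right]
    rw [e]
    calc _ ≤ ‖gradBil r B‖ * ‖m - φ ηs‖ * ‖-fderiv ℝ φ η‖ := (gradBil r B).le_opNorm₂ _ _
      _ ≤ ‖gradBil r B‖ * ‖m - φ ηs‖ * B₁ := by rw [norm_neg]; gcongr; exact hB₁ η hη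
      _ = ‖gradBil r B‖ * B₁ * ‖m - φ ηs‖ := by ring
      _ ≤ _ := by
        gcongr
        rw [hQ]
        have : 0 ≤ ‖(gradBil r B).precompR (Vec r)‖ * B₂ := by positivity
        linarith
  refine ⟨δ / Q, C * Q, by positivity, by positivity, fun m hm => ?_⟩
  have hmQ : Q * ‖m - φ ηs‖ ≤ δ := by
    rw [le_div_iff₀ hQ0] at hm; linarith
  obtain ⟨hex, hloc⟩ := key (fun ζ => gradBil r B (m - φ ζ) (-fderiv ℝ φ ζ))
    (fun η => gradBilDeriv r B (m - φ η) (-fderiv ℝ φ η) (-fderiv ℝ (fderiv ℝ φ) η))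
    (fun η hη => hasFDerivAt_momentScore (hφ η (interior_subset hη)) m)
    (fun η hη => (hd1 m η hη).trans hmQ)
    (fun η hη => by
      have e : gradBilDeriv r B (m - φ η) (-fderiv ℝ φ η) (-fderiv ℝ (fderiv ℝ φ) η) -
          gradBilDeriv r B (φ ηs - φ η) (-fderiv ℝ φ η) (-fderiv ℝ (fderiv ℝ φ) η) =
          (gradBil r B).precompR (Vec r) (m - φ ηs) (-fderiv ℝ (fderiv ℝ φ) η) := by
        rw [gradBilDeriv, gradBilDeriv, add_sub_add_right_eq_sub, ← sub_apply, ← map_sub,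
          sub_sub_sub_cancel_right]
      rw [e]
      refine le_trans ?_ hmQ
      calc _ ≤ ‖(gradBil r B).precompR (Vec r)‖ * ‖m - φ ηs‖ * ‖-fderiv ℝ (fderiv ℝ φ) η‖ :=
            ContinuousLinearMap.le_opNorm₂ _ _ _
        _ ≤ ‖(gradBil r B).precompR (Vec r)‖ * ‖m - φ ηs‖ * B₂ := by
            rw [norm_neg]; gcongr; exact hB₂ η hη
        _ = ‖(gradBil r B).precompR (Vec r)‖ * B₂ * ‖m - φ ηs‖ := by ring
        _ ≤ _ := by
          gcongr
          rw [hQ]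
          have : 0 ≤ ‖gradBil r B‖ * B₁ := by positivity
          linarith)
  refine ⟨(existsUnique_congr fun η => and_congr_right fun hη => by rw [hgrad m η hη]).2 hex,
    fun η hη h0 => ?_⟩
  have h1 := (hloc η hη ((hgrad m η hη).symm.trans h0)).2
  have h2 := hd1 m ηs hs
  rw [sub_self (φ ηs), map_zero, zero_apply, sub_zero] at h2
  exact h1.trans (by rw [mul_assoc]; gcongr)

end Moments

/-! ### The noise estimator as a method of moments with estimated innovations. -/

section NoiseParameter

variable {p d r M : ℕ} {S : SystemFamily p d} {F : NoiseFamily r} {w : ℝ} {D : Set (Vec p)}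

/-- The exponentials of the innovation. -/
def expFun (S : SystemFamily p d) (w : ℝ) (u : Fin M → ℝ) (θ : Vec p) (x : (ℕ →ᵇ ℝ) →L[ℝ] ℝ) :
    Fin M → ℂ :=
  fun k => Complex.exp (Complex.I * u k * innovFun S w θ x)

/-- The vector of values of the characteristic function. -/
def NoiseFamily.phiVec (F : NoiseFamily r) (h : ℝ) (u : Fin M → ℝ) (η : Vec r) : Fin M → ℂ :=
  fun k => F.phi h (u k) η

theorem NoiseFamily.contDiffAt_phiVec {h : ℝ} {η : Vec r}
    (hφ : ∀ u : ℝ, ContDiffAt ℝ 2 (F.phi h u) η) (u : Fin M → ℝ) :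
    ContDiffAt ℝ 2 (F.phiVec h u) η :=
  contDiffAt_pi.2 fun k => hφ (u k)

theorem pl_expFun (hD : IsCompact D) (hS : ∀ θ ∈ D, ContDiffAt ℝ 3 (S.weighted w) θ)
    (u : Fin M → ℝ) : PL D (expFun S w u) :=
  PL.pi fun k => (spl_innovFun hD hS).pl.expI (u k)

variable {Ω : Type*} [MeasurableSpace Ω] {P : Measure Ω} {θs : Vec p} {z y : ℤ → Ω → ℝ}

namespace IsSetup

theorem noiseScoreMean_eq (hs : IsSetup S θs z y P w D) (h : ℝ) (u : Fin M → ℝ) {N : ℕ} (hN : 1 ≤ N)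
    {θ : Vec p} (hθ : θ ∈ D) (η : Vec r) (ω : Ω) : noiseScoreMean S F h u y N θ η ω =
      avg (startedFunctional w y) (expFun S w u) N θ ω - F.phiVec h u η := by
  have hN0 : (N : ℂ) ≠ 0 := by exact_mod_cast (by omega : N ≠ 0)
  ext k
  simp only [noiseScoreMean, avg, Pi.sub_apply, Pi.smul_apply, Finset.sum_apply, expFun,
    NoiseFamily.phiVec, Finset.sum_sub_distrib, Finset.sum_const, Nat.card_Icc,
    Nat.add_sub_cancel, nsmul_eq_mul, mul_sub, inv_mul_cancel_left₀ hN0, hs.innov_eq hθ,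
    Complex.real_smul, Complex.ofReal_inv, Complex.ofReal_natCast]

variable [IsProbabilityMeasure P]

/-- The innovation at the true system parameter is an increment of the Lévy process, whose
characteristic function is known. -/
theorem mean_expFun_true (hs : IsSetup S θs z y P w D) {h : ℝ} {ηs : Vec r}
    (hchar : ∀ u : ℝ, ∫ ω, Complex.exp (Complex.I * u * z 0 ω) ∂P = F.phi h u ηs)
    (u : Fin M → ℝ) : hs.mean (expFun S w u) θs = F.phiVec h u ηs := by
  ext k
  have h1 := (pl_expFun hs.compact hs.smooth u).statMean_clm hs.noise hs.decay'
    (ContinuousLinearMap.proj (R := ℝ) (φ := fun _ : Fin M => ℂ) k) (interior_subset hs.mem)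
  rw [ContinuousLinearMap.proj_apply] at h1
  rw [IsSetup.mean, ← h1, NoiseFamily.phiVec, ← hchar]
  refine integral_congr_ae ?_
  filter_upwards [hs.ae_innovFun_true] with ω hω
  rw [← hω]
  rfl

/-- Decomposition into variance and squared bias: the score is a centred variable not depending on
`η` plus a deterministic vector, and the mixed term integrates to zero. The identifiability
assumptions thus become statements about the distance between moment vectors. -/
theorem noiseAsympCost_eq (hs : IsSetup S θs z y P w D) {h : ℝ} {ηs : Vec r}
    (hchar : ∀ u : ℝ, ∫ ω, Complex.exp (Complex.I * u * z 0 ω) ∂P = F.phi h u ηs)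
    (u : Fin M → ℝ) (K : Matrix (Fin M) (Fin M) ℂ) : ∃ c : ℝ,
      noiseAsympCost S F h u P K y θs =
        fun η => c + weightedSq K (F.phiVec h u ηs - F.phiVec h u η) := by
  have hθs := interior_subset hs.mem
  let e : Ω → Fin M → ℂ := fun ω => expFun S w u θs (hs.stat ω) - F.phiVec h u ηs
  have hpl := (pl_expFun hs.compact hs.smooth u).add (PL.const (-F.phiVec h u ηs))
  have hepl : PL D fun θ x => expFun S w u θ x - F.phiVec h u ηs := by
    simpa only [sub_eq_add_neg] using hpl
  have hei : Integrable e P := hepl.integrable hs.noise hs.decay' hθs 0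
  have he0 : ∫ ω, e ω ∂P = 0 := by
    have h1 := (pl_expFun hs.compact hs.smooth u).integrable hs.noise hs.decay' hθs 0
    have h2 := hs.mean_expFun_true hchar u
    calc ∫ ω, e ω ∂P = hs.mean (expFun S w u) θs - ∫ _, F.phiVec h u ηs ∂P :=
          integral_sub h1 (integrable_const _)
      _ = 0 := by rw [h2]; simp
  have hqi : Integrable (fun ω => weightedBil K (e ω) (e ω)) P :=
    (hepl.bilin hepl (weightedBil K)).integrable hs.noise hs.decay' hθs 0
  refine ⟨∫ ω, weightedBil K (e ω) (e ω) ∂P, funext fun η => ?_⟩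
  set v := F.phiVec h u ηs - F.phiVec h u η with hv
  have hli : Integrable (fun ω => 2 * weightedBil K v (e ω)) P :=
    ((weightedBil K v).integrable_comp hei).const_mul 2
  have hl0 : ∫ ω, 2 * weightedBil K v (e ω) ∂P = 0 := by
    rw [integral_const_mul, (weightedBil K v).integral_comp_comm hei, he0, map_zero, mul_zero]
  have h1 : noiseAsympCost S F h u P K y θs η =
      ∫ ω, ((weightedBil K (e ω) (e ω) + 2 * weightedBil K v (e ω)) + weightedSq K v) ∂P := by
    refine integral_congr_ae ?_
    filter_upwards [hs.ae_statInnov_eq] with ω hω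
    have h2 : noiseStatScore S F h u y 0 θs η ω = e ω + v := by
      ext k
      simp only [noiseStatScore, hω θs hθs, e, hv, Pi.add_apply, Pi.sub_apply, expFun,
        NoiseFamily.phiVec]
      ring
    have h3 : weightedBil K (e ω + v) (e ω + v) = weightedBil K (e ω) (e ω) +
        weightedBil K (e ω) v + (weightedBil K v (e ω) + weightedBil K v v) := by
      simp only [map_add, add_apply]
      ring
    rw [h2, ← weightedBil_self, ← weightedBil_self, h3, weightedBil_comm K (e ω) v]
    ring
  have h4 := integral_add (hqi.add hli) (integrable_const (μ := P) (weightedSq K v))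
  simp only [Pi.add_apply] at h4
  rw [h1, h4, integral_add hqi hli, hl0]
  simp

/-- The empirical moments at the estimated system parameter differ from the true ones by a sampling
error at `θ*` plus a random Lipschitz constant times the error of the first stage, both of order
`N^{-1/2}`. -/
theorem om_noiseEstimator (hs : IsSetup S θs z y P w D) {h : ℝ} {ηs : Vec r}
    (hchar : ∀ u : ℝ, ∫ ω, Complex.exp (Complex.I * u * z 0 ω) ∂P = F.phi h u ηs)
    {Dη : Set (Vec r)} (hDη : IsCompact Dη) (hηs : ηs ∈ interior Dη)
    (hφ : ∀ u : ℝ, ∀ η ∈ Dη, ContDiffAt ℝ 2 (F.phi h u) η) (u : Fin M → ℝ)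
    (K : Matrix (Fin M) (Fin M) ℂ)
    (hE : ∀ η ∈ Dη, gradient (noiseAsympCost S F h u P K y θs) η = 0 → η = ηs)
    (hRE : (hessian (noiseAsympCost S F h u P K y θs) ηs).IsInvertible)
    {θhat : ℕ → Ω → Vec p} (hθD : ∀ N, 1 ≤ N → ∀ ω, θhat N ω ∈ D) (hθ : OM P (fun N ω => ‖θhat N ω - θs‖) (1 / 2))
    {ηhat : ℕ → Ω → Vec r} (hηhat : ∀ N, 1 ≤ N → IsRootEstimator Dη
      (fun η ω => gradient (fun ζ => noiseCost S F h u K y N (θhat N ω) ζ ω) η) (ηhat N)) :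
    OM P (fun N ω => ‖ηhat N ω - ηs‖) (1 / 2) := by
  have hθs := interior_subset hs.mem
  have hpl := pl_expFun hs.compact hs.smooth u
  obtain ⟨c, hc⟩ := hs.noiseAsympCost_eq hchar u K
  have hgradc : gradient (noiseAsympCost S F h u P K y θs) =
      gradient (fun ζ => weightedBil K (F.phiVec h u ηs - F.phiVec h u ζ)
        (F.phiVec h u ηs - F.phiVec h u ζ)) := by
    rw [hc]
    funext η
    simp only [gradient, fderiv_const_add, weightedBil_self]
  obtain ⟨δ, C, hδ, hC, key⟩ := exists_moment_root (weightedBil_comm K) (φ := F.phiVec h u) hDη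
    (fun η hη => NoiseFamily.contDiffAt_phiVec (fun v => hφ v η hη) u) hηs
    (fun η hη h0 => hE η hη (by rw [hgradc, h0]))
    (by
      unfold hessian at hRE ⊢
      rwa [hgradc] at hRE)
  obtain ⟨ξ, hξ, hξ0, -, hlip, -⟩ := hpl.exists_avg_bound hs.isSample
  obtain ⟨R, hR⟩ := hDη.isBounded.subset_closedBall ηs
  let T : ℕ → Ω → ℝ := fun N ω => ‖avg (startedFunctional w y) (expFun S w u) N θs ω -
    hs.mean (expFun S w u) θs‖ + ξ N ω * ‖θhat N ω - θs‖
  have hT : OM P T (1 / 2) := by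
    refine (hpl.om_norm_avg_sub hs.isSample hθs).add ?_
    simpa using hξ.mul hθ
  have hT0 : ∀ N ω, 0 ≤ T N ω := fun N ω =>
    add_nonneg (norm_nonneg _) (mul_nonneg (hξ0 N ω) (norm_nonneg _))
  have hTb : ∀ N, 1 ≤ N → ∀ ω, ‖avg (startedFunctional w y) (expFun S w u) N (θhat N ω) ω -
      F.phiVec h u ηs‖ ≤ T N ω := fun N hN ω => by
    rw [← hs.mean_expFun_true hchar u, ← sub_add_sub_cancel _
      (avg (startedFunctional w y) (expFun S w u) N θs ω), add_comm]
    exact (norm_add_le _ _).trans (add_le_add le_rfl (hlip N ω _ (hθD N hN ω) _ hθs))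
  -- The same variable bounds the error and defines the good event, so its first power suffices on
  -- the bad event.
  refine OM.of_good (b := 0) (c := 1 / 2) (G := fun N ω => C * T N ω) (B := fun _ _ => R)
    (T := T) 1 hδ (fun N hN => ((hηhat N hN).1.sub_const _).norm.aestronglyMeasurable)
    (hT.const_mul C) (OM.const R) hT (by norm_num) (fun N hN => ae_of_all _ fun ω hTω => ?_)
    fun N hN => ae_of_all _ fun ω => ?_
  · have h1 : ∀ ζ, noiseCost S F h u K y N (θhat N ω) ζ ω =
        weightedBil K (avg (startedFunctional w y) (expFun S w u) N (θhat N ω) ω -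
          F.phiVec h u ζ) (avg (startedFunctional w y) (expFun S w u) N (θhat N ω) ω -
          F.phiVec h u ζ) := fun ζ => by
      rw [noiseCost, weightedBil_self, hs.noiseScoreMean_eq h u hN (hθD N hN ω)]
    have h2 := hTb N hN ω
    obtain ⟨hex, hloc⟩ := key _ (h2.trans ((le_abs_self _).trans hTω))
    have hroot := (hηhat N hN).2.2 ω (by simpa only [h1] using hex)
    simp only [h1] at hroot
    have := hloc _ ((hηhat N hN).2.1 ω) hroot
    rw [abs_norm, abs_of_nonneg (mul_nonneg hC (hT0 N ω))]
    exact this.trans (by gcongr)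
  · rw [abs_norm]
    refine le_trans ?_ (le_abs_self _)
    exact mem_closedBall_iff_norm.1 (hR ((hηhat N hN).2.1 ω))

end IsSetup

end NoiseParameter

/-! ### Zeros of gradients of quadratic costs -/

section QuadraticRoots

variable {V : Type*} [NormedAddCommGroup V] [NormedSpace ℝ V] {p : ℕ} {B : V →L[ℝ] V →L[ℝ] ℝ}

/-- The Gauss-Newton approximation of the Hessian of a quadratic cost. -/
def gaussNewton (p : ℕ) (B : V →L[ℝ] V →L[ℝ] ℝ) (T : Vec p →L[ℝ] V) : Vec p →L[ℝ] Vec p :=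
  (gradBil p B).precompL (Vec p) T T

theorem gaussNewton_apply (T : Vec p →L[ℝ] V) (v : Vec p) :
    gaussNewton p B T v = gradBil p B (T v) T := rfl

/-- The score is bilinear in `h` and `h'`. Where `h` is differenced, it is linearised with error
`τ`; where `h'` is differenced, it is multiplied by `h y`, which is small near a zero of `h`. So no
second derivative of `h` is needed. -/
theorem norm_gradBil_sub_sub_le {h : Vec p → V} {h' : Vec p → Vec p →L[ℝ] V} {s : Set (Vec p)}
    (hs : Convex ℝ s) (hh : ∀ x ∈ s, HasFDerivAt h (h' x) x) {T : Vec p →L[ℝ] V} {τ κ σ L : ℝ}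
    (hτ : ∀ x ∈ s, ‖h' x - T‖ ≤ τ) {x y : Vec p} (hx : x ∈ s) (hy : y ∈ s) (hκ : ‖h' x‖ ≤ κ)
    (hσ : ‖h y‖ ≤ σ) (hL : ‖h' x - h' y‖ ≤ L * ‖x - y‖) :
    ‖gradBil p B (h x) (h' x) - gradBil p B (h y) (h' y) - gaussNewton p B T (x - y)‖ ≤
      ‖gradBil p B‖ * (τ * κ + ‖T‖ * τ + σ * L) * ‖x - y‖ := by
  have hτ0 : 0 ≤ τ := (norm_nonneg _).trans (hτ x hx)
  have h1 : ‖h x - h y - T (x - y)‖ ≤ τ * ‖x - y‖ := by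
    have h2 : ∀ z ∈ s, HasFDerivWithinAt (fun z => h z - T z) (h' z - T) s z := fun z hz =>
      ((hh z hz).sub T.hasFDerivAt).hasFDerivWithinAt
    refine le_trans (le_of_eq ?_) (hs.norm_image_sub_le_of_norm_hasFDerivWithin_le h2 hτ hy hx)
    rw [map_sub]
    congr 1
    abel
  have e : gradBil p B (h x) (h' x) - gradBil p B (h y) (h' y) - gaussNewton p B T (x - y) =
      gradBil p B (h x - h y - T (x - y)) (h' x) + gradBil p B (T (x - y)) (h' x - T) +
        gradBil p B (h y) (h' x - h' y) := by
    rw [gaussNewton_apply]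
    simp only [map_sub, sub_apply]
    abel
  rw [e]
  calc _ ≤ ‖gradBil p B‖ * ‖h x - h y - T (x - y)‖ * ‖h' x‖ +
        ‖gradBil p B‖ * ‖T (x - y)‖ * ‖h' x - T‖ + ‖gradBil p B‖ * ‖h y‖ * ‖h' x - h' y‖ :=
        (norm_add₃_le).trans (add_le_add (add_le_add ((gradBil p B).le_opNorm₂ _ _)
          ((gradBil p B).le_opNorm₂ _ _)) ((gradBil p B).le_opNorm₂ _ _))
    _ ≤ ‖gradBil p B‖ * (τ * ‖x - y‖) * κ + ‖gradBil p B‖ * (‖T‖ * ‖x - y‖) * τ +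
        ‖gradBil p B‖ * σ * (L * ‖x - y‖) := by
        have := (norm_nonneg _).trans hσ
        gcongr
        · exact T.le_opNorm _
        · exact hτ x hx
    _ = _ := by ring

/-- Where `g` vanishes the second derivative drops out of the Hessian, which is therefore of
Gauss-Newton form even if `g'` is merely Lipschitz. -/
theorem hasFDerivAt_gradBil_of_zero {g : Vec p → V} {g' : Vec p → Vec p →L[ℝ] V} {D : Set (Vec p)}
    {xs : Vec p} (hxs : xs ∈ interior D) (hg : ∀ x ∈ interior D, HasFDerivAt g (g' x) x) {K : ℝ}
    (hK : ∀ x ∈ D, ∀ y ∈ D, ‖g' x - g' y‖ ≤ K * ‖x - y‖) (h0 : g xs = 0) :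
    HasFDerivAt (fun x => gradBil p B (g x) (g' x)) (gaussNewton p B (g' xs)) xs := by
  obtain ⟨ε, hε, hball⟩ := Metric.nhds_basis_closedBall.mem_iff.1 (isOpen_interior.mem_nhds hxs)
  have hKb : ∀ x ∈ Metric.closedBall xs ε, ‖g' x - g' xs‖ ≤ |K| * ‖x - xs‖ := fun x hx =>
    (hK x (interior_subset (hball hx)) xs (interior_subset hxs)).trans
      (by gcongr; exact le_abs_self _)
  have h1 : (fun x => gradBil p B (g x) (g' x) - gradBil p B (g xs) (g' xs) -
      gaussNewton p B (g' xs) (x - xs)) =O[𝓝 xs] fun x => ‖x - xs‖ ^ 2 := by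
    refine Asymptotics.IsBigO.of_bound (‖gradBil p B‖ * (|K| * (‖g' xs‖ + |K| * ε) + ‖g' xs‖ * |K|)) ?_
    filter_upwards [Metric.closedBall_mem_nhds xs hε] with x hx
    have hx' : ‖x - xs‖ ≤ ε := mem_closedBall_iff_norm.1 hx
    have hsub : Metric.closedBall xs ‖x - xs‖ ⊆ Metric.closedBall xs ε :=
      Metric.closedBall_subset_closedBall hx'
    have h2 := norm_gradBil_sub_sub_le (B := B) (h := g) (h' := g') (T := g' xs)
      (τ := |K| * ‖x - xs‖) (κ := ‖g' xs‖ + |K| * ε) (σ := 0) (L := |K|)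
      (convex_closedBall xs ‖x - xs‖)
      (fun z hz => hg z (hball (hsub hz)))
      (fun z hz => (hKb z (hsub hz)).trans (by gcongr; exact mem_closedBall_iff_norm.1 hz))
      (mem_closedBall_iff_norm.2 le_rfl) (Metric.mem_closedBall_self (norm_nonneg _))
      (by
        have h3 := norm_add_le (g' xs) (g' x - g' xs)
        rw [add_sub_cancel] at h3
        refine h3.trans ?_
        gcongr
        exact (hKb x hx).trans (by gcongr))
      (by rw [h0, norm_zero]) (hKb x hx)
    refine h2.trans_eq ?_
    rw [Real.norm_of_nonneg (by positivity)]
    ring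
  exact hasFDerivAt_iff_isLittleO.2 (h1.trans_isLittleO (by
    simpa using Asymptotics.isLittleO_pow_sub_sub xs one_lt_two))

/-- Stability of the zero of the gradient of a quadratic cost that vanishes there. -/
theorem exists_quadratic_root {g : Vec p → V} {g' : Vec p → Vec p →L[ℝ] V} {D : Set (Vec p)}
    (hD : IsCompact D) {xs : Vec p} (hxs : xs ∈ interior D)
    (hg : ∀ x ∈ interior D, HasFDerivAt g (g' x) x) {K : ℝ}
    (hgK : ∀ x ∈ D, ‖g x‖ ≤ K) (hgK' : ∀ x ∈ D, ‖g' x‖ ≤ K)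
    (hgL : ∀ x ∈ D, ∀ y ∈ D, ‖g x - g y‖ ≤ K * ‖x - y‖)
    (hgL' : ∀ x ∈ D, ∀ y ∈ D, ‖g' x - g' y‖ ≤ K * ‖x - y‖) (h0 : g xs = 0)
    (huniq : ∀ x ∈ D, gradBil p B (g x) (g' x) = 0 → x = xs)
    (hA : (gaussNewton p B (g' xs)).IsInvertible) {L : ℝ} (hL : 0 ≤ L) :
    ∃ δ ρ C : ℝ, 0 < δ ∧ 0 < ρ ∧ 0 ≤ C ∧ Metric.closedBall xs ρ ⊆ interior D ∧
      ∀ (h : Vec p → V) (h' : Vec p → Vec p →L[ℝ] V), (∀ x ∈ interior D, HasFDerivAt h (h' x) x) →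
        (∀ x ∈ D, ‖h x - g x‖ ≤ δ) → (∀ x ∈ D, ‖h' x - g' x‖ ≤ δ) →
        (∀ x ∈ D, ∀ y ∈ D, ‖h' x - h' y‖ ≤ L * ‖x - y‖) →
        (∃! x, x ∈ D ∧ gradBil p B (h x) (h' x) = 0) ∧
        ∀ x ∈ D, gradBil p B (h x) (h' x) = 0 →
          ‖x - xs‖ ≤ ρ ∧ ‖x - xs‖ ≤ C * ‖gradBil p B (h xs) (h' xs)‖ := by
  have hs := interior_subset hxs
  have hK : 0 ≤ K := (norm_nonneg _).trans (hgK xs hs)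
  have hGA := hasFDerivAt_gradBil_of_zero (B := B) hxs hg hgL' h0
  have hlip : ∀ {F : Type _} [NormedAddCommGroup F] {f : Vec p → F},
      (∀ x ∈ D, ∀ y ∈ D, ‖f x - f y‖ ≤ K * ‖x - y‖) → ContinuousOn f D := fun {F} _ {f} hf => by
    refine LipschitzOnWith.continuousOn (K := K.toNNReal)
      (LipschitzOnWith.of_dist_le_mul fun x hx y hy => ?_)
    rw [dist_eq_norm, dist_eq_norm, Real.coe_toNNReal _ hK]
    exact hf x hx y hy
  have hGc : ContinuousOn (fun x => gradBil p B (g x) (g' x)) D :=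
    ((gradBil p B).continuous.comp_continuousOn (hlip hgL)).clm_apply (hlip hgL')
  obtain ⟨A, hA⟩ := hA
  obtain ⟨δ₀, ρ₀, C, hδ₀, hρ₀, hC, hball, key⟩ := exists_root_radius hD hGc hxs (by simp [h0])
    huniq (A := A) (hA ▸ hGA)
  obtain ⟨ρ₁, hρ₁, hball₁⟩ := Metric.nhds_basis_closedBall.mem_iff.1 (isOpen_interior.mem_nhds hxs)
  set Q : ℝ := ‖gradBil p B‖ * (2 * K + 1 + L) + 1 with hQ
  have hQ0 : 0 < Q := by positivity
  -- The error of linearisation on the ball is at most `Q (δ + K ρ)`, which has to stay below `δ₀`.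
  -- The radius is fixed first, since the score error `Q δ` must also be at most `δ₀ ρ`.
  set ρ : ℝ := min (min ρ₀ ρ₁) (δ₀ / (2 * Q * (K + 1))) with hρ
  have hρ0 : 0 < ρ := by positivity
  have hρK : Q * (K * ρ) ≤ δ₀ / 2 := by
    calc Q * (K * ρ) ≤ Q * ((K + 1) * (δ₀ / (2 * Q * (K + 1)))) := by
          gcongr
          · linarith
          · exact min_le_right _ _
      _ = δ₀ / 2 := by field_simp
  set δ : ℝ := min 1 (min (δ₀ / (2 * Q)) (δ₀ * ρ / Q)) with hδ
  have hδ0 : 0 < δ := by positivity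
  have hδ1 : δ ≤ 1 := min_le_left _ _
  have hδ2 : Q * δ ≤ δ₀ / 2 := by
    calc Q * δ ≤ Q * (δ₀ / (2 * Q)) := by
          gcongr
          exact (min_le_right _ _).trans (min_le_left _ _)
      _ = δ₀ / 2 := by field_simp
  have hδ3 : Q * δ ≤ δ₀ * ρ := by
    calc Q * δ ≤ Q * (δ₀ * ρ / Q) := by
          gcongr
          exact (min_le_right _ _).trans (min_le_right _ _)
      _ = δ₀ * ρ := by field_simp
  have hsub : Metric.closedBall xs ρ ⊆ interior D :=
    (Metric.closedBall_subset_closedBall ((min_le_left _ _).trans (min_le_right _ _))).trans hball₁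
  have hsub' := hsub.trans interior_subset
  refine ⟨δ, ρ, C, hδ0, hρ0, hC, hsub, fun h h' hh hδh hδh' hLh =>
    key ρ hρ0 ((min_le_left _ _).trans (min_le_left _ _)) _ (fun x hx y hy => ?_) fun x hx => ?_⟩
  · have h1 : ∀ z ∈ Metric.closedBall xs ρ, ‖h' z - g' xs‖ ≤ δ + K * ρ := fun z hz => by
      have h2 := hgL' z (hsub' hz) xs hs
      have h3 : ‖z - xs‖ ≤ ρ := mem_closedBall_iff_norm.1 hz
      calc ‖h' z - g' xs‖ = ‖(h' z - g' z) + (g' z - g' xs)‖ := by rw [sub_add_sub_cancel]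
        _ ≤ δ + K * ρ := (norm_add_le _ _).trans
          (add_le_add (hδh' z (hsub' hz)) (h2.trans (by gcongr)))
    have h2 : ‖h' x‖ ≤ K + 1 := by
      calc ‖h' x‖ = ‖g' x + (h' x - g' x)‖ := by rw [add_sub_cancel]
        _ ≤ K + 1 := (norm_add_le _ _).trans
          (add_le_add (hgK' x (hsub' hx)) ((hδh' x (hsub' hx)).trans hδ1))
    have h3 : ‖h y‖ ≤ δ + K * ρ := by
      have h4 := hgL y (hsub' hy) xs hs
      rw [h0, sub_zero] at h4
      have h5 : ‖y - xs‖ ≤ ρ := mem_closedBall_iff_norm.1 hy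
      calc ‖h y‖ = ‖(h y - g y) + g y‖ := by rw [sub_add_cancel]
        _ ≤ δ + K * ρ := (norm_add_le _ _).trans
          (add_le_add (hδh y (hsub' hy)) (h4.trans (by gcongr)))
    have h6 := norm_gradBil_sub_sub_le (B := B) (convex_closedBall xs ρ) (fun z hz => hh z (hsub hz))
      h1 hx hy h2 h3 (hLh x (hsub' hx) y (hsub' hy))
    rw [← ContinuousLinearEquiv.coe_coe, hA]
    refine h6.trans ?_
    gcongr
    calc ‖gradBil p B‖ * ((δ + K * ρ) * (K + 1) + ‖g' xs‖ * (δ + K * ρ) + (δ + K * ρ) * L)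
        ≤ ‖gradBil p B‖ * ((δ + K * ρ) * (K + 1) + K * (δ + K * ρ) + (δ + K * ρ) * L) := by
          gcongr
          exact hgK' xs hs
      _ = (Q - 1) * (δ + K * ρ) := by rw [hQ]; ring
      _ ≤ Q * (δ + K * ρ) := by gcongr; linarith
      _ = Q * δ + Q * (K * ρ) := by ring
      _ ≤ δ₀ := by linarith
  · have e : gradBil p B (h x) (h' x) - gradBil p B (g x) (g' x) =
        gradBil p B (h x - g x) (h' x) + gradBil p B (g x) (h' x - g' x) := by
      simp only [map_sub, sub_apply]
      abel
    have h2 : ‖h' x‖ ≤ K + 1 := by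
      calc ‖h' x‖ = ‖g' x + (h' x - g' x)‖ := by rw [add_sub_cancel]
        _ ≤ K + 1 := (norm_add_le _ _).trans (add_le_add (hgK' x hx) ((hδh' x hx).trans hδ1))
    rw [e]
    refine le_trans ?_ hδ3
    calc _ ≤ ‖gradBil p B‖ * ‖h x - g x‖ * ‖h' x‖ + ‖gradBil p B‖ * ‖g x‖ * ‖h' x - g' x‖ :=
          (norm_add_le _ _).trans (add_le_add ((gradBil p B).le_opNorm₂ _ _)
            ((gradBil p B).le_opNorm₂ _ _))
      _ ≤ ‖gradBil p B‖ * δ * (K + 1) + ‖gradBil p B‖ * K * δ := by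
          gcongr
          · exact hδh x hx
          · exact hgK x hx
          · exact hδh' x hx
      _ = ‖gradBil p B‖ * (2 * K + 1 + 0) * δ := by ring
      _ ≤ ‖gradBil p B‖ * (2 * K + 1 + L) * δ := by gcongr
      _ ≤ Q * δ := by gcongr; rw [hQ]; linarith

end QuadraticRoots

/-! ### Expansion of the zeros of gradients of quadratic costs -/

section Expansion

variable {V W : Type*} [NormedAddCommGroup V] [NormedSpace ℝ V] [NormedAddCommGroup W]
  [NormedSpace ℝ W] {p : ℕ} {B : V →L[ℝ] V →L[ℝ] ℝ}

/-- The constant in the expansion of a zero. -/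
def expansionConst (a b κ K C : ℝ) : ℝ :=
  a * (b * (2 * κ ^ 2 + (κ * (C * b * κ ^ 2 + 1 + K) * (κ + κ * K) + κ ^ 2) * (C * b * κ ^ 2)))

set_option maxHeartbeats 1000000 in
-- Here `Ls` and `Lh` stand for the score maps at the true and at the estimated noise parameter, and
-- `T` for the mean derivative. The small quantities `α xs`, `α' xs - T` and `e` enter the remainder
-- only quadratically: passing from `Lh` to `Ls` costs `e` times `α xs`, which is itself small, and
-- the error of linearisation is a small coefficient times `x - xs`. This is why the error of the
-- noise parameter leaves no first-order trace.
theorem norm_root_expansion_le {α : Vec p → W} {α' : Vec p → Vec p →L[ℝ] W} {Ls Lh : W →L[ℝ] V}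
    {κ e ξ K C ρ : ℝ} {T : Vec p →L[ℝ] W} {xs x : Vec p} (he : 0 ≤ e) (hC : 0 ≤ C)
    (hLs : ‖Ls‖ ≤ κ) (hLh : ‖Lh‖ ≤ κ) (hLd : ‖Lh - Ls‖ ≤ κ * e)
    (hα : ∀ z ∈ Metric.closedBall xs ρ, HasFDerivAt α (α' z) z)
    (hαL : ∀ z ∈ Metric.closedBall xs ρ, ‖α' z - α' xs‖ ≤ ξ * ‖z - xs‖)
    (hαb : ∀ z ∈ Metric.closedBall xs ρ, ‖α' z‖ ≤ ξ) (hT : ‖T‖ ≤ K)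
    (hA : (gaussNewton p B (Ls ∘L T)).IsInvertible)
    (hx : ‖x - xs‖ ≤ ρ) (hroot : gradBil p B (Lh (α x)) (Lh ∘L α' x) = 0)
    (hxC : ‖x - xs‖ ≤ C * ‖gradBil p B (Lh (α xs)) (Lh ∘L α' xs)‖) :
    ‖(x - xs) + (gaussNewton p B (Ls ∘L T)).inverse (gradBil p B (Ls (α xs)) (Ls ∘L α' xs))‖ ≤
      expansionConst ‖(gaussNewton p B (Ls ∘L T)).inverse‖ ‖gradBil p B‖ κ K C *
        (‖α xs‖ + ‖α' xs - T‖ + e) ^ 2 * (1 + ξ) ^ 4 := by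
  set b := ‖gradBil p B‖ with hb
  set s := ‖α xs‖ with hs
  set s' := ‖α' xs - T‖ with hs'
  set q := s + s' + e with hq
  have hs0 : 0 ≤ s := norm_nonneg _
  have hs'0 : 0 ≤ s' := norm_nonneg _
  have hb0 : 0 ≤ b := norm_nonneg _
  have hκ : 0 ≤ κ := (norm_nonneg _).trans hLs
  have hK : 0 ≤ K := (norm_nonneg _).trans hT
  have hρ : 0 ≤ ρ := (norm_nonneg _).trans hx
  have hxs : xs ∈ Metric.closedBall xs ρ := Metric.mem_closedBall_self hρ
  have hxb : x ∈ Metric.closedBall xs ρ := mem_closedBall_iff_norm.2 hx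
  have hξ : 0 ≤ ξ := (norm_nonneg _).trans (hαb xs hxs)
  have hq0 : 0 ≤ q := by positivity
  have hsq : s ≤ q := by linarith
  have hs'q : s' ≤ q := by linarith
  have heq : e ≤ q := by linarith
  set Ξ := 1 + ξ with hΞ
  have hΞ1 : 1 ≤ Ξ := by linarith
  have hξΞ : ξ ≤ Ξ := by linarith
  have hcomp : ∀ (L : W →L[ℝ] V) (U : Vec p →L[ℝ] W) {a a' : ℝ}, ‖L‖ ≤ a → ‖U‖ ≤ a' →
      ‖L ∘L U‖ ≤ a * a' := fun L U a a' h1 h2 =>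
    (L.opNorm_comp_le U).trans (mul_le_mul h1 h2 (norm_nonneg _) ((norm_nonneg _).trans h1))
  have happ : ∀ (L : W →L[ℝ] V) (w : W) {a : ℝ}, ‖L‖ ≤ a → ‖L w‖ ≤ a * ‖w‖ := fun L w a h1 =>
    (L.le_opNorm w).trans (by gcongr)
  have hH : ‖gradBil p B (Lh (α xs)) (Lh ∘L α' xs)‖ ≤ b * κ ^ 2 * (q * Ξ) := by
    calc _ ≤ b * ‖Lh (α xs)‖ * ‖Lh ∘L α' xs‖ := (gradBil p B).le_opNorm₂ _ _
      _ ≤ b * (κ * s) * (κ * ξ) := by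
        gcongr
        · exact happ _ _ hLh
        · exact hcomp _ _ hLh (hαb xs hxs)
      _ = b * κ ^ 2 * (s * ξ) := by ring
      _ ≤ _ := by gcongr
  -- A first bound of order `q` on the root, fed back into the linearisation to make the remainder
  -- of order `q²`.
  have hΔ : ‖x - xs‖ ≤ C * b * κ ^ 2 * (q * Ξ) := by
    refine hxC.trans ?_
    rw [mul_assoc C, mul_assoc C]
    gcongr
  set C₂ := C * b * κ ^ 2 with hC₂
  have hC₂0 : 0 ≤ C₂ := by positivity
  set τ := κ * (C₂ + 1 + K) * (q * Ξ ^ 2) with hτ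
  have hsub : Metric.closedBall xs ‖x - xs‖ ⊆ Metric.closedBall xs ρ :=
    Metric.closedBall_subset_closedBall hx
  have hq1 : q ≤ q * Ξ ^ 2 := le_mul_of_one_le_right hq0 (one_le_pow₀ hΞ1)
  have h1 : ∀ z ∈ Metric.closedBall xs ‖x - xs‖, ‖Lh ∘L α' z - Ls ∘L T‖ ≤ τ := fun z hz => by
    have hz' : ‖z - xs‖ ≤ ‖x - xs‖ := mem_closedBall_iff_norm.1 hz
    have e1 : Lh ∘L α' z - Ls ∘L T =
        Lh ∘L (α' z - α' xs) + Lh ∘L (α' xs - T) + (Lh - Ls) ∘L T := by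
      simp only [ContinuousLinearMap.comp_sub, ContinuousLinearMap.sub_comp]; abel
    rw [e1]
    calc _ ≤ κ * (ξ * ‖z - xs‖) + κ * s' + κ * e * K :=
          norm_add₃_le.trans (add_le_add (add_le_add (hcomp _ _ hLh (hαL z (hsub hz)))
            (hcomp _ _ hLh le_rfl)) (hcomp _ _ hLd hT))
      _ ≤ κ * (Ξ * (C₂ * (q * Ξ))) + κ * q + κ * q * K := by
          gcongr
          exact hz'.trans hΔ
      _ = κ * (C₂ * (q * Ξ ^ 2) + q + K * q) := by ring
      _ ≤ κ * (C₂ * (q * Ξ ^ 2) + q * Ξ ^ 2 + K * (q * Ξ ^ 2)) := by gcongr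
      _ = τ := by rw [hτ]; ring
  have hLh' : ∀ z ∈ Metric.closedBall xs ‖x - xs‖,
      HasFDerivAt (fun z => Lh (α z)) (Lh ∘L α' z) z := fun z hz =>
    Lh.hasFDerivAt.comp z (hα z (hsub hz))
  have hrem := norm_gradBil_sub_sub_le (B := B) (h := fun z => Lh (α z))
    (h' := fun z => Lh ∘L α' z) (T := Ls ∘L T) (τ := τ) (κ := κ * ξ) (σ := κ * s) (L := κ * ξ)
    (convex_closedBall xs ‖x - xs‖) hLh' h1 (mem_closedBall_iff_norm.2 le_rfl)
    (Metric.mem_closedBall_self (norm_nonneg _)) (hcomp _ _ hLh (hαb x hxb)) (happ _ _ hLh)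
    (by
      rw [← ContinuousLinearMap.comp_sub, mul_assoc]
      exact hcomp _ _ hLh (hαL x hxb))
  rw [hroot, zero_sub] at hrem
  have hΞ3 : 1 ≤ Ξ ^ 3 := one_le_pow₀ hΞ1
  have hrem' : b * (τ * (κ * ξ) + ‖Ls ∘L T‖ * τ + κ * s * (κ * ξ)) * ‖x - xs‖ ≤
      b * ((κ * (C₂ + 1 + K) * (κ + κ * K) + κ ^ 2) * C₂) * (q ^ 2 * Ξ ^ 4) := by
    calc _ ≤ b * (τ * (κ * Ξ) + κ * K * τ * Ξ + κ * q * (κ * Ξ)) * (C₂ * (q * Ξ)) := by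
          have h2 : ‖Ls ∘L T‖ * τ ≤ κ * K * τ * Ξ := by
            have : ‖Ls ∘L T‖ ≤ κ * K := hcomp _ _ hLs hT
            calc ‖Ls ∘L T‖ * τ ≤ κ * K * τ := by gcongr
              _ ≤ κ * K * τ * Ξ := le_mul_of_one_le_right (by positivity) hΞ1
          gcongr
      _ = b * (κ * (C₂ + 1 + K) * (κ + κ * K) * (q * Ξ ^ 3) + κ ^ 2 * (q * Ξ)) * (C₂ * (q * Ξ)) := by
          rw [hτ]; ring
      _ ≤ b * (κ * (C₂ + 1 + K) * (κ + κ * K) * (q * Ξ ^ 3) + κ ^ 2 * (q * Ξ ^ 3)) *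
          (C₂ * (q * Ξ)) := by
          have : Ξ ≤ Ξ ^ 3 := le_self_pow₀ hΞ1 (by norm_num)
          gcongr
      _ = _ := by ring
  have hdiff : ‖gradBil p B (Ls (α xs)) (Ls ∘L α' xs) - gradBil p B (Lh (α xs)) (Lh ∘L α' xs)‖ ≤
      b * (2 * κ ^ 2) * (q ^ 2 * Ξ ^ 4) := by
    have e2 : gradBil p B (Ls (α xs)) (Ls ∘L α' xs) - gradBil p B (Lh (α xs)) (Lh ∘L α' xs) =
        -(gradBil p B ((Lh - Ls) (α xs)) (Lh ∘L α' xs) +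
          gradBil p B (Ls (α xs)) ((Lh - Ls) ∘L α' xs)) := by
      simp only [ContinuousLinearMap.sub_comp, map_sub, sub_apply]; abel
    rw [e2, norm_neg]
    calc _ ≤ b * ‖(Lh - Ls) (α xs)‖ * ‖Lh ∘L α' xs‖ + b * ‖Ls (α xs)‖ * ‖(Lh - Ls) ∘L α' xs‖ :=
          (norm_add_le _ _).trans (add_le_add ((gradBil p B).le_opNorm₂ _ _)
            ((gradBil p B).le_opNorm₂ _ _))
      _ ≤ b * (κ * e * s) * (κ * ξ) + b * (κ * s) * (κ * e * ξ) := by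
          gcongr
          · exact happ _ _ hLd
          · exact hcomp _ _ hLh (hαb xs hxs)
          · exact happ _ _ hLs
          · exact hcomp _ _ hLd (hαb xs hxs)
      _ = b * (2 * κ ^ 2) * (e * s * ξ) := by ring
      _ ≤ b * (2 * κ ^ 2) * (q * q * Ξ ^ 4) := by
          have : ξ ≤ Ξ ^ 4 := hξΞ.trans (le_self_pow₀ hΞ1 (by norm_num))
          gcongr
      _ = _ := by ring
  obtain ⟨A, hA⟩ := hA
  set R := gradBil p B (Lh (α xs)) (Lh ∘L α' xs) with hR
  set R₀ := gradBil p B (Ls (α xs)) (Ls ∘L α' xs) with hR₀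
  -- The score vanishes at `x`, so its increment from `xs` to `x` is `-R`. The expansion error is
  -- the inverse applied to the change of score map minus the error of linearisation.
  have e3 : (x - xs) + (gaussNewton p B (Ls ∘L T)).inverse R₀ =
      (gaussNewton p B (Ls ∘L T)).inverse
        ((R₀ - R) - (-R - gaussNewton p B (Ls ∘L T) (x - xs))) := by
    rw [← hA, ContinuousLinearMap.inverse_equiv]
    simp only [map_sub, map_neg, ContinuousLinearEquiv.coe_coe, ContinuousLinearEquiv.symm_apply_apply]
    abel
  rw [e3]
  calc _ ≤ ‖(gaussNewton p B (Ls ∘L T)).inverse‖ *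
        ‖(R₀ - R) - (-R - gaussNewton p B (Ls ∘L T) (x - xs))‖ := ContinuousLinearMap.le_opNorm _ _
    _ ≤ ‖(gaussNewton p B (Ls ∘L T)).inverse‖ * (b * (2 * κ ^ 2) * (q ^ 2 * Ξ ^ 4) +
        b * ((κ * (C₂ + 1 + K) * (κ + κ * K) + κ ^ 2) * C₂) * (q ^ 2 * Ξ ^ 4)) := by
        gcongr
        exact (norm_sub_le _ _).trans (add_le_add hdiff (hrem.trans hrem'))
    _ = _ := by rw [expansionConst]; ring

end Expansion

/-! ### The expansion of the estimator with a remainder of order `N⁻¹`. -/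

section StochasticExpansion

variable {V W : Type*} [NormedAddCommGroup V] [NormedSpace ℝ V] [NormedAddCommGroup W]
  [NormedSpace ℝ W] [FiniteDimensional ℝ W] {p r : ℕ} {B : V →L[ℝ] V →L[ℝ] ℝ}
  {Ω : Type*} [MeasurableSpace Ω] {P : Measure Ω} [IsProbabilityMeasure P]
  {G : Type*} [NormedAddCommGroup G] [NormedSpace ℝ G] [CompleteSpace G]
  {c : ℕ → G} {z : ℤ → Ω → ℝ} {X : ℕ → Ω → G}

/-- The noise parameter enters only through the linear map `L η` applied to averages that do not
involve it, and the means of these averages vanish at `θ*`. So uniform laws of large numbers are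
needed in `θ` alone. -/
theorem om_root_expansion (hX : IsSample c z P X) {D : Set (Vec p)} (hD : IsCompact D)
    {f : Vec p → G → W} {f' : Vec p → G → Vec p →L[ℝ] W} (hf : SPL D f f') {D₀ : Set (Vec p)}
    (hD₀ : IsCompact D₀) (hDD : D₀ ⊆ interior D) {θs : Vec p} (hθs : θs ∈ interior D₀)
    (hf0 : statMean c z P f θs = 0) {L : Vec r → W →L[ℝ] V} {Dη : Set (Vec r)} {ηs : Vec r}
    (hηs : ηs ∈ Dη) {κ : ℝ} (hLb : ∀ η ∈ Dη, ‖L η‖ ≤ κ)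
    (hLl : ∀ η ∈ Dη, ‖L η - L ηs‖ ≤ κ * ‖η - ηs‖)
    (huniq : ∀ θ ∈ D₀, gradBil p B (L ηs (statMean c z P f θ)) (L ηs ∘L statMean c z P f' θ) = 0 →
      θ = θs)
    (hA : (gaussNewton p B (L ηs ∘L statMean c z P f' θs)).IsInvertible)
    {ηhat : ℕ → Ω → Vec r} (hηD : ∀ N, 1 ≤ N → ∀ ω, ηhat N ω ∈ Dη)
    (hη : OM P (fun N ω => ‖ηhat N ω - ηs‖) (1 / 2)) {θhat : ℕ → Ω → Vec p}
    (hθm : ∀ N, 1 ≤ N → Measurable (θhat N)) (hθD : ∀ N, 1 ≤ N → ∀ ω, θhat N ω ∈ D₀)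
    (hroot : ∀ N, 1 ≤ N → ∀ ω, (∃! θ, θ ∈ D₀ ∧
      gradBil p B (L (ηhat N ω) (avg X f N θ ω)) (L (ηhat N ω) ∘L avg X f' N θ ω) = 0) →
      gradBil p B (L (ηhat N ω) (avg X f N (θhat N ω) ω))
        (L (ηhat N ω) ∘L avg X f' N (θhat N ω) ω) = 0) :
    (∀ N, AEStronglyMeasurable (fun ω => gradBil p B (L ηs (avg X f N θs ω))
      (L ηs ∘L avg X f' N θs ω)) P) ∧
    OM P (fun N ω => ‖(θhat N ω - θs) +
      (gaussNewton p B (L ηs ∘L statMean c z P f' θs)).inverse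
        (gradBil p B (L ηs (avg X f N θs ω)) (L ηs ∘L avg X f' N θs ω))‖) 1 := by
  have := FiniteDimensional.complete ℝ W
  have hsub : D₀ ⊆ D := hDD.trans interior_subset
  have hint : interior D₀ ⊆ interior D := interior_subset.trans hDD
  have hθ0 : θs ∈ D₀ := interior_subset hθs
  have hθ1 : θs ∈ D := hsub hθ0
  have hκ : 0 ≤ κ := (norm_nonneg _).trans (hLb ηs hηs)
  obtain ⟨K₁, hK₁, hf1, hf2⟩ := hf.pl.exists_statMean_bound hX.noise hX.decay
  obtain ⟨K₂, hK₂, hf1', hf2'⟩ := hf.pl'.exists_statMean_bound hX.noise hX.decay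
  obtain ⟨Y₁, hY₁, hY₁'⟩ := hf.pl.exists_unif hD.isBounded hX
  obtain ⟨Y₂, hY₂, hY₂'⟩ := hf.pl'.exists_unif hD.isBounded hX
  obtain ⟨ξ₁, hξ₁, hξ₁0, hξ₁b, -, -⟩ := hf.pl.exists_avg_bound hX
  obtain ⟨ξ₂, hξ₂, hξ₂0, hξ₂b, hξ₂L, Λ, hΛ⟩ := hf.pl'.exists_avg_bound hX
  obtain ⟨R, hR⟩ := hD₀.isBounded.subset_closedBall θs
  have happ : ∀ (M : W →L[ℝ] V) (w : W) {a a' : ℝ}, ‖M‖ ≤ a → ‖w‖ ≤ a' → ‖M w‖ ≤ a * a' :=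
    fun M w a a' h1 h2 => (M.le_opNorm w).trans
      (mul_le_mul h1 h2 (norm_nonneg _) ((norm_nonneg _).trans h1))
  have hcomp : ∀ (M : W →L[ℝ] V) (U : Vec p →L[ℝ] W) {a a' : ℝ}, ‖M‖ ≤ a → ‖U‖ ≤ a' →
      ‖M ∘L U‖ ≤ a * a' := fun M U a a' h1 h2 =>
    (M.opNorm_comp_le U).trans (mul_le_mul h1 h2 (norm_nonneg _) ((norm_nonneg _).trans h1))
  set b := ‖gradBil p B‖ with hb
  set Ai := (gaussNewton p B (L ηs ∘L statMean c z P f' θs)).inverse with hAi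
  have hm1 : ∀ N, AEStronglyMeasurable (fun ω => gradBil p B (L ηs (avg X f N θs ω))
      (L ηs ∘L avg X f' N θs ω)) P := fun N =>
    (gradBil p B).aestronglyMeasurable_comp₂
      ((L ηs).continuous.comp_aestronglyMeasurable (hf.pl.aestronglyMeasurable_avg hX hθ1 N))
      ((ContinuousLinearMap.compL ℝ (Vec p) W V (L ηs)).continuous.comp_aestronglyMeasurable
        (hf.pl'.aestronglyMeasurable_avg hX hθ1 N))
  refine ⟨hm1, ?_⟩
  obtain ⟨δ, ρ, C, hδ, hρ, hC, hball, key⟩ := exists_quadratic_root (B := B)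
    (g := fun θ => L ηs (statMean c z P f θ)) (g' := fun θ => L ηs ∘L statMean c z P f' θ)
    (K := κ * (K₁ + K₂)) hD₀ hθs
    (fun x hx => (L ηs).hasFDerivAt.comp x (hf.hasFDerivAt_statMean hX.noise hX.decay (hint hx)))
    (fun x hx => happ _ _ (hLb ηs hηs) ((hf1 x (hsub hx)).trans (by linarith)))
    (fun x hx => hcomp _ _ (hLb ηs hηs) ((hf1' x (hsub hx)).trans (by linarith)))
    (fun x hx y hy => by
      rw [← map_sub, mul_assoc]
      exact happ _ _ (hLb ηs hηs) ((hf2 x (hsub hx) y (hsub hy)).trans (by gcongr; linarith)))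
    (fun x hx y hy => by
      rw [← ContinuousLinearMap.comp_sub, mul_assoc]
      exact hcomp _ _ (hLb ηs hηs) ((hf2' x (hsub hx) y (hsub hy)).trans (by gcongr; linarith)))
    (by rw [hf0, map_zero]) huniq hA (L := κ * (|Λ| + 1)) (by positivity)
  -- The last summand controls the random Lipschitz constant of the derivative: when it is at most
  -- `1`, the deterministic bound `κ (|Λ| + 1)` demanded by the root lemma holds. Hence the
  -- threshold `min δ 1` below.
  let T : ℕ → Ω → ℝ := fun N ω => κ * (Y₁ N ω + Y₂ N ω) + κ * (K₁ + K₂) * ‖ηhat N ω - ηs‖ +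
    |ξ₂ N ω - Λ|
  have hT : OM P T (1 / 4) := (((hY₁.add hY₂).const_mul κ).add
    ((hη.of_le (by norm_num)).const_mul _)).add (hΛ.abs.of_le (by norm_num))
  let q : ℕ → Ω → ℝ := fun N ω => ‖avg X f N θs ω - statMean c z P f θs‖ +
    ‖avg X f' N θs ω - statMean c z P f' θs‖ + ‖ηhat N ω - ηs‖
  have hq : OM P q (1 / 2) := ((hf.pl.om_norm_avg_sub hX hθ1).add
    (hf.pl'.om_norm_avg_sub hX hθ1)).add hη
  have hmain : OM P (fun N ω => expansionConst ‖Ai‖ b κ K₂ C * q N ω ^ 2 * (1 + ξ₂ N ω) ^ 4) 1 := by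
    have h1 := ((hq.pow 2).const_mul (expansionConst ‖Ai‖ b κ K₂ C)).mul
      (((OM.const 1).add hξ₂).pow 4)
    convert h1 using 1
    norm_num
  have hbad : OM P (fun N ω => R + ‖Ai‖ * (b * κ ^ 2) * (ξ₁ N ω * ξ₂ N ω)) 0 := by
    have h1 := (OM.const (P := P) R).add (a := 0) (by simpa using (hξ₁.mul hξ₂).const_mul (‖Ai‖ * (b * κ ^ 2)))
    exact h1
  -- `T` is of order `N^{-1/4}`, so its fourth power yields the rate `N⁻¹` on the bad event.
  refine OM.of_good (k := 4) (δ := min δ 1) (by positivity) (fun N hN => ?_) hmain hbad hT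
    (by norm_num) (fun N hN => ?_) fun N hN => ae_of_all _ fun ω => ?_
  · exact ((((hθm N hN).sub_const _).aestronglyMeasurable).add
      (Ai.continuous.comp_aestronglyMeasurable (hm1 N))).norm
  · filter_upwards [hY₁' N hN, hY₂' N hN] with ω h1 h2 hTω
    have hY1 : 0 ≤ Y₁ N ω := (norm_nonneg _).trans (h1 θs hθ1)
    have hY2 : 0 ≤ Y₂ N ω := (norm_nonneg _).trans (h2 θs hθ1)
    have hη0 := hηD N hN ω
    set e := ‖ηhat N ω - ηs‖ with he
    have he0 : 0 ≤ e := norm_nonneg _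
    have hT1 : κ * (Y₁ N ω + Y₂ N ω) + κ * (K₁ + K₂) * e + |ξ₂ N ω - Λ| ≤ min δ 1 :=
      (le_abs_self _).trans hTω
    have hp1 : 0 ≤ κ * Y₁ N ω := by positivity
    have hp2 : 0 ≤ κ * Y₂ N ω := by positivity
    have hp3 : 0 ≤ κ * K₁ * e := by positivity
    have hp4 : 0 ≤ κ * K₂ * e := by positivity
    have hp5 : 0 ≤ |ξ₂ N ω - Λ| := abs_nonneg _
    have hTδ := hT1.trans (min_le_left _ _)
    have hT1' := hT1.trans (min_le_right _ _)
    have hξΛ : ξ₂ N ω ≤ |Λ| + 1 := by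
      have h3 := le_abs_self (ξ₂ N ω - Λ)
      have h4 := le_abs_self Λ
      linarith
    have hd := fun θ (hθ : θ ∈ interior D) => hf.hasFDerivAt_avg (X := X) N ω (interior_subset hθ)
    obtain ⟨hex, hloc⟩ := key (fun θ => L (ηhat N ω) (avg X f N θ ω))
      (fun θ => L (ηhat N ω) ∘L avg X f' N θ ω)
      (fun θ hθ => (L (ηhat N ω)).hasFDerivAt.comp θ (hd θ (hint hθ)))
      (fun θ hθ => by
        have e1 : L (ηhat N ω) (avg X f N θ ω) - L ηs (statMean c z P f θ) =
            L (ηhat N ω) (avg X f N θ ω - statMean c z P f θ) +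
              (L (ηhat N ω) - L ηs) (statMean c z P f θ) := by
          simp only [map_sub, sub_apply]; abel
        rw [e1]
        refine ((norm_add_le _ _).trans (add_le_add (happ _ _ (hLb _ hη0) (h1 θ (hsub hθ)))
          (happ _ _ (hLl _ hη0) (hf1 θ (hsub hθ))))).trans ?_
        rw [← he]
        linarith)
      (fun θ hθ => by
        have e1 : L (ηhat N ω) ∘L avg X f' N θ ω - L ηs ∘L statMean c z P f' θ =
            L (ηhat N ω) ∘L (avg X f' N θ ω - statMean c z P f' θ) +
              (L (ηhat N ω) - L ηs) ∘L (statMean c z P f' θ) := by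
          simp only [ContinuousLinearMap.comp_sub, ContinuousLinearMap.sub_comp]; abel
        rw [e1]
        refine ((norm_add_le _ _).trans (add_le_add (hcomp _ _ (hLb _ hη0) (h2 θ (hsub hθ)))
          (hcomp _ _ (hLl _ hη0) (hf1' θ (hsub hθ))))).trans ?_
        rw [← he]
        linarith)
      (fun θ hθ θ' hθ' => by
        rw [← ContinuousLinearMap.comp_sub, mul_assoc]
        exact hcomp _ _ (hLb _ hη0) ((hξ₂L N ω θ (hsub hθ) θ' (hsub hθ')).trans (by gcongr)))
    have hr := hroot N hN ω hex
    obtain ⟨hx1, hx2⟩ := hloc _ (hθD N hN ω) hr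
    have hbs : ∀ θ ∈ Metric.closedBall θs ρ, θ ∈ D := fun θ hθ => hsub (interior_subset (hball hθ))
    have hfin := norm_root_expansion_le (B := B) (α := fun θ => avg X f N θ ω)
      (α' := fun θ => avg X f' N θ ω) (Ls := L ηs) (Lh := L (ηhat N ω)) (ξ := ξ₂ N ω) (K := K₂)
      (T := statMean c z P f' θs) he0 hC (hLb ηs hηs) (hLb _ hη0) (hLl _ hη0)
      (fun θ hθ => hd θ (hint (hball hθ))) (fun θ hθ => hξ₂L N ω θ (hbs θ hθ) θs hθ1)
      (fun θ hθ => hξ₂b N ω θ (hbs θ hθ)) (hf1' θs hθ1) hA hx1 hr hx2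
    rw [abs_norm]
    refine hfin.trans ((le_of_eq ?_).trans (le_abs_self _))
    simp only [q, hf0, sub_zero]
    rfl
  · rw [abs_norm]
    refine le_trans ?_ (le_abs_self _)
    have h3 : ‖θhat N ω - θs‖ ≤ R := mem_closedBall_iff_norm.1 (hR (hθD N hN ω))
    refine (norm_add_le _ _).trans (add_le_add h3 ((Ai.le_opNorm _).trans ?_))
    rw [mul_assoc]
    gcongr
    calc _ ≤ b * ‖L ηs (avg X f N θs ω)‖ * ‖L ηs ∘L avg X f' N θs ω‖ := (gradBil p B).le_opNorm₂ _ _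
      _ ≤ b * (κ * ξ₁ N ω) * (κ * ξ₂ N ω) := by
          have h4 := hξ₁0 N ω
          gcongr
          · exact happ _ _ (hLb ηs hηs) (hξ₁b N ω θs hθ1)
          · exact hcomp _ _ (hLb ηs hηs) (hξ₂b N ω θs hθ1)
      _ = _ := by ring

end StochasticExpansion

/-! ### The system parameter stage -/

section Prod

variable {E G F₁ F₂ : Type*} [NormedAddCommGroup E] [NormedSpace ℝ E] [NormedAddCommGroup G]
  [NormedAddCommGroup F₁] [NormedSpace ℝ F₁] [NormedAddCommGroup F₂] [NormedSpace ℝ F₂] {D : Set E}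

theorem SPL.prodMk {f : E → G → F₁} {f' : E → G → E →L[ℝ] F₁} {g : E → G → F₂}
    {g' : E → G → E →L[ℝ] F₂} (hf : SPL D f f') (hg : SPL D g g') :
    SPL D (fun θ x => (f θ x, g θ x)) (fun θ x => (f' θ x).prod (g' θ x)) := by
  have h := (hf.clm (ContinuousLinearMap.inl ℝ F₁ F₂)).add (hg.clm (ContinuousLinearMap.inr ℝ F₁ F₂))
  refine ⟨?_, ?_, fun θ hθ x => (hf.deriv θ hθ x).prodMk (hg.deriv θ hθ x)⟩
  · convert h.pl using 3 with θ x
    simp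
  · convert h.pl' using 3 with θ x
    ext v <;> simp

end Prod

/-! ### The third-stage score, its stationary mean and its Hessian. -/

section SystemScore

variable {p d r M : ℕ} {S : SystemFamily p d} {w : ℝ} {D : Set (Vec p)} {u : Fin M → ℝ}

/-- A coordinate of a linear functional, as a complex number. -/
def complexCoord (j : Fin p) : (Vec p →L[ℝ] ℝ) →L[ℝ] ℂ :=
  Complex.ofRealCLM ∘L ContinuousLinearMap.apply ℝ ℝ (EuclideanSpace.single j (1 : ℝ))

theorem complexCoord_apply (j : Fin p) (f : Vec p →L[ℝ] ℝ) :
    complexCoord j f = (f (EuclideanSpace.single j 1) : ℂ) := rfl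

/-- The products of exponentials of the innovation and coordinates of its derivative, together
with these coordinates. -/
def scoreFun (S : SystemFamily p d) (w : ℝ) (u : Fin M → ℝ) (θ : Vec p)
    (x : (ℕ →ᵇ ℝ) →L[ℝ] ℝ) : (Fin M × Fin p → ℂ) × (Fin M × Fin p → ℂ) :=
  (fun kj => ContinuousLinearMap.mul ℝ ℂ (Complex.exp (Complex.I * u kj.1 * innovFun S w θ x))
      (complexCoord kj.2 (innovDeriv S w θ x)),
    fun kj => complexCoord kj.2 (innovDeriv S w θ x))

/-- The derivative of `scoreFun`. -/
def scoreDeriv (S : SystemFamily p d) (w : ℝ) (u : Fin M → ℝ) (θ : Vec p)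
    (x : (ℕ →ᵇ ℝ) →L[ℝ] ℝ) : Vec p →L[ℝ] (Fin M × Fin p → ℂ) × (Fin M × Fin p → ℂ) :=
  (ContinuousLinearMap.pi fun kj =>
      (ContinuousLinearMap.mul ℝ ℂ).precompR (Vec p)
        (Complex.exp (Complex.I * u kj.1 * innovFun S w θ x))
        (complexCoord kj.2 ∘L innovDeriv₂ S w θ x) +
      (ContinuousLinearMap.mul ℝ ℂ).precompL (Vec p) ((innovDeriv S w θ x).smulRight
        (Complex.I * u kj.1 * Complex.exp (Complex.I * u kj.1 * innovFun S w θ x)))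
        (complexCoord kj.2 (innovDeriv S w θ x))).prod
    (ContinuousLinearMap.pi fun kj => complexCoord kj.2 ∘L innovDeriv₂ S w θ x)

theorem scoreDeriv_fst (θ : Vec p) (x : (ℕ →ᵇ ℝ) →L[ℝ] ℝ) (v : Vec p) (kj : Fin M × Fin p) :
    (scoreDeriv S w u θ x v).1 kj = Complex.exp (Complex.I * u kj.1 * innovFun S w θ x) *
        (innovDeriv₂ S w θ x v (EuclideanSpace.single kj.2 1) : ℂ) +
      (innovDeriv S w θ x v : ℂ) *
        (Complex.I * u kj.1 * Complex.exp (Complex.I * u kj.1 * innovFun S w θ x)) *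
        (innovDeriv S w θ x (EuclideanSpace.single kj.2 1) : ℂ) := by
  simp [scoreDeriv, complexCoord_apply, ContinuousLinearMap.precompR_apply,
    ContinuousLinearMap.precompL_apply]

theorem spl_scoreFun (hD : IsCompact D) (hS : ∀ θ ∈ D, ContDiffAt ℝ 3 (S.weighted w) θ)
    (u : Fin M → ℝ) : SPL D (scoreFun S w u) (scoreDeriv S w u) := by
  have h1 := spl_innovFun hD hS
  have h2 := spl_innovDeriv hD hS
  exact (SPL.pi fun kj : Fin M × Fin p => (h1.expI (u kj.1)).bilin (h2.clm (complexCoord kj.2))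
    (ContinuousLinearMap.mul ℝ ℂ)).prodMk
      (SPL.pi fun kj : Fin M × Fin p => h2.clm (complexCoord kj.2))

/-- Multiplication of the blocks of a vector by scalars. -/
def blockMul (M p : ℕ) : (Fin M → ℂ) →L[ℝ] (Fin M × Fin p → ℂ) →L[ℝ] (Fin M × Fin p → ℂ) :=
  ContinuousLinearMap.mul ℝ (Fin M × Fin p → ℂ) ∘L
    ContinuousLinearMap.pi fun kj => ContinuousLinearMap.proj (R := ℝ) (φ := fun _ : Fin M => ℂ) kj.1

/-- The score in terms of `scoreFun` and the characteristic function. -/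
def scoreMap (p : ℕ) (φ : Fin M → ℂ) :
    ((Fin M × Fin p → ℂ) × (Fin M × Fin p → ℂ)) →L[ℝ] (Fin M × Fin p → ℂ) :=
  ContinuousLinearMap.fst ℝ _ _ - blockMul M p φ ∘L ContinuousLinearMap.snd ℝ _ _

theorem scoreMap_apply (φ : Fin M → ℂ) (x : (Fin M × Fin p → ℂ) × (Fin M × Fin p → ℂ))
    (kj : Fin M × Fin p) : scoreMap p φ x kj = x.1 kj - φ kj.1 * x.2 kj := rfl

theorem contDiff_scoreMap : ContDiff ℝ 2 (scoreMap (M := M) p) :=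
  (contDiff_const (c := ContinuousLinearMap.fst ℝ (Fin M × Fin p → ℂ) (Fin M × Fin p → ℂ))).sub
    (((ContinuousLinearMap.compL ℝ ((Fin M × Fin p → ℂ) × (Fin M × Fin p → ℂ)) (Fin M × Fin p → ℂ)
      (Fin M × Fin p → ℂ)).flip (ContinuousLinearMap.snd ℝ _ _)) ∘L blockMul M p).contDiff

variable {Ω : Type*} [MeasurableSpace Ω] {P : Measure Ω} {θs : Vec p} {z y : ℤ → Ω → ℝ}
  {F : NoiseFamily r}

namespace IsSetup

theorem scoreMean_eq (hs : IsSetup S θs z y P w D) (h : ℝ) (u : Fin M → ℝ) (N : ℕ) {θ : Vec p}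
    (hθ : θ ∈ interior D) (η : Vec r) (ω : Ω) : scoreMean S F h u y N θ η ω =
      scoreMap p (F.phiVec h u η) (avg (startedFunctional w y) (scoreFun S w u) N θ ω) := by
  rw [← avg_clm]
  ext kj
  simp only [scoreMean, avg, Pi.smul_apply, Finset.sum_apply, Complex.real_smul,
    Complex.ofReal_inv, Complex.ofReal_natCast]
  congr 1
  refine Finset.sum_congr rfl fun n _ => ?_
  rw [scoreMap_apply, hs.innov_eq (interior_subset hθ), hs.innovGrad_eq hθ, riesz_apply, sub_mul]
  rfl

theorem ecfCostGrad_eq (hs : IsSetup S θs z y P w D) (h : ℝ) (u : Fin M → ℝ)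
    (K : Matrix (Fin M × Fin p) (Fin M × Fin p) ℂ) (N : ℕ) {θ : Vec p} (hθ : θ ∈ interior D)
    (η : Vec r) (ω : Ω) : ecfCostGrad S F h u K y N θ η ω =
      gradBil p (weightedBil K)
        (scoreMap p (F.phiVec h u η) (avg (startedFunctional w y) (scoreFun S w u) N θ ω))
        (scoreMap p (F.phiVec h u η) ∘L
          avg (startedFunctional w y) (scoreDeriv S w u) N θ ω) := by
  have h1 : HasFDerivAt (fun τ => scoreMap p (F.phiVec h u η)
      (avg (startedFunctional w y) (scoreFun S w u) N τ ω)) _ θ :=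
    (scoreMap p (F.phiVec h u η)).hasFDerivAt.comp θ
      ((spl_scoreFun hs.compact hs.smooth u).hasFDerivAt_avg N ω (interior_subset hθ))
  rw [← gradient_quadratic (weightedBil_comm K) h1, ecfCostGrad]
  refine Filter.EventuallyEq.gradient_eq ?_
  filter_upwards [isOpen_interior.mem_nhds hθ] with τ hτ
  rw [weightedBil_self, ecfCost, hs.scoreMean_eq h u N hτ]

variable [IsProbabilityMeasure P]

theorem scoreExpectation_eq (hs : IsSetup S θs z y P w D) (h : ℝ) (u : Fin M → ℝ) {θ : Vec p}
    (hθ : θ ∈ interior D) (η : Vec r) : scoreExpectation S F h u P y θ η =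
      scoreMap p (F.phiVec h u η) (hs.mean (scoreFun S w u) θ) := by
  ext kj
  have h1 := (spl_scoreFun hs.compact hs.smooth u).pl.statMean_clm hs.noise hs.decay'
    (ContinuousLinearMap.proj (R := ℝ) (φ := fun _ : Fin M × Fin p => ℂ) kj ∘L
      scoreMap p (F.phiVec h u η)) (interior_subset hθ)
  rw [ContinuousLinearMap.comp_apply, ContinuousLinearMap.proj_apply] at h1
  rw [IsSetup.mean, ← h1, scoreExpectation]
  refine integral_congr_ae ?_
  filter_upwards [hs.ae_statInnov_eq, hs.ae_statInnovGrad_eq] with ω h2 h3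
  rw [statScore, h2 θ (interior_subset hθ), h3 θ hθ, riesz_apply, sub_mul]
  rfl

theorem gradient_ecfAsympCost_eq (hs : IsSetup S θs z y P w D) (h : ℝ) (u : Fin M → ℝ)
    (K : Matrix (Fin M × Fin p) (Fin M × Fin p) ℂ) {θ : Vec p} (hθ : θ ∈ interior D) (η : Vec r) :
    gradient (fun τ => ecfAsympCost S F h u P K y τ η) θ =
      gradBil p (weightedBil K) (scoreMap p (F.phiVec h u η) (hs.mean (scoreFun S w u) θ))
        (scoreMap p (F.phiVec h u η) ∘L hs.mean (scoreDeriv S w u) θ) := by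
  have h1 : HasFDerivAt (fun τ => scoreMap p (F.phiVec h u η) (hs.mean (scoreFun S w u) τ))
      (scoreMap p (F.phiVec h u η) ∘L hs.mean (scoreDeriv S w u) θ) θ :=
    (scoreMap p (F.phiVec h u η)).hasFDerivAt.comp θ
      ((spl_scoreFun hs.compact hs.smooth u).hasFDerivAt_statMean hs.noise hs.decay' hθ)
  rw [← gradient_quadratic (weightedBil_comm K) h1]
  refine Filter.EventuallyEq.gradient_eq ?_
  filter_upwards [isOpen_interior.mem_nhds hθ] with τ hτ
  rw [weightedBil_self, ecfAsympCost, hs.scoreExpectation_eq h u hτ]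

theorem continuous_exp_mul (v : ℝ) : Continuous fun t : ℝ => Complex.exp (Complex.I * v * t) := by
  fun_prop

theorem norm_exp_mul_le (v t : ℝ) : ‖Complex.exp (Complex.I * v * t)‖ ≤ 1 * (1 + |t|) := by
  have : Complex.I * v * t = ((v * t : ℝ) : ℂ) * Complex.I := by push_cast; ring
  rw [this, Complex.norm_exp_ofReal_mul_I]
  linarith [abs_nonneg t]

theorem norm_one_le (t : ℝ) : ‖(1 : ℂ)‖ ≤ 1 * (1 + |t|) := by
  rw [norm_one]
  linarith [abs_nonneg t]

/-- Each entry is a function of the present noise times a functional of the strict past. Both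
components vanish separately, so the mean score at `θ*` is zero whatever value of `η` is inserted.
-/
theorem mean_scoreFun_true (hs : IsSetup S θs z y P w D) (u : Fin M → ℝ) :
    hs.mean (scoreFun S w u) θs = 0 := by
  have hθs := interior_subset hs.mem
  have hspl := (spl_scoreFun hs.compact hs.smooth u).pl
  have hp := fun kj => hspl.statMean_clm hs.noise hs.decay'
    (ContinuousLinearMap.proj (R := ℝ) (φ := fun _ : Fin M × Fin p => ℂ) kj ∘L
      ContinuousLinearMap.fst ℝ (Fin M × Fin p → ℂ) (Fin M × Fin p → ℂ)) hθs
  have hp' := fun kj => hspl.statMean_clm hs.noise hs.decay'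
    (ContinuousLinearMap.proj (R := ℝ) (φ := fun _ : Fin M × Fin p => ℂ) kj ∘L
      ContinuousLinearMap.snd ℝ (Fin M × Fin p → ℂ) (Fin M × Fin p → ℂ)) hθs
  refine Prod.ext (funext fun kj => ?_) (funext fun kj => ?_)
  · exact (hp kj).symm.trans (hs.integral_mul_innovDeriv (continuous_exp_mul (u kj.1))
      (norm_exp_mul_le (u kj.1)) (EuclideanSpace.single kj.2 1))
  · refine (hp' kj).symm.trans (Eq.trans ?_ (hs.integral_mul_innovDeriv (f := fun _ => 1)
      continuous_const norm_one_le (EuclideanSpace.single kj.2 1)))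
    exact integral_congr_ae (ae_of_all _ fun ω => (one_mul _).symm)

/-- The terms with the second derivative of the innovation vanish by orthogonality, and the other
term contains the first derivative in the direction `v`. -/
theorem mean_scoreDeriv_apply_eq_zero (hs : IsSetup S θs z y P w D) (u : Fin M → ℝ) {v : Vec p}
    (hv : ∀ᵐ ω ∂P, innovDeriv S w θs (hs.stat ω) v = 0) :
    hs.mean (scoreDeriv S w u) θs v = 0 := by
  have hθs := interior_subset hs.mem
  have hspl := (spl_scoreFun hs.compact hs.smooth u).pl'
  have hp := fun kj => hspl.statMean_clm hs.noise hs.decay'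
    (ContinuousLinearMap.proj (R := ℝ) (φ := fun _ : Fin M × Fin p => ℂ) kj ∘L
      ContinuousLinearMap.fst ℝ (Fin M × Fin p → ℂ) (Fin M × Fin p → ℂ) ∘L
        ContinuousLinearMap.apply ℝ _ v) hθs
  have hp' := fun kj => hspl.statMean_clm hs.noise hs.decay'
    (ContinuousLinearMap.proj (R := ℝ) (φ := fun _ : Fin M × Fin p => ℂ) kj ∘L
      ContinuousLinearMap.snd ℝ (Fin M × Fin p → ℂ) (Fin M × Fin p → ℂ) ∘L
        ContinuousLinearMap.apply ℝ _ v) hθs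
  refine Prod.ext (funext fun kj => ?_) (funext fun kj => ?_)
  · refine (hp kj).symm.trans (Eq.trans ?_ (hs.integral_mul_innovDeriv₂
      (continuous_exp_mul (u kj.1)) (norm_exp_mul_le (u kj.1)) v (EuclideanSpace.single kj.2 1)))
    refine integral_congr_ae ?_
    filter_upwards [hv] with ω hω
    refine (scoreDeriv_fst θs (hs.stat ω) v kj).trans ?_
    rw [hω]
    simp
  · refine (hp' kj).symm.trans (Eq.trans ?_ (hs.integral_mul_innovDeriv₂ (f := fun _ => 1)
      continuous_const norm_one_le v (EuclideanSpace.single kj.2 1)))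
    exact integral_congr_ae (ae_of_all _ fun ω => (one_mul _).symm)

theorem ecfHessian_eq (hs : IsSetup S θs z y P w D) (h : ℝ) (u : Fin M → ℝ)
    (K : Matrix (Fin M × Fin p) (Fin M × Fin p) ℂ) (η : Vec r) :
    ecfHessian S F h u P K y θs η = gaussNewton p (weightedBil K)
      (scoreMap p (F.phiVec h u η) ∘L hs.mean (scoreDeriv S w u) θs) := by
  have hspl := spl_scoreFun hs.compact hs.smooth u
  obtain ⟨C, hC, -, hlip⟩ := hspl.pl'.exists_statMean_bound hs.noise hs.decay'
  set Φ := scoreMap p (F.phiVec h u η)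
  have h1 := hasFDerivAt_gradBil_of_zero (B := weightedBil K)
    (g := fun θ => Φ (hs.mean (scoreFun S w u) θ))
    (g' := fun θ => Φ ∘L hs.mean (scoreDeriv S w u) θ) (K := ‖Φ‖ * C) hs.mem
    (fun x hx => Φ.hasFDerivAt.comp x (hspl.hasFDerivAt_statMean hs.noise hs.decay' hx))
    (fun x hx x' hx' => by
      rw [← ContinuousLinearMap.comp_sub, mul_assoc]
      exact (Φ.opNorm_comp_le _).trans (by gcongr; exact hlip x hx x' hx'))
    (by rw [hs.mean_scoreFun_true, map_zero])
  refine (h1.congr_of_eventuallyEq ?_).fderiv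
  filter_upwards [isOpen_interior.mem_nhds hs.mem] with θ hθ
  exact hs.gradient_ecfAsympCost_eq h u K hθ η

/-- A degenerate direction of the innovation gradient is annihilated by the mean score derivative,
hence lies in the kernel of the Gauss-Newton Hessian. This supplies the nondegeneracy in the first
stage, where none is assumed. -/
theorem eq_zero_of_innovDeriv_eq_zero (hs : IsSetup S θs z y P w D) {h : ℝ} {u : Fin M → ℝ}
    {K : Matrix (Fin M × Fin p) (Fin M × Fin p) ℂ} {ηs : Vec r}
    (hR : (ecfHessian S F h u P K y θs ηs).IsInvertible) (v : Vec p)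
    (hv : ∀ᵐ ω ∂P, innovDeriv S w θs (hs.stat ω) v = 0) : v = 0 := by
  obtain ⟨A, hA⟩ := hR
  refine A.injective ?_
  rw [map_zero, ← ContinuousLinearEquiv.coe_coe, hA, hs.ecfHessian_eq, gaussNewton_apply,
    ContinuousLinearMap.comp_apply, hs.mean_scoreDeriv_apply_eq_zero u hv, map_zero, map_zero,
    zero_apply]

theorem om_ecfEstimator (hs : IsSetup S θs z y P w D) {h : ℝ} {ηs : Vec r} {Dη : Set (Vec r)}
    (hDη : IsCompact Dη) (hηs : ηs ∈ Dη) (hφ : ∀ u : ℝ, ∀ η ∈ Dη, ContDiffAt ℝ 2 (F.phi h u) η)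
    {Dθ : Set (Vec p)} (hDθ : IsCompact Dθ) (hDD : Dθ ⊆ interior D) (hθs : θs ∈ interior Dθ)
    (u : Fin M → ℝ) (K : Matrix (Fin M × Fin p) (Fin M × Fin p) ℂ)
    (hW : ∃ θ₀, ∀ θ ∈ Dθ, gradient (fun τ => ecfAsympCost S F h u P K y τ ηs) θ = 0 → θ = θ₀)
    (hR : (ecfHessian S F h u P K y θs ηs).IsInvertible) {ηhat : ℕ → Ω → Vec r}
    (hηD : ∀ N, 1 ≤ N → ∀ ω, ηhat N ω ∈ Dη) (hη : OM P (fun N ω => ‖ηhat N ω - ηs‖) (1 / 2))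
    {θhat : ℕ → Ω → Vec p} (hθhat : ∀ N, 1 ≤ N → IsRootEstimator Dθ
      (fun θ ω => ecfCostGrad S F h u K y N θ (ηhat N ω) ω) (θhat N)) :
    (∀ N, AEStronglyMeasurable (fun ω => ecfCostGrad S F h u K y N θs ηs ω) P) ∧
      OM P (fun N ω => ‖(θhat N ω - θs) + (ecfHessian S F h u P K y θs ηs).inverse
        (ecfCostGrad S F h u K y N θs ηs ω)‖) 1 := by
  have hθ0 : θs ∈ Dθ := interior_subset hθs
  obtain ⟨κ, hκ, hLb, hLl⟩ := exists_lipschitz_of_contDiffAt hDη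
    (b := fun η => scoreMap p (F.phiVec h u η)) fun η hη =>
      (contDiff_scoreMap.contDiffAt.comp η
        (NoiseFamily.contDiffAt_phiVec (fun v => hφ v η hη) u)).of_le (by norm_num)
  simp only [hs.ecfCostGrad_eq h u K _ hs.mem]
  rw [hs.ecfHessian_eq] at hR ⊢
  refine om_root_expansion hs.isSample hs.compact (spl_scoreFun hs.compact hs.smooth u) hDθ hDD hθs
    (hs.mean_scoreFun_true u) (L := fun η => scoreMap p (F.phiVec h u η)) hηs hLb
    (fun η hη => hLl η hη ηs hηs) (fun θ hθ h0 => ?_) hR hηD hη (fun N hN => (hθhat N hN).1)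
    (fun N hN => (hθhat N hN).2.1) fun N hN ω hex => ?_
  -- The unique critical point is identified as `θ*`, since the mean score, and with it the
  -- gradient, vanishes there.
  · obtain ⟨θ₀, hθ₀⟩ := hW
    rw [hθ₀ θ hθ ((hs.gradient_ecfAsympCost_eq h u K (hDD hθ) ηs).trans h0), ← hθ₀ θs hθ0]
    rw [hs.gradient_ecfAsympCost_eq h u K (hDD hθ0), hs.mean_scoreFun_true, map_zero, map_zero,
      zero_apply]
  · have h1 : ∀ θ ∈ Dθ, ecfCostGrad S F h u K y N θ (ηhat N ω) ω = _ := fun θ hθ =>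
      hs.ecfCostGrad_eq h u K N (hDD hθ) (ηhat N ω) ω
    exact (h1 _ ((hθhat N hN).2.1 ω)).symm.trans ((hθhat N hN).2.2 ω
      ((existsUnique_congr fun θ => and_congr_right fun hθ => by simp only [h1 θ hθ]).2 hex))

end IsSetup

end SystemScore

/-! ### The noise and the setup of the estimation problem -/

section Increments

variable {Ω : Type*} [MeasurableSpace Ω] {P : Measure Ω} [IsProbabilityMeasure P] {Z : ℝ → Ω → ℝ}
  {b h : ℝ} {ν : Measure ℝ}

theorem IsLevyProcess.isNoise_increment (hZ : IsLevyProcess Z P b ν) (hh : 0 < h)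
    (hν : IsFiniteVariationLevyMeasure ν) (hm : MomentCondition Z P h ν) :
    IsNoise (increment Z h) P where
  meas := hZ.measurable_increment h
  indep := hZ.iIndepFun_increment hh
  law := hZ.map_increment hh
  memLp := hZ.memLp_increment hh hν hm
  mean := hm.2

theorem IsLevyProcess.integral_exp_increment (hZ : IsLevyProcess Z P b ν) (hh : 0 < h) (n : ℤ)
    (u : ℝ) : ∫ ω, Complex.exp (Complex.I * u * increment Z h n ω) ∂P =
      Complex.exp (h * charExponent b ν u) := by
  rw [← hZ.charFun_increment hh n u, charFun_apply_real,
    integral_map (hZ.measurable_increment h n).aemeasurable (by fun_prop)]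
  refine integral_congr_ae (ae_of_all _ fun ω => ?_)
  simp only
  congr 1
  ring

end Increments

theorem exists_isSetup {Ω : Type*} [MeasurableSpace Ω] {P : Measure Ω} {p d : ℕ}
    {S : SystemFamily p d} {θs : Vec p} {z : ℤ → Ω → ℝ} (hz : IsNoise z P) {D : Set (Vec p)}
    (hD : IsCompact D) (hS : S.SmoothOn D) (hstab : S.StabilityCondition D) (hθs : θs ∈ D) :
    ∃ (w : ℝ) (D' : Set (Vec p)), IsSetup S θs z (output S θs z) P w D' ∧ D ⊆ interior D' := by
  obtain ⟨w, hw, D', hD', hDD, h⟩ := S.exists_weight hD hS fun θ hθ => (hstab θ hθ).2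
  obtain ⟨C, ρ, hρ0, hρ1, hC, hb⟩ := S.exists_abs_response_le (hstab θs hθs).1
  exact ⟨w, D', ⟨hz, hw, ⟨C, ρ, hC, hρ0, hρ1, hb⟩, rfl, hD', fun θ hθ => (h θ hθ).1,
    fun θ hθ => (h θ hθ).2, hDD hθs⟩, hDD⟩

end LevyECF

end

/-! ### The three stages combined. -/

theorem mainTheorem1 {Ω : Type*} [MeasurableSpace Ω] (P : Measure Ω) [IsProbabilityMeasure P]
    {p d r M M' : ℕ} (S : LevyECF.SystemFamily p d) (F : LevyECF.NoiseFamily r)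
    -- parameter sets and true parameters
    (Gθ Dθ Dθ' : Set (LevyECF.Vec p)) (Gη Dη Dη' : Set (LevyECF.Vec r))
    (θs : LevyECF.Vec p) (ηs : LevyECF.Vec r)
    (hDθ : IsCompact Dθ) (hDθ' : IsCompact Dθ') (hDη : IsCompact Dη) (hDη' : IsCompact Dη')
    (hθs : θs ∈ Dθ') (hDθ'D : Dθ' ⊆ interior Dθ) (hDθG : Dθ ⊆ Gθ)
    (hηs : ηs ∈ Dη') (hDη'D : Dη' ⊆ interior Dη) (hDηG : Dη ⊆ Gη)
    -- the driving Lévy process, its increments and the observed output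
    (h : ℝ) (hh : 0 < h)
    (hν : ∀ η ∈ Gη, LevyECF.IsFiniteVariationLevyMeasure (F.ν η))
    (Z : ℝ → Ω → ℝ) (hZ : LevyECF.IsLevyProcess Z P (F.b ηs) (F.ν ηs))
    (y : ℤ → Ω → ℝ) (hy : y = LevyECF.output S θs (LevyECF.increment Z h))
    -- smooth dependence on the parameters
    (hSmooth : S.SmoothOn Dθ)
    (hφ : ∀ u : ℝ, ∀ η ∈ Dη, ContDiffAt ℝ 2 (F.phi h u) η)
    -- stability, moment and zero-mean conditions
    (hStab : S.StabilityCondition Gθ)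
    (hMom : LevyECF.MomentCondition Z P h (F.ν ηs))
    -- first stage: identifiability, and the prediction error estimator
    (hPE : ∀ θ ∈ Dθ, gradient (LevyECF.peAsympCost S P y) θ = 0 → θ = θs)
    (θhat : ℕ → Ω → LevyECF.Vec p)
    (hθhat : ∀ N, 1 ≤ N → LevyECF.IsRootEstimator Dθ
      (fun θ ω => gradient (fun τ => LevyECF.peCost S y N τ ω) θ) (θhat N))
    -- second stage: uniqueness condition, and the estimator of the noise parameter
    (u' : Fin M' → ℝ) (K' : Matrix (Fin M') (Fin M') ℂ) (hK' : K'.PosDef)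
    (hE : ∀ η ∈ Dη, gradient (LevyECF.noiseAsympCost S F h u' P K' y θs) η = 0 → η = ηs)
    (hRE : (LevyECF.hessian (LevyECF.noiseAsympCost S F h u' P K' y θs) ηs).IsInvertible)
    (ηhat : ℕ → Ω → LevyECF.Vec r)
    (hηhat : ∀ N, 1 ≤ N → LevyECF.IsRootEstimator Dη
      (fun η ω => gradient (fun ζ => LevyECF.noiseCost S F h u' K' y N (θhat N ω) ζ ω) η)
      (ηhat N))
    -- third stage: uniqueness condition, nondegeneracy, and the final estimator
    (u : Fin M → ℝ) (K : Matrix (Fin M × Fin p) (Fin M × Fin p) ℂ) (hK : K.PosDef)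
    (hW : ∀ η ∈ Dη, ∃ θ₀ ∈ Dθ',
      gradient (fun τ => LevyECF.ecfAsympCost S F h u P K y τ η) θ₀ = 0 ∧
      ∀ θ ∈ Dθ, gradient (fun τ => LevyECF.ecfAsympCost S F h u P K y τ η) θ = 0 → θ = θ₀)
    (hR : (LevyECF.ecfHessian S F h u P K y θs ηs).IsInvertible)
    (θhathat : ℕ → Ω → LevyECF.Vec p)
    (hθhathat : ∀ N, 1 ≤ N → LevyECF.IsRootEstimator Dθ
      (fun θ ω => LevyECF.ecfCostGrad S F h u K y N θ (ηhat N ω) ω) (θhathat N)) :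
    LevyECF.IsOM P
      (fun N ω => (θhathat N ω - θs) -
        -((LevyECF.ecfHessian S F h u P K y θs ηs).inverse
          (LevyECF.ecfCostGrad S F h u K y N θs ηs ω)))
      (fun N => (N : ℝ)⁻¹) := by
  obtain ⟨w, D, hs, hDD⟩ := LevyECF.exists_isSetup
    (hZ.isNoise_increment hh (hν ηs (hDηG (interior_subset (hDη'D hηs)))) hMom) hDθ hSmooth
    (fun θ hθ => hStab θ (hDθG hθ)) (interior_subset (hDθ'D hθs))
  rw [← hy] at hs
  have hηi := hDη'D hηs
  have hθi := hDθ'D hθs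
  have hη0 := interior_subset hηi
  -- Nonsingularity of the third-stage Hessian is what makes the first-stage root nondegenerate.
  have h1 := hs.om_peEstimator hDθ hDD hθi (hs.eq_zero_of_innovDeriv_eq_zero hR) hPE hθhat
  have h2 := hs.om_noiseEstimator (hZ.integral_exp_increment hh 0) hDη hηi hφ u' K' hE hRE
    (fun N hN ω => interior_subset (hDD ((hθhat N hN).2.1 ω))) h1 hηhat
  obtain ⟨θ₀, -, -, hθ₀⟩ := hW ηs hη0
  obtain ⟨h3, h4⟩ := hs.om_ecfEstimator hDη hη0 hφ hDθ hDD hθi u K ⟨θ₀, hθ₀⟩ hR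
    (fun N hN => (hηhat N hN).2.1) h2 hθhathat
  simp only [sub_neg_eq_add]
  refine ⟨fun N hN => ((hθhathat N hN).1.sub_const _).aestronglyMeasurable.add
    (ContinuousLinearMap.continuous _ |>.comp_aestronglyMeasurable (h3 N)), fun q hq => ?_⟩
  obtain ⟨C, hC⟩ := h4.bound q hq
  exact ⟨C, fun N hN => by simpa only [Real.rpow_neg_one, eLpNorm_norm] using hC N hN⟩
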